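/- Let $a,\rho_0,S>0$, $K_1,\dots,K_n>0$, $M_1,\dots,M_n>0$, and let $\mathcal S=\{s_1,\dots,s_n\}\subset\mathbb R$ consist of $n$ distinct points. Let $\mathcal H=L^2(\mathbb R)\oplus L^2(\mathbb R)\oplus\mathbb C^n\oplus\mathbb C^n$, with elements $\Psi=(p,v,\underline y,\underline z)$, be the Hilbert space with scalar product $$\langle\langle\Psi_1,\Psi_2\rangle\rangle=\frac1{a^2\rho_0}\langle p_1,p_2\rangle+\rho_0\langle v_1,v_2\rangle+\frac1S\sum_{j=1}^n\left(K_j\bar y_{1j}y_{2j}+M_j\bar z_{1j}z_{2j}\right),$$ antilinear in the first argument. Let $A$ be the operator with domain $H^1(\mathbb R)\oplus H^1(\mathbb R)\oplus\mathbb C^n\oplus\mathbb C^n$ and $$A(p,v,\underline y,\underline z)=\left(-a^2\rho_0\,v',\,-\tfrac1{\rho_0}\,p',\,\underline z,\,-\sum_j\tfrac{K_j}{M_j}y_j\,\underline e_j\right),$$ and let $A_0$ be its restriction to the states with $v(s_j)=z_j$ for $1\le j\le n$. Let $T$ be an extension of $A_0$. We call $T$ skew-adjoint if it is densely defined and $T^*=-T$,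 and real if it commutes with complex conjugation. We say that $T$ has local conditions if there are linear subspaces $L_1,\dots,L_n\subset\mathbb C^5$ such that a state $\Psi\in D(A_0^*)$ belongs to $D(T)$ if and only if $(p(s_j^-),p(s_j^+),v(s_j),y_j,z_j)\in L_j$ for every $j$. We say that the $j$-th oscillator is free in $T$ if all states $(0,0,y\,\underline e_j,z\,\underline e_j)$ belong to $D(T)$ and $T$ maps them to $(0,0,z\,\underline e_j,-\frac{K_j}{M_j}y\,\underline e_j)$. We call $T$ local if it has local conditions and none of the $n$ oscillators is free in $T$, i.e. if $T$ couples, for every $j$, the fields at $s_j$ with the $j$-th oscillator, and couples nothing else. Theorem. There is exactly one local, real and skew-adjoint extension $\hat A$ of $A_0$. Its domain is $$D(\hat A)=\left\{(p,v,\underline y,\underline z):\ p\in L^2(\mathbb R)\cap H^1(\mathbb R\setminus\mathcal S),\ v\in H^1(\mathbb R),\ p(s_j^+)-p(s_j^-)=\sigma_j,\ v(s_j)=z_j\ (1\le j\le n),\ \underline\sigma\in\mathbb C^n\right\}$$ and it acts as $$\hat A(p,v,\underline y,\underline z)=\left(-a^2\rho_0\,v',\,-\tfrac1{\rho_0}\,p_0',\,\underline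 z,\,-\sum_j\Big(\tfrac{K_j}{M_j}y_j+\tfrac S{M_j}\sigma_j\Big)\underline e_j\right),$$ where $p_0(x)=p(x)-\frac12\sum_j\sigma_j\,\mathrm{sgn}(x-s_j)$ is locally square-integrable with distributional derivative $p_0'\in L^2(\mathbb R)$. If the oscillators are allowed to be free, then for every real and skew-adjoint extension $T$ of $A_0$ with local conditions and every $j$, either the $j$-th oscillator is free in $T$, or $v(s_j)=z_j$ for all states in $D(T)$. The operator $A$ is real, has local conditions, and is the only skew-adjoint extension of $A_0$ in which all oscillators are free. (Thus for $n=1$ the only real and skew-adjoint extensions of $A_0$ with local conditions are $A$ and $\hat A$.) For every $\zeta\in\mathbb C\setminus i\mathbb R$ the matrix $$\Gamma(\zeta)_{ij}=-\zeta\left(\pm\frac{e^{\mp\zeta|s_i-s_j|/a}}{2a\rho_0\zeta}+\frac{S\,\delta_{ij}}{K_j+\zeta^2M_j}\right),\qquad\pm\mathrm{Re}\,\zeta>0,$$ is invertible, $-A+\zeta$ and $-\hat A+\zeta$ have bounded inverses, and $$(-\hat A+\zeta)^{-1}=(-A+\zeta)^{-1}+\sum_{i,j=1}^n\left(\Gamma(\zeta)^{-1}\right)_{ij}\,G^i_\zeta\otimes\breve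 G^j_{\bar\zeta},\qquad (G\otimes\breve G)\Psi:=\langle\langle\breve G,\Psi\rangle\rangle\,G,$$ where $$\breve G^j_\zeta(x)=\left(\mathcal G'_\zeta(x-s_j),\ \tfrac{\zeta}{a^2\rho_0}\mathcal G_\zeta(x-s_j),\ \tfrac{S}{K_j+\zeta^2M_j}\underline e_j,\ \tfrac{-\zeta S}{K_j+\zeta^2M_j}\underline e_j\right),$$ $$G^j_\zeta(x)=\left(-\mathcal G'_\zeta(x-s_j),\ \tfrac{\zeta}{a^2\rho_0}\mathcal G_\zeta(x-s_j),\ \tfrac{-S}{K_j+\zeta^2M_j}\underline e_j,\ \tfrac{-\zeta S}{K_j+\zeta^2M_j}\underline e_j\right),$$ $$\mathcal G_\zeta(x)=\pm\frac a{2\zeta}e^{\mp\zeta|x|/a},\qquad \mathcal G'_\zeta(x)=-\frac12\,\mathrm{sgn}(x)\,e^{\mp\zeta|x|/a},\qquad\pm\mathrm{Re}\,\zeta>0.$$ -/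

import Mathlib

open MeasureTheory Filter Topology
open scoped ContDiff ComplexConjugate

noncomputable section

namespace Acoustic

/-- The complex space `L²(ℝ)`. -/
abbrev L2 : Type := Lp ℂ 2 (volume : Measure ℝ)

/-! ### Physical parameters and the Hilbert space of states -/

/-- The parameters of a pipe with `n` thin walls: sound velocity `a`, equilibrium density `ρ₀`,
cross section `S`, elastic constants `K j`, masses `M j`, and the (distinct) wall positions
`s j`. -/
structure Params (n : ℕ) where
  a : ℝ
  ρ₀ : ℝ
  S : ℝ
  K : Fin n → ℝ
  M : Fin n → ℝ
  s : Fin n → ℝ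
  a_pos : 0 < a
  ρ₀_pos : 0 < ρ₀
  S_pos : 0 < S
  K_pos : ∀ j, 0 < K j
  M_pos : ∀ j, 0 < M j
  s_inj : Function.Injective s

/-- The space `L²(ℝ) ⊕ L²(ℝ) ⊕ ℂⁿ ⊕ ℂⁿ` of states `(p, v, y, z)`; its inner product is
`energyForm`. -/
def State {n : ℕ} (_P : Params n) : Type :=
  L2 × L2 × (Fin n → ℂ) × (Fin n → ℂ)

variable {n : ℕ} {P : Params n}

instance : AddCommGroup (State P) :=
  inferInstanceAs (AddCommGroup (L2 × L2 × (Fin n → ℂ) × (Fin n → ℂ)))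

instance : Module ℂ (State P) :=
  inferInstanceAs (Module ℂ (L2 × L2 × (Fin n → ℂ) × (Fin n → ℂ)))

namespace State

/-- The state with given components. -/
def mk (p v : L2) (y z : Fin n → ℂ) : State P := (p, v, y, z)

/-- Pressure. -/
def p (Ψ : State P) : L2 := Prod.fst Ψ

/-- Velocity field. -/
def v (Ψ : State P) : L2 := Prod.fst (Prod.snd Ψ)

/-- Displacements of the walls. -/
def y (Ψ : State P) : Fin n → ℂ := Prod.fst (Prod.snd (Prod.snd Ψ))

/-- Velocities of the walls. -/
def z (Ψ : State P) : Fin n → ℂ := Prod.snd (Prod.snd (Prod.snd Ψ))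

theorem ext' {Ψ Φ : State P} (hp : Ψ.p = Φ.p) (hv : Ψ.v = Φ.v) (hy : Ψ.y = Φ.y)
    (hz : Ψ.z = Φ.z) : Ψ = Φ :=
  Prod.ext hp (Prod.ext hv (Prod.ext hy hz))

@[simp] theorem p_mk (p v : L2) (y z : Fin n → ℂ) : (mk p v y z : State P).p = p := rfl
@[simp] theorem v_mk (p v : L2) (y z : Fin n → ℂ) : (mk p v y z : State P).v = v := rfl
@[simp] theorem y_mk (p v : L2) (y z : Fin n → ℂ) : (mk p v y z : State P).y = y := rfl
@[simp] theorem z_mk (p v : L2) (y z : Fin n → ℂ) : (mk p v y z : State P).z = z := rfl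
@[simp] theorem p_zero : (0 : State P).p = 0 := rfl
@[simp] theorem v_zero : (0 : State P).v = 0 := rfl
@[simp] theorem y_zero : (0 : State P).y = 0 := rfl
@[simp] theorem z_zero : (0 : State P).z = 0 := rfl
@[simp] theorem p_add (Ψ Φ : State P) : (Ψ + Φ).p = Ψ.p + Φ.p := rfl
@[simp] theorem v_add (Ψ Φ : State P) : (Ψ + Φ).v = Ψ.v + Φ.v := rfl
@[simp] theorem y_add (Ψ Φ : State P) : (Ψ + Φ).y = Ψ.y + Φ.y := rfl
@[simp] theorem z_add (Ψ Φ : State P) : (Ψ + Φ).z = Ψ.z + Φ.z := rfl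
@[simp] theorem p_smul (c : ℂ) (Ψ : State P) : (c • Ψ).p = c • Ψ.p := rfl
@[simp] theorem v_smul (c : ℂ) (Ψ : State P) : (c • Ψ).v = c • Ψ.v := rfl
@[simp] theorem y_smul (c : ℂ) (Ψ : State P) : (c • Ψ).y = c • Ψ.y := rfl
@[simp] theorem z_smul (c : ℂ) (Ψ : State P) : (c • Ψ).z = c • Ψ.z := rfl

/-- Componentwise complex conjugation. -/
def conjugate (Ψ : State P) : State P :=
  mk (star Ψ.p) (star Ψ.v) (star Ψ.y) (star Ψ.z)

end State

/-- The energy scalar product, conjugate linear in the first argument. -/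
def energyForm (Ψ Φ : State P) : ℂ :=
  ((1 / (P.a ^ 2 * P.ρ₀) : ℝ) : ℂ) * inner ℂ Ψ.p Φ.p + (P.ρ₀ : ℂ) * inner ℂ Ψ.v Φ.v
    + ((1 / P.S : ℝ) : ℂ) * ∑ j, ((P.K j : ℂ) * (conj (Ψ.y j) * Φ.y j)
        + (P.M j : ℂ) * (conj (Ψ.z j) * Φ.z j))

theorem energyForm_self (Ψ : State P) : energyForm Ψ Ψ =
    ((1 / (P.a ^ 2 * P.ρ₀) * ‖Ψ.p‖ ^ 2 + P.ρ₀ * ‖Ψ.v‖ ^ 2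
      + 1 / P.S * ∑ j, (P.K j * ‖Ψ.y j‖ ^ 2 + P.M j * ‖Ψ.z j‖ ^ 2) : ℝ) : ℂ) := by
  simp only [energyForm, inner_self_eq_norm_sq_to_K, RCLike.conj_mul]
  push_cast
  rfl

/-- The energy scalar product is positive definite. -/
@[reducible] def energyCore (P : Params n) : InnerProductSpace.Core ℂ (State P) where
  inner := energyForm
  conj_inner_symm Ψ Φ := by
    simp only [energyForm, map_add, map_mul, map_sum, Complex.conj_ofReal, inner_conj_symm,
      Complex.conj_conj]
    congr 2
    refine Finset.sum_congr rfl fun j _ => ?_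
    ring
  re_inner_nonneg Ψ := by
    have ha := P.a_pos
    have hr := P.ρ₀_pos
    have hS := P.S_pos
    have hs : 0 ≤ ∑ j, (P.K j * ‖Ψ.y j‖ ^ 2 + P.M j * ‖Ψ.z j‖ ^ 2) :=
      Finset.sum_nonneg fun j _ => by
        have := P.K_pos j
        have := P.M_pos j
        positivity
    rw [energyForm_self]
    simp only [RCLike.re_to_complex, Complex.ofReal_re]
    positivity
  add_left Ψ Φ Ξ := by
    simp only [energyForm, State.p_add, State.v_add, State.y_add, State.z_add, inner_add_left,
      Pi.add_apply, map_add, add_mul, mul_add, Finset.sum_add_distrib]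
    ring
  smul_left Ψ Φ c := by
    simp only [energyForm, State.p_smul, State.v_smul, State.y_smul, State.z_smul,
      inner_smul_left, Pi.smul_apply, smul_eq_mul, map_mul, mul_add, Finset.mul_sum]
    congr 1
    · ring
    · refine Finset.sum_congr rfl fun j _ => ?_
      ring
  definite Ψ h := by
    have ha := P.a_pos
    have hr := P.ρ₀_pos
    have hS := P.S_pos
    have hj : ∀ j ∈ Finset.univ, 0 ≤ P.K j * ‖Ψ.y j‖ ^ 2 + P.M j * ‖Ψ.z j‖ ^ 2 := fun j _ => by
      have := P.K_pos j
      have := P.M_pos j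
      positivity
    have hs := Finset.sum_nonneg hj
    rw [energyForm_self, Complex.ofReal_eq_zero] at h
    have h1 : 0 ≤ 1 / (P.a ^ 2 * P.ρ₀) * ‖Ψ.p‖ ^ 2 := by positivity
    have h2 : 0 ≤ P.ρ₀ * ‖Ψ.v‖ ^ 2 := by positivity
    have h3 : 0 ≤ 1 / P.S * ∑ j, (P.K j * ‖Ψ.y j‖ ^ 2 + P.M j * ‖Ψ.z j‖ ^ 2) := by positivity
    have e1 : 1 / (P.a ^ 2 * P.ρ₀) * ‖Ψ.p‖ ^ 2 = 0 := by linarith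
    have e2 : P.ρ₀ * ‖Ψ.v‖ ^ 2 = 0 := by linarith
    have e3 : 1 / P.S * ∑ j, (P.K j * ‖Ψ.y j‖ ^ 2 + P.M j * ‖Ψ.z j‖ ^ 2) = 0 := by linarith
    have e4 : ∑ j, (P.K j * ‖Ψ.y j‖ ^ 2 + P.M j * ‖Ψ.z j‖ ^ 2) = 0 :=
      (mul_eq_zero.1 e3).resolve_left (by positivity)
    have e5 := (Finset.sum_eq_zero_iff_of_nonneg hj).1 e4
    refine State.ext' ?_ ?_ ?_ ?_
    · simpa using (mul_eq_zero.1 e1).resolve_left (by positivity)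
    · simpa using (mul_eq_zero.1 e2).resolve_left (by positivity)
    · funext j
      have hK := P.K_pos j
      have hM := P.M_pos j
      have a1 : 0 ≤ P.K j * ‖Ψ.y j‖ ^ 2 := by positivity
      have a2 : 0 ≤ P.M j * ‖Ψ.z j‖ ^ 2 := by positivity
      have a3 : P.K j * ‖Ψ.y j‖ ^ 2 = 0 := by linarith [e5 j (Finset.mem_univ j)]
      simpa using (mul_eq_zero.1 a3).resolve_left hK.ne'
    · funext j
      have hK := P.K_pos j
      have hM := P.M_pos j
      have a1 : 0 ≤ P.K j * ‖Ψ.y j‖ ^ 2 := by positivity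
      have a2 : 0 ≤ P.M j * ‖Ψ.z j‖ ^ 2 := by positivity
      have a3 : P.M j * ‖Ψ.z j‖ ^ 2 = 0 := by linarith [e5 j (Finset.mem_univ j)]
      simpa using (mul_eq_zero.1 a3).resolve_left hM.ne'

instance : NormedAddCommGroup (State P) :=
  @InnerProductSpace.Core.toNormedAddCommGroup ℂ (State P) _ _ _ (energyCore P)

instance : InnerProductSpace ℂ (State P) :=
  InnerProductSpace.ofCore (energyCore P).toCore

theorem inner_eq (Ψ Φ : State P) : inner ℂ Ψ Φ = energyForm Ψ Φ := rfl

theorem norm_sq_eq (Ψ : State P) : ‖Ψ‖ ^ 2 =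
    1 / (P.a ^ 2 * P.ρ₀) * ‖Ψ.p‖ ^ 2 + P.ρ₀ * ‖Ψ.v‖ ^ 2
      + 1 / P.S * ∑ j, (P.K j * ‖Ψ.y j‖ ^ 2 + P.M j * ‖Ψ.z j‖ ^ 2) := by
  have h := inner_self_eq_norm_sq_to_K (𝕜 := ℂ) Ψ
  rw [inner_eq, energyForm_self] at h
  exact (Complex.ofReal_injective (by rw [h]; push_cast; rfl)).symm

/-- A state as an element of the plain product. -/
def toProd (P : Params n) : State P ≃ₗ[ℂ] L2 × L2 × (Fin n → ℂ) × (Fin n → ℂ) :=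
  LinearEquiv.refl ℂ (L2 × L2 × (Fin n → ℂ) × (Fin n → ℂ))

theorem le_of_weight {c x N : ℝ} (hc : 0 < c) (hN : 0 ≤ N) (h : c * x ^ 2 ≤ N ^ 2) :
    x ≤ √(1 / c) * N := by
  have h1 : x ^ 2 ≤ 1 / c * N ^ 2 := by
    rw [one_div, inv_mul_eq_div, le_div_iff₀ hc]
    linarith
  calc x ≤ √(x ^ 2) := Real.le_sqrt_of_sq_le le_rfl
    _ ≤ √(1 / c * N ^ 2) := Real.sqrt_le_sqrt h1
    _ = √(1 / c) * N := by rw [Real.sqrt_mul (by positivity), Real.sqrt_sq hN]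

theorem weight_le (Ψ : State P) :
    (1 / (P.a ^ 2 * P.ρ₀) * ‖Ψ.p‖ ^ 2 ≤ ‖Ψ‖ ^ 2 ∧ P.ρ₀ * ‖Ψ.v‖ ^ 2 ≤ ‖Ψ‖ ^ 2) ∧
      ∀ j, P.K j / P.S * ‖Ψ.y j‖ ^ 2 ≤ ‖Ψ‖ ^ 2 ∧ P.M j / P.S * ‖Ψ.z j‖ ^ 2 ≤ ‖Ψ‖ ^ 2 := by
  have ha := P.a_pos
  have hr := P.ρ₀_pos
  have hS := P.S_pos
  have hj : ∀ j, 0 ≤ P.K j * ‖Ψ.y j‖ ^ 2 ∧ 0 ≤ P.M j * ‖Ψ.z j‖ ^ 2 := fun j => by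
    have := P.K_pos j
    have := P.M_pos j
    constructor <;> positivity
  have hs : ∀ j, P.K j * ‖Ψ.y j‖ ^ 2 + P.M j * ‖Ψ.z j‖ ^ 2
      ≤ ∑ j, (P.K j * ‖Ψ.y j‖ ^ 2 + P.M j * ‖Ψ.z j‖ ^ 2) := fun j =>
    Finset.single_le_sum (f := fun j => P.K j * ‖Ψ.y j‖ ^ 2 + P.M j * ‖Ψ.z j‖ ^ 2)
      (fun i _ => add_nonneg (hj i).1 (hj i).2) (Finset.mem_univ j)
  have hs0 : 0 ≤ ∑ j, (P.K j * ‖Ψ.y j‖ ^ 2 + P.M j * ‖Ψ.z j‖ ^ 2) :=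
    Finset.sum_nonneg fun i _ => add_nonneg (hj i).1 (hj i).2
  have h1 : 0 ≤ 1 / (P.a ^ 2 * P.ρ₀) * ‖Ψ.p‖ ^ 2 := by positivity
  have h2 : 0 ≤ P.ρ₀ * ‖Ψ.v‖ ^ 2 := by positivity
  have h3 : 0 ≤ 1 / P.S * ∑ j, (P.K j * ‖Ψ.y j‖ ^ 2 + P.M j * ‖Ψ.z j‖ ^ 2) := by positivity
  rw [norm_sq_eq]
  refine ⟨⟨by linarith, by linarith⟩, fun j => ?_⟩
  have hle : ∀ t, t ≤ P.K j * ‖Ψ.y j‖ ^ 2 + P.M j * ‖Ψ.z j‖ ^ 2 →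
      1 / P.S * t ≤ 1 / P.S * ∑ j, (P.K j * ‖Ψ.y j‖ ^ 2 + P.M j * ‖Ψ.z j‖ ^ 2) := fun t ht =>
    mul_le_mul_of_nonneg_left (ht.trans (hs j)) (by positivity)
  constructor
  · have := hle (P.K j * ‖Ψ.y j‖ ^ 2) (by linarith [(hj j).2])
    rw [show P.K j / P.S * ‖Ψ.y j‖ ^ 2 = 1 / P.S * (P.K j * ‖Ψ.y j‖ ^ 2) by ring]
    linarith
  · have := hle (P.M j * ‖Ψ.z j‖ ^ 2) (by linarith [(hj j).1])
    rw [show P.M j / P.S * ‖Ψ.z j‖ ^ 2 = 1 / P.S * (P.M j * ‖Ψ.z j‖ ^ 2) by ring]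
    linarith

theorem continuous_p : Continuous (State.p : State P → L2) :=
  AddMonoidHomClass.continuous_of_bound
    ({ toFun := State.p, map_add' := fun _ _ => rfl, map_smul' := fun _ _ => rfl } :
      State P →ₗ[ℂ] L2) _ fun Ψ =>
    le_of_weight (by have := P.a_pos; have := P.ρ₀_pos; positivity) (norm_nonneg Ψ)
      (weight_le Ψ).1.1

theorem continuous_v : Continuous (State.v : State P → L2) :=
  AddMonoidHomClass.continuous_of_bound
    ({ toFun := State.v, map_add' := fun _ _ => rfl, map_smul' := fun _ _ => rfl } :
      State P →ₗ[ℂ] L2) _ fun Ψ =>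
    le_of_weight P.ρ₀_pos (norm_nonneg Ψ) (weight_le Ψ).1.2

theorem continuous_y : Continuous (State.y : State P → Fin n → ℂ) :=
  continuous_pi fun j => AddMonoidHomClass.continuous_of_bound
    ({ toFun := fun Ψ => Ψ.y j, map_add' := fun _ _ => rfl, map_smul' := fun _ _ => rfl } :
      State P →ₗ[ℂ] ℂ) _ fun Ψ =>
    le_of_weight (div_pos (P.K_pos j) P.S_pos) (norm_nonneg Ψ) ((weight_le Ψ).2 j).1

theorem continuous_z : Continuous (State.z : State P → Fin n → ℂ) :=
  continuous_pi fun j => AddMonoidHomClass.continuous_of_bound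
    ({ toFun := fun Ψ => Ψ.z j, map_add' := fun _ _ => rfl, map_smul' := fun _ _ => rfl } :
      State P →ₗ[ℂ] ℂ) _ fun Ψ =>
    le_of_weight (div_pos (P.M_pos j) P.S_pos) (norm_nonneg Ψ) ((weight_le Ψ).2 j).2

/-- The energy norm induces the product topology. -/
def toProdL (P : Params n) : State P ≃L[ℂ] L2 × L2 × (Fin n → ℂ) × (Fin n → ℂ) where
  toLinearEquiv := toProd P
  continuous_toFun :=
    continuous_p.prodMk (continuous_v.prodMk (continuous_y.prodMk continuous_z))
  continuous_invFun := by
    refine continuous_of_continuousAt_zero (toProd P).symm ?_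
    have h : Continuous fun x : L2 × L2 × (Fin n → ℂ) × (Fin n → ℂ) =>
        √(1 / (P.a ^ 2 * P.ρ₀) * ‖x.1‖ ^ 2 + P.ρ₀ * ‖x.2.1‖ ^ 2
          + 1 / P.S * ∑ j, (P.K j * ‖x.2.2.1 j‖ ^ 2 + P.M j * ‖x.2.2.2 j‖ ^ 2)) := by
      fun_prop
    have h0 := h.tendsto 0
    rw [ContinuousAt, map_zero, tendsto_zero_iff_norm_tendsto_zero]
    have e : (fun x => ‖(toProd P).symm x‖) = fun x : L2 × L2 × (Fin n → ℂ) × (Fin n → ℂ) =>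
        √(1 / (P.a ^ 2 * P.ρ₀) * ‖x.1‖ ^ 2 + P.ρ₀ * ‖x.2.1‖ ^ 2
          + 1 / P.S * ∑ j, (P.K j * ‖x.2.2.1 j‖ ^ 2 + P.M j * ‖x.2.2.2 j‖ ^ 2)) := by
      funext x
      rw [← Real.sqrt_sq (norm_nonneg ((toProd P).symm x)), norm_sq_eq]
      rfl
    rw [e]
    simpa using h0

instance : CompleteSpace (State P) :=
  (completeSpace_congr (e := (toProdL P).toEquiv) (toProdL P).isUniformEmbedding).2 inferInstance

/-! ### Weak derivatives, Sobolev spaces and boundary values -/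

/-- `g` is the weak (distributional) derivative of `f` on the open set `U`. -/
def HasWeakDerivOn (U : Set ℝ) (f g : ℝ → ℂ) : Prop :=
  LocallyIntegrableOn f U ∧ LocallyIntegrableOn g U ∧
    ∀ φ : ℝ → ℝ, ContDiff ℝ ∞ φ → HasCompactSupport φ → tsupport φ ⊆ U →
      ∫ x, deriv φ x • f x = -∫ x, φ x • g x

theorem integrable_smul_of_locallyIntegrableOn {U : Set ℝ} {f : ℝ → ℂ}
    (hf : LocallyIntegrableOn f U) {φ : ℝ → ℝ} (hφ : Continuous φ) (hc : HasCompactSupport φ)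
    (hU : tsupport φ ⊆ U) : Integrable fun x => φ x • f x := by
  have h1 : IntegrableOn (fun x => φ x • f x) (tsupport φ) :=
    (hf.integrableOn_compact_subset hU hc).continuousOn_smul hφ.continuousOn hc
  refine (integrableOn_iff_integrable_of_support_subset ?_).1 h1
  exact (Function.support_smul_subset_left φ f).trans (subset_tsupport φ)

theorem HasWeakDerivOn.add {U : Set ℝ} {f g f' g' : ℝ → ℂ} (h : HasWeakDerivOn U f g)
    (h' : HasWeakDerivOn U f' g') : HasWeakDerivOn U (f + f') (g + g') := by
  refine ⟨h.1.add h'.1, h.2.1.add h'.2.1, fun φ hφ hc hU => ?_⟩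
  have hU' : tsupport (deriv φ) ⊆ U := (tsupport_deriv_subset (f := φ)).trans hU
  have hd : Continuous (deriv φ) := hφ.continuous_deriv (by simp)
  simp only [Pi.add_apply, smul_add]
  rw [integral_add (integrable_smul_of_locallyIntegrableOn h.1 hd hc.deriv hU')
      (integrable_smul_of_locallyIntegrableOn h'.1 hd hc.deriv hU'),
    integral_add (integrable_smul_of_locallyIntegrableOn h.2.1 hφ.continuous hc hU)
      (integrable_smul_of_locallyIntegrableOn h'.2.1 hφ.continuous hc hU),
    h.2.2 φ hφ hc hU, h'.2.2 φ hφ hc hU]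
  ring

theorem HasWeakDerivOn.smul {U : Set ℝ} {f g : ℝ → ℂ} (c : ℂ) (h : HasWeakDerivOn U f g) :
    HasWeakDerivOn U (c • f) (c • g) := by
  refine ⟨h.1.smul c, h.2.1.smul c, fun φ hφ hc hU => ?_⟩
  simp only [Pi.smul_apply, smul_comm _ c]
  rw [integral_smul, integral_smul, h.2.2 φ hφ hc hU, smul_neg]

theorem HasWeakDerivOn.congr {U : Set ℝ} {f g f' g' : ℝ → ℂ} (h : HasWeakDerivOn U f g)
    (hf : f =ᵐ[volume] f') (hg : g =ᵐ[volume] g') : HasWeakDerivOn U f' g' := by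
  refine ⟨h.1.congr (ae_restrict_of_ae hf), h.2.1.congr (ae_restrict_of_ae hg),
    fun φ hφ hc hU => ?_⟩
  rw [← integral_congr_ae (hf.mono fun x hx => by simp only [hx] :
      (fun x => deriv φ x • f x) =ᵐ[volume] fun x => deriv φ x • f' x),
    ← integral_congr_ae (hg.mono fun x hx => by simp only [hx] :
      (fun x => φ x • g x) =ᵐ[volume] fun x => φ x • g' x)]
  exact h.2.2 φ hφ hc hU

/-- The Sobolev space `H¹(U)`, for functions of `L²(ℝ)` and an open set `U` (below `U` is `ℝ` or
`ℝ` without finitely many points). -/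
def H1 (U : Set ℝ) : Submodule ℂ L2 where
  carrier := {f | ∃ g : L2, HasWeakDerivOn U f g}
  zero_mem' := by
    refine ⟨0, HasWeakDerivOn.congr (f := 0) (g := 0) ?_ (Lp.coeFn_zero _ _ _).symm
      (Lp.coeFn_zero _ _ _).symm⟩
    exact ⟨locallyIntegrableOn_zero, locallyIntegrableOn_zero, by simp⟩
  add_mem' := by
    rintro f f' ⟨g, hg⟩ ⟨g', hg'⟩
    exact ⟨g + g', (hg.add hg').congr (Lp.coeFn_add f f').symm (Lp.coeFn_add g g').symm⟩
  smul_mem' := by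
    rintro c f ⟨g, hg⟩
    exact ⟨c • g, (hg.smul c).congr (Lp.coeFn_smul c f).symm (Lp.coeFn_smul c g).symm⟩

theorem HasWeakDerivOn.unique {f : ℝ → ℂ} {g g' : L2} (h : HasWeakDerivOn Set.univ f g)
    (h' : HasWeakDerivOn Set.univ f g') : g = g' := by
  refine Lp.ext (ae_eq_of_integral_contDiff_smul_eq (locallyIntegrableOn_univ.1 h.2.1)
    (locallyIntegrableOn_univ.1 h'.2.1) fun φ hφ hc => ?_)
  have e := h.2.2 φ hφ hc (Set.subset_univ _)
  rw [h'.2.2 φ hφ hc (Set.subset_univ _)] at e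
  exact (neg_injective e).symm

/-- The weak derivative `d/dx : H¹(ℝ) → L²(ℝ)`. -/
def weakDeriv : L2 →ₗ.[ℂ] L2 where
  domain := H1 Set.univ
  toFun :=
    { toFun := fun f => f.2.choose
      map_add' := fun f f' => (f + f').2.choose_spec.unique
        ((f.2.choose_spec.add f'.2.choose_spec).congr (Lp.coeFn_add _ _).symm
          (Lp.coeFn_add _ _).symm)
      map_smul' := fun c f => (c • f).2.choose_spec.unique
        ((f.2.choose_spec.smul c).congr (Lp.coeFn_smul _ _).symm (Lp.coeFn_smul _ _).symm) }

theorem weakDeriv_spec (f : weakDeriv.domain) :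
    HasWeakDerivOn Set.univ (f : L2) (weakDeriv f) := f.2.choose_spec

/-- Limit of an almost everywhere defined function along `l`, disregarding null sets. Along
`𝓝[>] s` and `𝓝[<] s` this is the one-sided limit, and along `𝓝 s` the value at `s`, of the
representative of `f` which is continuous on the corresponding side of `s`, or around `s`. -/
def HasEssLimit (f : ℝ → ℂ) (l : Filter ℝ) (c : ℂ) : Prop :=
  Tendsto f (l ⊓ ae volume) (𝓝 c)

/-- `f(s⁺) - f(s⁻) = σ`. -/
def HasJump (f : ℝ → ℂ) (s : ℝ) (σ : ℂ) : Prop :=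
  ∃ cr cl : ℂ, HasEssLimit f (𝓝[>] s) cr ∧ HasEssLimit f (𝓝[<] s) cl ∧ cr - cl = σ

/-! ### The free generator and its restriction -/

/-- The free generator `A`, with domain `H¹(ℝ) ⊕ H¹(ℝ) ⊕ ℂⁿ ⊕ ℂⁿ`. -/
def freeGen (P : Params n) : State P →ₗ.[ℂ] State P where
  domain :=
    { carrier := {Ψ | Ψ.p ∈ weakDeriv.domain ∧ Ψ.v ∈ weakDeriv.domain}
      zero_mem' := ⟨Submodule.zero_mem _, Submodule.zero_mem _⟩
      add_mem' := fun h h' => ⟨Submodule.add_mem _ h.1 h'.1, Submodule.add_mem _ h.2 h'.2⟩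
      smul_mem' := fun c _ h => ⟨Submodule.smul_mem _ c h.1, Submodule.smul_mem _ c h.2⟩ }
  toFun :=
    { toFun := fun Ψ => State.mk
        (-(P.a ^ 2 * P.ρ₀ : ℂ) • weakDeriv ⟨Ψ.1.v, Ψ.2.2⟩)
        (-(1 / P.ρ₀ : ℂ) • weakDeriv ⟨Ψ.1.p, Ψ.2.1⟩)
        Ψ.1.z
        (fun j => -((P.K j / P.M j : ℂ) * Ψ.1.y j))
      map_add' := fun Ψ Φ => by
        refine State.ext' ?_ ?_ rfl ?_
        · exact (congrArg _ (weakDeriv.map_add ⟨Ψ.1.v, Ψ.2.2⟩ ⟨Φ.1.v, Φ.2.2⟩)).trans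
            (smul_add _ _ _)
        · exact (congrArg _ (weakDeriv.map_add ⟨Ψ.1.p, Ψ.2.1⟩ ⟨Φ.1.p, Φ.2.1⟩)).trans
            (smul_add _ _ _)
        · funext j
          simp
          ring
      map_smul' := fun c Ψ => by
        refine State.ext' ?_ ?_ rfl ?_
        · exact (congrArg _ (weakDeriv.map_smul c ⟨Ψ.1.v, Ψ.2.2⟩)).trans (smul_comm _ _ _)
        · exact (congrArg _ (weakDeriv.map_smul c ⟨Ψ.1.p, Ψ.2.1⟩)).trans (smul_comm _ _ _)
        · funext j
          simp
          ring }

/-- The states which satisfy `v(s_j) = z_j` at every wall. -/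
def kinematic (P : Params n) : Submodule ℂ (State P) where
  carrier := {Ψ | ∀ j, HasEssLimit Ψ.v (𝓝 (P.s j)) (Ψ.z j)}
  zero_mem' := fun _ => (tendsto_const_nhds (x := (0 : ℂ))).congr'
    (((Lp.coeFn_zero ℂ 2 volume).filter_mono inf_le_right).mono fun _ hx => hx.symm)
  add_mem' := fun {Ψ Φ} h h' j => ((h j).add (h' j)).congr'
    (((Lp.coeFn_add Ψ.v Φ.v).filter_mono inf_le_right).mono fun _ hx => hx.symm)
  smul_mem' := fun c Ψ h j => ((h j).const_smul c).congr'
    (((Lp.coeFn_smul c Ψ.v).filter_mono inf_le_right).mono fun _ hx => hx.symm)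

/-- The operator `A₀`: the restriction of `A` to the states with `v(s_j) = z_j` for all `j`. -/
def restrictedGen (P : Params n) : State P →ₗ.[ℂ] State P :=
  (freeGen P).domRestrict (kinematic P)

/-! ### Properties of extensions -/

/-- `T` is densely defined and `T* = -T`, for the energy scalar product. -/
def IsSkewAdjoint (T : State P →ₗ.[ℂ] State P) : Prop :=
  Dense (T.domain : Set (State P)) ∧ T.adjoint = -T

/-- `T` is real: it commutes with complex conjugation. -/
def IsReal (T : State P →ₗ.[ℂ] State P) : Prop :=
  ∀ Ψ : T.domain, ∃ h : (Ψ : State P).conjugate ∈ T.domain,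
    T ⟨(Ψ : State P).conjugate, h⟩ = (T Ψ).conjugate

/-- The extension `T` of `A₀` is singled out, among the states in the domain of `A₀*`, by linear
conditions imposed at each wall `j` separately, which involve only the fields at `s_j` and the
`j`-th oscillator: `(p(s_j⁻), p(s_j⁺), v(s_j), y_j, z_j) ∈ L j`. -/
def HasLocalConditions (T : State P →ₗ.[ℂ] State P) : Prop :=
  ∃ L : Fin n → Submodule ℂ (ℂ × ℂ × ℂ × ℂ × ℂ),
    ∀ Ψ ∈ (restrictedGen P).adjoint.domain, Ψ ∈ T.domain ↔
      ∀ j, ∃ pl pr vj : ℂ, HasEssLimit Ψ.p (𝓝[<] (P.s j)) pl ∧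
        HasEssLimit Ψ.p (𝓝[>] (P.s j)) pr ∧ HasEssLimit Ψ.v (𝓝 (P.s j)) vj ∧
        (pl, pr, vj, Ψ.y j, Ψ.z j) ∈ L j

/-- The state with fields at rest in which only the `j`-th oscillator is excited. -/
def oscillatorState (P : Params n) (j : Fin n) (y z : ℂ) : State P :=
  State.mk 0 0 (Pi.single j y) (Pi.single j z)

/-- The `j`-th oscillator is not coupled by `T` to the rest of the system: its states form a
subspace of the domain, on which `T` is the generator of the free oscillator. -/
def IsDecoupled (T : State P →ₗ.[ℂ] State P) (j : Fin n) : Prop :=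
  ∀ y z : ℂ, ∃ h : oscillatorState P j y z ∈ T.domain,
    T ⟨oscillatorState P j y z, h⟩ = oscillatorState P j z (-((P.K j / P.M j : ℂ) * y))

/-- `T` is local: for each `j` it couples the fields at `s_j` with the `j`-th oscillator, and it
generates no other coupling. -/
def IsLocal (T : State P →ₗ.[ℂ] State P) : Prop :=
  HasLocalConditions T ∧ ∀ j, ¬ IsDecoupled T j

/-- `R` is the bounded inverse `(-T + ζ)⁻¹`. -/
def IsResolvent (T : State P →ₗ.[ℂ] State P) (ζ : ℂ) (R : State P →L[ℂ] State P) : Prop :=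
  (∀ Ψ, ∃ h : R Ψ ∈ T.domain, -T ⟨R Ψ, h⟩ + ζ • R Ψ = Ψ) ∧
    ∀ Ψ : T.domain, R (-T Ψ + ζ • (Ψ : State P)) = Ψ

/-! ### The operator with point interactions -/

/-- The regular part `p₀(x) = p(x) - ½ ∑ σ_j sgn(x - s_j)` of the pressure. -/
def regularPart (P : Params n) (p : ℝ → ℂ) (σ : Fin n → ℂ) (x : ℝ) : ℂ :=
  p x - 1 / 2 * ∑ j, σ j * (Real.sign (x - P.s j) : ℂ)

/-- `T` is the operator `Â`: this describes its domain and its action, hence determines it. -/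
structure IsPointInteractionGen (P : Params n) (T : State P →ₗ.[ℂ] State P) : Prop where
  mem_domain_iff : ∀ Ψ : State P, Ψ ∈ T.domain ↔
    Ψ.p ∈ H1 (Set.range P.s)ᶜ ∧ Ψ.v ∈ H1 Set.univ ∧
      (∃ σ : Fin n → ℂ, ∀ j, HasJump Ψ.p (P.s j) (σ j)) ∧
      ∀ j, HasEssLimit Ψ.v (𝓝 (P.s j)) (Ψ.z j)
  apply_eq : ∀ (Ψ : T.domain) (σ : Fin n → ℂ), (∀ j, HasJump Ψ.1.p (P.s j) (σ j)) →
    ∃ dv dp₀ : L2, HasWeakDerivOn Set.univ Ψ.1.v dv ∧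
      HasWeakDerivOn Set.univ (regularPart P Ψ.1.p σ) dp₀ ∧
      T Ψ = State.mk (-(P.a ^ 2 * P.ρ₀ : ℂ) • dv) (-(1 / P.ρ₀ : ℂ) • dp₀) Ψ.1.z
        (fun j => -((P.K j / P.M j : ℂ) * Ψ.1.y j + (P.S / P.M j : ℂ) * σ j))

/-! ### The ingredients of the resolvent formula -/

/-- The sign `±` with `± Re ζ > 0`. -/
def reSign (ζ : ℂ) : ℂ := if 0 < ζ.re then 1 else -1

/-- `𝒢_ζ(x) = ± (a / 2ζ) exp(∓ ζ |x| / a)`. -/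
def green (P : Params n) (ζ : ℂ) (x : ℝ) : ℂ :=
  reSign ζ * (P.a / (2 * ζ)) * Complex.exp (-(reSign ζ * ζ * (|x| : ℝ) / P.a))

/-- `𝒢'_ζ(x) = - ½ sgn(x) exp(∓ ζ |x| / a)`. -/
def green' (P : Params n) (ζ : ℂ) (x : ℝ) : ℂ :=
  -(1 / 2) * (Real.sign x : ℂ) * Complex.exp (-(reSign ζ * ζ * (|x| : ℝ) / P.a))

/-- The matrix `Γ(ζ)`. -/
def gammaMatrix (P : Params n) (ζ : ℂ) : Matrix (Fin n) (Fin n) ℂ :=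
  Matrix.of fun i j => -ζ * (reSign ζ *
      (Complex.exp (-(reSign ζ * ζ * (|P.s i - P.s j| : ℝ) / P.a)) / (2 * P.a * P.ρ₀ * ζ))
    + P.S * (if i = j then 1 else 0) / (P.K j + ζ ^ 2 * P.M j))

theorem integrable_exp_neg_abs {c : ℝ} (hc : 0 < c) :
    Integrable fun x : ℝ => Real.exp (-c * |x|) := by
  have h1 : IntegrableOn (fun x : ℝ => Real.exp (-c * |x|)) (Set.Ioi 0) :=
    (integrableOn_exp_mul_Ioi (neg_lt_zero.2 hc) 0).congr_fun
      (fun x hx => by simp [abs_of_pos (Set.mem_Ioi.1 hx)]) measurableSet_Ioi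
  have h2 : IntegrableOn (fun x : ℝ => Real.exp (-c * |x|)) (Set.Iic 0) := by
    rw [integrableOn_Iic_iff_integrableOn_Iio]
    have h := (Measure.measurePreserving_neg (volume : Measure ℝ)).integrableOn_comp_preimage
      (Homeomorph.neg ℝ).measurableEmbedding (f := fun x : ℝ => Real.exp (-c * |x|))
      (s := Set.Ioi 0)
    simpa [Function.comp_def] using h.2 h1
  rw [← integrableOn_univ, ← Set.Iic_union_Ioi (a := (0 : ℝ))]
  exact h2.union h1

theorem norm_exp_green (P : Params n) (ζ : ℂ) (x : ℝ) :
    ‖Complex.exp (-(reSign ζ * ζ * (|x| : ℝ) / P.a))‖ = Real.exp (-(|ζ.re| / P.a) * |x|) := by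
  rw [Complex.norm_exp, Complex.neg_re, Complex.div_ofReal_re, Complex.re_mul_ofReal]
  congr 1
  unfold reSign
  split_ifs with h
  · rw [abs_of_pos h]
    simp
    ring
  · rw [abs_of_nonpos (not_lt.1 h)]
    simp
    ring

theorem memLp_exp_green (P : Params n) {ζ : ℂ} (hζ : ζ.re ≠ 0) :
    MemLp (fun x : ℝ => Complex.exp (-(reSign ζ * ζ * (|x| : ℝ) / P.a))) 2 volume := by
  have hc : 0 < 2 * (|ζ.re| / P.a) := by
    have := P.a_pos
    have := abs_pos.2 hζ
    positivity
  rw [memLp_two_iff_integrable_sq_norm (by fun_prop)]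
  refine (integrable_exp_neg_abs hc).congr (ae_of_all _ fun x => ?_)
  simp only [norm_exp_green, ← Real.exp_nat_mul]
  congr 1
  push_cast
  ring

theorem memLp_green (P : Params n) {ζ : ℂ} (hζ : ζ.re ≠ 0) (s : ℝ) :
    MemLp (fun x => green P ζ (x - s)) 2 volume :=
  ((memLp_exp_green P hζ).const_mul _).comp_measurePreserving (measurePreserving_sub_right _ s)

theorem memLp_green' (P : Params n) {ζ : ℂ} (hζ : ζ.re ≠ 0) (s : ℝ) :
    MemLp (fun x => green' P ζ (x - s)) 2 volume := by
  have h : MemLp (green' P ζ) 2 volume := by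
    refine (memLp_exp_green P hζ).of_le ?_ (ae_of_all _ fun x => ?_)
    · have : Measurable Real.sign := by
        unfold Real.sign
        exact Measurable.ite measurableSet_Iio measurable_const
          (Measurable.ite measurableSet_Ioi measurable_const measurable_const)
      unfold green'
      fun_prop
    · rw [green', norm_mul]
      refine mul_le_of_le_one_left (norm_nonneg _) ?_
      rcases Real.sign_apply_eq x with h | h | h <;> rw [h] <;> norm_num
  exact h.comp_measurePreserving (measurePreserving_sub_right _ s)

/-- The vector `G^j_ζ`. -/
def vecG (P : Params n) {ζ : ℂ} (hζ : ζ.re ≠ 0) (j : Fin n) : State P :=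
  State.mk (-(memLp_green' P hζ (P.s j)).toLp)
    ((ζ / (P.a ^ 2 * P.ρ₀) : ℂ) • (memLp_green P hζ (P.s j)).toLp)
    (Pi.single j (-P.S / (P.K j + ζ ^ 2 * P.M j)))
    (Pi.single j (-ζ * P.S / (P.K j + ζ ^ 2 * P.M j)))

/-- The vector `Ğ^j_ζ`. -/
def vecGbreve (P : Params n) {ζ : ℂ} (hζ : ζ.re ≠ 0) (j : Fin n) : State P :=
  State.mk (memLp_green' P hζ (P.s j)).toLp
    ((ζ / (P.a ^ 2 * P.ρ₀) : ℂ) • (memLp_green P hζ (P.s j)).toLp)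
    (Pi.single j (P.S / (P.K j + ζ ^ 2 * P.M j)))
    (Pi.single j (-ζ * P.S / (P.K j + ζ ^ 2 * P.M j)))

theorem conj_re_ne_zero {ζ : ℂ} (hζ : ζ.re ≠ 0) : (conj ζ).re ≠ 0 := by
  simpa using hζ

/-- The operator `∑_{i,j} (Γ(ζ)⁻¹)_{ij} G^i_ζ ⊗ Ğ^j_{ζ̄}`, where
`(G ⊗ Ğ) Ψ = ⟨⟨Ğ, Ψ⟩⟩ G`. -/
def kreinTerm (P : Params n) {ζ : ℂ} (hζ : ζ.re ≠ 0) : State P →L[ℂ] State P :=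
  ∑ i, ∑ j, (gammaMatrix P ζ)⁻¹ i j •
    InnerProductSpace.rankOne ℂ (vecG P hζ i) (vecGbreve P (conj_re_ne_zero hζ) j)

end Acoustic

end

open Acoustic

/-! The theorem is a boundary-value argument for the maximal operator `B = -A₀*`. An element of its
domain has a velocity in `H¹(ℝ)` and a pressure in `H¹` off the walls, so it carries two numbers at
each wall: the jump `σ_j` of the pressure and the slip `δ_j = v(s_j) - z_j`. Integration by parts
gives Green's identity (`green_identity`): for states with data `(σ, δ)` and `(τ, ε)`, `⟨⟨BΨ,Φ⟩⟩ +
⟨⟨Ψ,BΦ⟩⟩ = ∑ (conj δ_j τ_j + conj σ_j ε_j)`. The data can be prescribed arbitrarily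
(`exists_maximalRel_of_traces`). Every skew-adjoint extension is therefore a restriction of `B`
whose boundary data are a maximal null space of this form; `σ = 0` gives `A` and `δ = 0` gives `Â`.

Local conditions allow the data of a state at one wall to be cut out, with zero data at all other
walls (`HasLocalConditions.exists_single`). Suppose that some state in the domain has `δ_j ≠ 0`.
Pairing its cut-out with the conjugate state, which is available by reality, gives `2 conj (δ_j σ_j)
= 0`, so `σ_j = 0`; pairing it with an arbitrary state of the domain shows that no such state has a
jump at `s_j`. The free states of the `j`-th oscillator, whose only datum is a slip at `s_j`, then
pair to zero with the whole domain and belong to it by maximality. This is the dichotomy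
`isDecoupled_or_kinematic`. A skew-adjoint operator has no proper skew-adjoint extension
(`IsSkewAdjoint.eq_of_le`), so one inclusion suffices for uniqueness.

For the resolvent, `G^i_ζ` is an eigenvector of `B` for `ζ`, with unit jump at `s_i` and slips
`-Γ(ζ)_{ij}`. The state `(-A+ζ)⁻¹Ψ` has no jumps, and by Green's identity its slips are
`⟨⟨Ğ^j_{ζ̄},Ψ⟩⟩`; adding the combination of the `G^i_ζ` which cancels them gives a state in `D(Â)`
without changing the image under `-B+ζ`. A null vector of `Γ(ζ)` would be an eigenvector of `Â` off
the imaginary axis, so `Γ(ζ)` is invertible. -/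

namespace Acoustic

/-! ### Primitives of locally integrable functions -/

/-- `f` is a primitive of the locally integrable function `g`. -/
structure IsPrimitive (f g : ℝ → ℂ) : Prop where
  locallyIntegrable : LocallyIntegrable g
  sub_eq : ∀ a b, f b - f a = ∫ t in a..b, g t

namespace IsPrimitive

theorem intervalIntegrable_of_locallyIntegrable {g : ℝ → ℂ} (hg : LocallyIntegrable g)
    (a b : ℝ) : IntervalIntegrable g volume a b :=
  intervalIntegrable_iff.mpr
    ((hg.integrableOn_isCompact isCompact_uIcc).mono_set Set.uIoc_subset_uIcc)

theorem eq_add {f g : ℝ → ℂ} (h : IsPrimitive f g) (a : ℝ) :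
    f = fun x => f a + ∫ t in a..x, g t := by
  funext x
  rw [← h.sub_eq a x]
  ring

theorem of_integral {g : ℝ → ℂ} (hg : LocallyIntegrable g) (a : ℝ) :
    IsPrimitive (fun x => ∫ t in a..x, g t) g :=
  ⟨hg, fun _ _ => intervalIntegral.integral_interval_sub_left
    (intervalIntegrable_of_locallyIntegrable hg _ _)
    (intervalIntegrable_of_locallyIntegrable hg _ _)⟩

theorem continuous {f g : ℝ → ℂ} (h : IsPrimitive f g) : Continuous f := by
  rw [h.eq_add 0]
  exact continuous_const.add (intervalIntegral.continuous_primitive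
    (fun a b => intervalIntegrable_of_locallyIntegrable h.locallyIntegrable a b) 0)

theorem add {f g f' g' : ℝ → ℂ} (h : IsPrimitive f g) (h' : IsPrimitive f' g') :
    IsPrimitive (f + f') (g + g') := by
  refine ⟨h.locallyIntegrable.add h'.locallyIntegrable, fun a b => ?_⟩
  simp only [Pi.add_apply]
  rw [intervalIntegral.integral_add
    (intervalIntegrable_of_locallyIntegrable h.locallyIntegrable a b)
    (intervalIntegrable_of_locallyIntegrable h'.locallyIntegrable a b), ← h.sub_eq, ← h'.sub_eq]
  ring

theorem const (c : ℂ) : IsPrimitive (fun _ => c) 0 :=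
  ⟨locallyIntegrable_zero, fun a b => by simp⟩

/-- The increments of `f` are bounded by those of the primitive of `‖g‖`, which is absolutely
continuous. -/
theorem absolutelyContinuousOnInterval {f g : ℝ → ℂ} (h : IsPrimitive f g) (a b : ℝ) :
    AbsolutelyContinuousOnInterval f a b := by
  have hI : ∀ x y, IntervalIntegrable (fun t => ‖g t‖) volume x y := fun x y =>
    (intervalIntegrable_of_locallyIntegrable h.locallyIntegrable x y).norm
  have hG := (hI a b).absolutelyContinuousOnInterval_intervalIntegral (c := a) Set.left_mem_uIcc
  refine squeeze_zero (fun E => Finset.sum_nonneg fun _ _ => dist_nonneg)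
    (fun E => Finset.sum_le_sum fun i _ => ?_) hG
  rw [dist_comm, dist_eq_norm, h.sub_eq, dist_comm, Real.dist_eq,
    intervalIntegral.integral_interval_sub_left (hI _ _) (hI _ _)]
  exact intervalIntegral.norm_integral_le_abs_integral_norm

theorem ae_hasDerivAt {f g : ℝ → ℂ} (h : IsPrimitive f g) :
    ∀ᵐ x, HasDerivAt f (g x) x := by
  filter_upwards [_root_.LocallyIntegrable.ae_hasDerivAt_integral h.locallyIntegrable] with x hx
  rw [h.eq_add 0]
  exact (hx 0).const_add _

theorem locallyIntegrable_mul_continuous {f g : ℝ → ℂ} (hg : LocallyIntegrable g)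
    (hf : Continuous f) : LocallyIntegrable (fun x => g x * f x) :=
  hg.smul_continuous hf

/-- The product rule for primitives. -/
theorem mul {f g f' g' : ℝ → ℂ} (h : IsPrimitive f g) (h' : IsPrimitive f' g') :
    IsPrimitive (fun x => f x * f' x) (fun x => g x * f' x + g' x * f x) := by
  have hl : LocallyIntegrable fun x => g x * f' x + g' x * f x :=
    (locallyIntegrable_mul_continuous h.locallyIntegrable h'.continuous).add
      (locallyIntegrable_mul_continuous h'.locallyIntegrable h.continuous)
  refine ⟨hl, fun a b => ?_⟩
  have hI := of_integral hl a
  -- The product minus the integral of the candidate derivative is absolutely continuous with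
  -- derivative zero almost everywhere, hence constant.
  have hAC := ((h.absolutelyContinuousOnInterval a b).smul
    (h'.absolutelyContinuousOnInterval a b)).sub (hI.absolutelyContinuousOnInterval a b)
  obtain ⟨C, hC⟩ := hAC.const_of_ae_hasDerivAt_zero (by
    filter_upwards [h.ae_hasDerivAt, h'.ae_hasDerivAt, hI.ae_hasDerivAt] with x h1 h2 h3 _
    have h4 := (h1.mul h2).sub h3
    have e : g x * f' x + f x * g' x - (g x * f' x + g' x * f x) = 0 := by ring
    rw [e] at h4
    exact h4)
  have h1 := hC a Set.left_mem_uIcc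
  have h2 := hC b Set.right_mem_uIcc
  simp only [Pi.sub_apply, smul_eq_mul, Pi.mul_apply, intervalIntegral.integral_same] at h1 h2
  linear_combination h2 - h1

theorem of_hasDerivAt {f g : ℝ → ℂ} (h : ∀ x, HasDerivAt f (g x) x) (hg : Continuous g) :
    IsPrimitive f g :=
  ⟨hg.locallyIntegrable, fun a b => (intervalIntegral.integral_eq_sub_of_hasDerivAt
    (fun x _ => h x) (hg.intervalIntegrable a b)).symm⟩

/-- Integrability of `g` gives a limit of `f`; integrability of `f` on sets of infinite measure
forces that limit to be zero. -/
theorem tendsto_atTop_zero {f g : ℝ → ℂ} (h : IsPrimitive f g) (hf : Integrable f)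
    (hg : Integrable g) : Tendsto f atTop (𝓝 0) := by
  have h1 : Tendsto f atTop (𝓝 (f 0 + ∫ t in Set.Ioi 0, g t)) := by
    rw [h.eq_add 0]
    exact (intervalIntegral_tendsto_integral_Ioi 0 hg.integrableOn tendsto_id).const_add _
      |>.trans_eq (by simp)
  have h2 : f 0 + ∫ t in Set.Ioi 0, g t = 0 := by
    refine (hf.integrableAtFilter atTop).eq_zero_of_tendsto (fun s hs => ?_) h1
    rcases mem_atTop_sets.1 hs with ⟨b, hb⟩
    rw [← top_le_iff, ← Real.volume_Ici (a := b)]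
    exact measure_mono hb
  rwa [h2] at h1

theorem tendsto_atBot_zero {f g : ℝ → ℂ} (h : IsPrimitive f g) (hf : Integrable f)
    (hg : Integrable g) : Tendsto f atBot (𝓝 0) := by
  have h1 : Tendsto f atBot (𝓝 (f 0 - ∫ t in Set.Iic 0, g t)) := by
    have := (intervalIntegral_tendsto_integral_Iic 0 hg.integrableOn tendsto_id).const_sub (f 0)
    refine this.congr fun x => ?_
    rw [← h.sub_eq]
    simp
  have h2 : f 0 - ∫ t in Set.Iic 0, g t = 0 := by
    refine (hf.integrableAtFilter atBot).eq_zero_of_tendsto (fun s hs => ?_) h1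
    rcases mem_atBot_sets.1 hs with ⟨b, hb⟩
    rw [← top_le_iff, ← Real.volume_Iic (a := b)]
    exact measure_mono hb
  rwa [h2] at h1

theorem integral_Ioi {f g : ℝ → ℂ} (h : IsPrimitive f g) (hf : Integrable f)
    (hg : Integrable g) (s : ℝ) : ∫ x in Set.Ioi s, g x = -f s := by
  have h1 := intervalIntegral_tendsto_integral_Ioi s hg.integrableOn tendsto_id
  have h2 := (h.tendsto_atTop_zero hf hg).sub_const (f s)
  rw [zero_sub] at h2
  exact tendsto_nhds_unique h1 (h2.congr fun x => h.sub_eq _ _)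

theorem integral_Iic {f g : ℝ → ℂ} (h : IsPrimitive f g) (hf : Integrable f)
    (hg : Integrable g) (s : ℝ) : ∫ x in Set.Iic s, g x = f s := by
  have h1 := intervalIntegral_tendsto_integral_Iic s hg.integrableOn tendsto_id
  have h2 := (h.tendsto_atBot_zero hf hg).const_sub (f s)
  rw [sub_zero] at h2
  exact tendsto_nhds_unique h1 (h2.congr fun x => h.sub_eq _ _)

/-- If a function and its derivative are integrable, then the derivative has integral zero. -/
theorem integral_eq_zero {f g : ℝ → ℂ} (h : IsPrimitive f g) (hf : Integrable f)
    (hg : Integrable g) : ∫ x, g x = 0 := by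
  rw [← intervalIntegral.integral_Iic_add_Ioi hg.integrableOn (b := 0) hg.integrableOn,
    h.integral_Iic hf hg, h.integral_Ioi hf hg, add_neg_cancel]

/-- Each half-line contributes `-f s`. This is the source of every jump term: it expresses that
`sign` has distributional derivative twice a delta, and it evaluates the pairing with the Green
function. -/
theorem integral_sign_mul {f g : ℝ → ℂ} (h : IsPrimitive f g) (hf : Integrable f)
    (hg : Integrable g) (s : ℝ) : ∫ x, (Real.sign (x - s) : ℂ) * g x = -2 * f s := by
  have e1 : (fun x => (Real.sign (x - s) : ℂ) * g x) =ᵐ[volume.restrict (Set.Iic s)]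
      fun x => -g x := by
    rw [Filter.EventuallyEq, ← restrict_Iio_eq_restrict_Iic, ae_restrict_iff' measurableSet_Iio]
    refine ae_of_all _ fun x hx => ?_
    rw [Real.sign_of_neg (sub_neg.2 hx)]
    simp
  have e2 : (fun x => (Real.sign (x - s) : ℂ) * g x) =ᵐ[volume.restrict (Set.Ioi s)] g := by
    rw [Filter.EventuallyEq, ae_restrict_iff' measurableSet_Ioi]
    refine ae_of_all _ fun x hx => ?_
    rw [Real.sign_of_pos (sub_pos.2 hx)]
    simp
  rw [← intervalIntegral.integral_Iic_add_Ioi (b := s)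
      (hg.integrableOn.neg.congr e1.symm) (hg.integrableOn.congr e2.symm),
    integral_congr_ae e1, integral_congr_ae e2, integral_neg, h.integral_Iic hf hg,
    h.integral_Ioi hf hg]
  ring

/-- Fundamental theorem of calculus, with a countable set of exceptional points. -/
theorem of_hasDerivAt_off_countable {f g : ℝ → ℂ} {N : Set ℝ} (hN : N.Countable)
    (hf : Continuous f) (h : ∀ x ∉ N, HasDerivAt f (g x) x) (hg : LocallyIntegrable g) :
    IsPrimitive f g :=
  ⟨hg, fun a b => (integral_eq_of_hasDerivAt_off_countable f g hN hf.continuousOn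
    (fun x hx => h x hx.2) (intervalIntegrable_of_locallyIntegrable hg a b)).symm⟩

theorem of_test {φ : ℝ → ℝ} (hφ : ContDiff ℝ ∞ φ) :
    IsPrimitive (fun x => ((φ x : ℝ) : ℂ)) (fun x => ((deriv φ x : ℝ) : ℂ)) :=
  of_hasDerivAt (fun x => ((hφ.differentiable (by simp)).differentiableAt.hasDerivAt).ofReal_comp)
    (Complex.continuous_ofReal.comp (hφ.continuous_deriv (by simp)))

/-- A primitive has the given function as its weak derivative. -/
theorem hasWeakDerivOn {f g : ℝ → ℂ} (h : IsPrimitive f g) : HasWeakDerivOn Set.univ f g := by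
  have hf : LocallyIntegrableOn f Set.univ :=
    locallyIntegrableOn_univ.2 h.continuous.locallyIntegrable
  have hg : LocallyIntegrableOn g Set.univ := locallyIntegrableOn_univ.2 h.locallyIntegrable
  refine ⟨hf, hg, fun φ hφ hc hU => ?_⟩
  have hd : Continuous (deriv φ) := hφ.continuous_deriv (by simp)
  have i1 := integrable_smul_of_locallyIntegrableOn hf hd hc.deriv (Set.subset_univ _)
  have i2 := integrable_smul_of_locallyIntegrableOn hg hφ.continuous hc (Set.subset_univ _)
  have i3 := integrable_smul_of_locallyIntegrableOn hf hφ.continuous hc (Set.subset_univ _)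
  have e := ((of_test hφ).mul h).integral_eq_zero
    (by simpa only [Complex.real_smul] using i3)
    ((i1.add i2).congr (ae_of_all _ fun x => by
      simp only [Pi.add_apply, Complex.real_smul, mul_comm]))
  have e' : ∫ x, (deriv φ x • f x + φ x • g x) = 0 := by
    rw [← e]
    refine integral_congr_ae (ae_of_all _ fun x => ?_)
    simp only [Complex.real_smul]
    ring
  rw [integral_add i1 i2] at e'
  exact eq_neg_of_add_eq_zero_left e'

end IsPrimitive

/-! ### Functions with a weak derivative on the line -/

/-- A smooth function with compact support and vanishing integral is the derivative of a smooth
function with compact support. -/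
theorem exists_deriv_eq_of_integral_eq_zero {ψ : ℝ → ℝ} (hψ : ContDiff ℝ ∞ ψ)
    (hc : HasCompactSupport ψ) (h0 : ∫ x, ψ x = 0) :
    ∃ φ : ℝ → ℝ, ContDiff ℝ ∞ φ ∧ HasCompactSupport φ ∧ deriv φ = ψ := by
  obtain ⟨r, hr⟩ := hc.isCompact.isBounded.subset_closedBall 0
  have hz : ∀ x, r < |x| → ψ x = 0 := fun x hx => by
    by_contra hne
    have := hr (subset_tsupport _ hne)
    simp at this
    linarith
  have hI : Integrable ψ := hψ.continuous.integrable_of_hasCompactSupport hc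
  -- The base point lies to the left of the support of `ψ` (the absolute value covers a negative
  -- `r`). Beyond `|r| + 1` the primitive equals the full integral of `ψ`, which vanishes.
  have hd : ∀ x, HasDerivAt (fun x => ∫ t in (-|r| - 1)..x, ψ t) (ψ x) x := fun x =>
    intervalIntegral.integral_hasDerivAt_right hI.intervalIntegrable
      (hψ.continuous.stronglyMeasurableAtFilter _ _) hψ.continuous.continuousAt
  have hde : deriv (fun x => ∫ t in (-|r| - 1)..x, ψ t) = ψ := funext fun x => (hd x).deriv
  refine ⟨fun x => ∫ t in (-|r| - 1)..x, ψ t, ?_, ?_, hde⟩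
  · rw [contDiff_infty_iff_deriv, hde]
    exact ⟨fun x => (hd x).differentiableAt, hψ⟩
  · refine HasCompactSupport.of_support_subset_isCompact
      (isCompact_Icc (a := -|r| - 1) (b := |r| + 1)) fun x hx => ?_
    by_contra hx'
    apply hx
    have hr' := le_abs_self r
    rw [Set.mem_Icc, not_and_or, not_le, not_le] at hx'
    rcases hx' with h | h
    · refine intervalIntegral.integral_zero_ae (ae_of_all _ fun t ht => hz t ?_)
      rw [Set.uIoc_of_ge h.le] at ht
      rw [abs_of_neg (by linarith [ht.2, abs_nonneg r])]
      linarith [ht.2]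
    · rw [← h0]
      have hxr : -|r| - 1 ≤ x := by linarith [abs_nonneg r]
      simp only
      rw [intervalIntegral.integral_of_le hxr]
      refine setIntegral_eq_integral_of_forall_compl_eq_zero fun t ht => hz t ?_
      rw [Set.mem_Ioc, not_and_or, not_lt, not_le] at ht
      rcases ht with ht | ht
      · rw [abs_of_neg (by linarith [abs_nonneg r])]
        linarith
      · rw [abs_of_pos (by linarith [abs_nonneg r])]
        linarith

/-- The lemma of du Bois-Reymond. -/
theorem HasWeakDerivOn.ae_const {f : ℝ → ℂ} (h : HasWeakDerivOn Set.univ f 0) :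
    ∃ c : ℂ, f =ᵐ[volume] fun _ => c := by
  have hf := locallyIntegrableOn_univ.1 h.1
  let χ : ContDiffBump (0 : ℝ) := ⟨1, 2, by norm_num, by norm_num⟩
  have hχ : ContDiff ℝ ∞ (χ.normed volume) := χ.contDiff_normed
  have hχc : HasCompactSupport (χ.normed volume) := χ.hasCompactSupport_normed
  have hfi : ∀ φ : ℝ → ℝ, Continuous φ → HasCompactSupport φ →
      Integrable fun x => φ x • f x := fun φ hφ hc =>
    integrable_smul_of_locallyIntegrableOn h.1 hφ hc (Set.subset_univ _)
  refine ⟨∫ x, χ.normed volume x • f x, ae_eq_of_integral_contDiff_smul_eq hf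
    (locallyIntegrable_const _) fun φ hφ hc => ?_⟩
  -- Subtracting from `φ` its integral times the normalised bump leaves a derivative of a test
  -- function, on which `f` integrates to zero. So `f` acts on `φ` as the constant `∫ χ f`.
  obtain ⟨Φ, hΦ, hΦc, hd⟩ := exists_deriv_eq_of_integral_eq_zero
    (ψ := fun x => φ x - (∫ t, φ t) * χ.normed volume x)
    (hφ.sub (contDiff_const.mul hχ)) (hc.sub hχc.mul_left) (by
      rw [integral_sub (hφ.continuous.integrable_of_hasCompactSupport hc)
        ((hχ.continuous.integrable_of_hasCompactSupport hχc).const_mul _), integral_const_mul,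
        χ.integral_normed]
      simp)
  have e := h.2.2 Φ hΦ hΦc (Set.subset_univ _)
  rw [hd] at e
  simp only [Pi.zero_apply, smul_zero, integral_zero, neg_zero, sub_smul, mul_smul] at e
  rw [integral_sub (hfi φ hφ.continuous hc) (g := fun x => (∫ t, φ t) • (χ.normed volume x • f x))
      ((hfi _ hχ.continuous hχc).smul (∫ t, φ t)), integral_smul, sub_eq_zero] at e
  rw [e, integral_smul_const]

/-- A function with a weak derivative on the line is a primitive of it. -/
theorem HasWeakDerivOn.exists_isPrimitive {f g : ℝ → ℂ} (h : HasWeakDerivOn Set.univ f g) :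
    ∃ F, f =ᵐ[volume] F ∧ IsPrimitive F g := by
  have hI := IsPrimitive.of_integral (locallyIntegrableOn_univ.1 h.2.1) 0
  obtain ⟨c, hc⟩ := HasWeakDerivOn.ae_const (((h.add (hI.hasWeakDerivOn.smul (-1)))).congr
    EventuallyEq.rfl (g' := 0) (ae_of_all _ fun x => by simp))
  refine ⟨fun x => c + ∫ t in 0..x, g t, ?_, ?_⟩
  · filter_upwards [hc] with x hx
    simp only [Pi.add_apply, Pi.smul_apply, smul_eq_mul] at hx
    rw [← hx]
    ring
  · have hs := (IsPrimitive.const c).add hI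
    rwa [zero_add] at hs

/-- Integration by parts for square integrable functions. -/
theorem integral_mul_add_mul_eq_zero {f g f' g' : ℝ → ℂ} (h : HasWeakDerivOn Set.univ f g)
    (h' : HasWeakDerivOn Set.univ f' g') (hf : MemLp f 2) (hg : MemLp g 2) (hf' : MemLp f' 2)
    (hg' : MemLp g' 2) : ∫ x, (g x * f' x + g' x * f x) = 0 := by
  obtain ⟨F, hF, hFp⟩ := h.exists_isPrimitive
  obtain ⟨F', hF', hFp'⟩ := h'.exists_isPrimitive
  have e : (fun x => g x * f' x + g' x * f x) =ᵐ[volume] fun x => g x * F' x + g' x * F x := by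
    filter_upwards [hF, hF'] with x h1 h2
    rw [h1, h2]
  rw [integral_congr_ae e]
  refine (hFp.mul hFp').integral_eq_zero ?_ ?_
  · refine (hf.integrable_mul hf').congr ?_
    filter_upwards [hF, hF'] with x h1 h2
    rw [Pi.mul_apply, h1, h2]
  · exact ((hg.integrable_mul hf').add (hg'.integrable_mul hf)).congr e

/-! ### Weak derivatives off finitely many points -/

/-- The defect of `g` from being the weak derivative of `f`, tested with `φ`. -/
noncomputable def weakDefect (f g : ℝ → ℂ) (φ : ℝ → ℝ) : ℂ :=
  ∫ x, (deriv φ x • f x + φ x • g x)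

theorem integrable_weakDefect {f g : ℝ → ℂ} (hf : LocallyIntegrable f) (hg : LocallyIntegrable g)
    {φ : ℝ → ℝ} (hφ : ContDiff ℝ ∞ φ) (hc : HasCompactSupport φ) :
    Integrable fun x => deriv φ x • f x + φ x • g x :=
  (integrable_smul_of_locallyIntegrableOn (locallyIntegrableOn_univ.2 hf)
    (hφ.continuous_deriv (by simp)) hc.deriv (Set.subset_univ _)).add
  (integrable_smul_of_locallyIntegrableOn (locallyIntegrableOn_univ.2 hg)
    hφ.continuous hc (Set.subset_univ _))

theorem weakDefect_sub {f g : ℝ → ℂ} (hf : LocallyIntegrable f) (hg : LocallyIntegrable g)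
    {φ ψ : ℝ → ℝ} (hφ : ContDiff ℝ ∞ φ) (hc : HasCompactSupport φ) (hψ : ContDiff ℝ ∞ ψ)
    (hc' : HasCompactSupport ψ) :
    weakDefect f g (fun x => φ x - ψ x) = weakDefect f g φ - weakDefect f g ψ := by
  unfold weakDefect
  rw [← integral_sub (integrable_weakDefect hf hg hφ hc) (integrable_weakDefect hf hg hψ hc')]
  refine integral_congr_ae (ae_of_all _ fun x => ?_)
  simp only
  rw [deriv_fun_sub (hφ.differentiable (by simp)).differentiableAt
    (hψ.differentiable (by simp)).differentiableAt]
  simp only [sub_smul]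
  ring

theorem weakDefect_eq_zero_iff {f g : ℝ → ℂ} (hf : LocallyIntegrable f)
    (hg : LocallyIntegrable g) {φ : ℝ → ℝ} (hφ : ContDiff ℝ ∞ φ) (hc : HasCompactSupport φ) :
    weakDefect f g φ = 0 ↔ ∫ x, deriv φ x • f x = -∫ x, φ x • g x := by
  rw [weakDefect, integral_add
    (integrable_smul_of_locallyIntegrableOn (locallyIntegrableOn_univ.2 hf)
      (hφ.continuous_deriv (by simp)) hc.deriv (Set.subset_univ _))
    (integrable_smul_of_locallyIntegrableOn (locallyIntegrableOn_univ.2 hg)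
      hφ.continuous hc (Set.subset_univ _)), add_eq_zero_iff_eq_neg]

theorem HasWeakDerivOn.weakDefect_eq_zero {U : Set ℝ} {f g : ℝ → ℂ} (h : HasWeakDerivOn U f g)
    (hf : LocallyIntegrable f) (hg : LocallyIntegrable g) {φ : ℝ → ℝ} (hφ : ContDiff ℝ ∞ φ)
    (hc : HasCompactSupport φ) (hU : tsupport φ ⊆ U) : weakDefect f g φ = 0 :=
  (weakDefect_eq_zero_iff hf hg hφ hc).2 (h.2.2 φ hφ hc hU)

/-- Test functions which vanish at a point do not see whether the point was removed. -/
theorem HasWeakDerivOn.weakDefect_eq_zero_of_apply_eq_zero {V : Set ℝ} {s : ℝ} {f g : ℝ → ℂ}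
    (h : HasWeakDerivOn (V \ {s}) f g) (hf : LocallyIntegrable f) (hg : LocallyIntegrable g)
    {φ : ℝ → ℝ} (hφ : ContDiff ℝ ∞ φ) (hc : HasCompactSupport φ) (hV : tsupport φ ⊆ V)
    (h0 : φ s = 0) : weakDefect f g φ = 0 := by
  let b : ContDiffBump (0 : ℝ) := ⟨1, 2, by norm_num, by norm_num⟩
  have hb : ContDiff ℝ ∞ b := b.contDiff
  have hb1 : ∀ y, |y| ≤ 1 → b y = 1 := fun y hy =>
    b.one_of_mem_closedBall (by simpa [Metric.mem_closedBall, Real.dist_eq] using hy)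
  have hb0 : ∀ y, 2 < |y| → b y = 0 := fun y hy =>
    b.zero_of_le_dist (by simpa [Real.dist_eq] using hy.le)
  have hb0' : ∀ y, 2 < |y| → deriv b y = 0 := fun y hy => by
    by_contra hne
    have := support_deriv_subset (Function.mem_support.2 hne)
    rw [b.tsupport_eq] at this
    simp only [Metric.mem_closedBall, dist_zero_right, Real.norm_eq_abs] at this
    exact absurd this (not_le.2 hy)
  obtain ⟨B, hB⟩ := (hb.continuous_deriv (by simp)).bounded_above_of_compact_support
    b.hasCompactSupport.deriv
  obtain ⟨C, hC⟩ := (hφ.continuous_deriv (by simp)).bounded_above_of_compact_support hc.deriv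
  have hC0 : 0 ≤ C := (norm_nonneg _).trans (hC 0)
  have hB0 : 0 ≤ B := (norm_nonneg _).trans (hB 0)
  -- The linear vanishing of `φ` at `s` compensates the growth `N k` of the derivative of the cutoff
  -- `χ k`, which equals one near `s` and has width of order `1 / N k`.
  have hφs : ∀ x, |φ x| ≤ C * |x - s| := fun x => by
    have := Convex.norm_image_sub_le_of_norm_deriv_le (𝕜 := ℝ) (f := φ) (s := Set.univ) (x := s)
      (y := x) (fun x _ => (hφ.differentiable (by simp)).differentiableAt) (fun x _ => hC x)
      convex_univ (Set.mem_univ _) (Set.mem_univ _)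
    simpa [h0] using this
  let N : ℕ → ℝ := fun k => k + 1
  have hN : ∀ k, 1 ≤ N k := fun k => by simp [N]
  let χ : ℕ → ℝ → ℝ := fun k x => b (N k * (x - s))
  have hχ : ∀ k, ContDiff ℝ ∞ (χ k) := fun k =>
    hb.comp (contDiff_const.mul (contDiff_id.sub contDiff_const))
  have hχd : ∀ k x, HasDerivAt (χ k) (deriv b (N k * (x - s)) * N k) x := fun k x => by
    have h1 : HasDerivAt (fun x => N k * (x - s)) (N k) x := by
      simpa using ((hasDerivAt_id x).sub_const s).const_mul (N k)
    exact ((hb.differentiable (by simp)).differentiableAt.hasDerivAt).comp x h1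
  have hprod : ∀ k, ContDiff ℝ ∞ fun x => φ x * χ k x := fun k => hφ.mul (hχ k)
  have hpd : ∀ k x, deriv (fun x => φ x * χ k x) x
      = deriv φ x * χ k x + φ x * (deriv b (N k * (x - s)) * N k) := fun k x =>
    ((hφ.differentiable (by simp)).differentiableAt.hasDerivAt.fun_mul (hχd k x)).deriv
  have hcprod : ∀ k, HasCompactSupport fun x => φ x * χ k x := fun k => hc.mul_right
  -- The factor `1 - χ k` vanishes near `s`, so `φ (1 - χ k)` is an admissible test function on the
  -- punctured set and contributes nothing.
  have key : ∀ k, weakDefect f g φ = weakDefect f g fun x => φ x * χ k x := fun k => by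
    have e := weakDefect_sub hf hg hφ hc (hprod k) (hcprod k)
    have e0 : weakDefect f g (fun x => φ x - φ x * χ k x) = 0 := by
      refine h.weakDefect_eq_zero hf hg (hφ.sub (hprod k)) (hc.sub (hcprod k)) ?_
      have e1 : (fun x => φ x - φ x * χ k x) = fun x => φ x * (1 - χ k x) := by
        funext x
        ring
      rw [e1]
      refine fun x hx => ⟨hV (tsupport_mul_subset_left hx), fun hxs => ?_⟩
      rw [Set.mem_singleton_iff] at hxs
      subst hxs
      refine absurd (tsupport_mul_subset_right hx) (notMem_tsupport_iff_eventuallyEq.2 ?_)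
      have hcont : Continuous fun y => |N k * (y - x)| := by fun_prop
      have : ∀ᶠ y in 𝓝 x, |N k * (y - x)| < 1 :=
        hcont.continuousAt.eventually_lt continuousAt_const (by simp)
      filter_upwards [this] with y hy
      simp [χ, hb1 _ hy.le]
    rw [e0] at e
    exact (sub_eq_zero.1 e.symm)
  -- Where `χ k` lives, `N k |x - s| ≤ 2`. Hence `φ' χ k` is bounded by `C`, the term `φ (χ k)'` by
  -- `C |x - s| B (N k) ≤ 2 C B`, and `φ χ k` by `2 C`; the pointwise limit is zero off `s`.
  have hlim : Tendsto (fun k => weakDefect f g fun x => φ x * χ k x) atTop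
      (𝓝 (∫ _ : ℝ, (0 : ℂ))) := by
    refine tendsto_integral_of_dominated_convergence
      (fun x => Set.indicator (Set.Icc (s - 2) (s + 2))
        (fun x => (C + 2 * C * B) * ‖f x‖ + 2 * C * ‖g x‖) x)
      (fun k => (integrable_weakDefect hf hg (hprod k) (hcprod k)).aestronglyMeasurable) ?_ ?_ ?_
    · rw [integrable_indicator_iff measurableSet_Icc]
      exact ((hf.integrableOn_isCompact isCompact_Icc).norm.const_mul _).add
        ((hg.integrableOn_isCompact isCompact_Icc).norm.const_mul _)
    · refine fun k => ae_of_all _ fun x => ?_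
      rw [hpd k x]
      by_cases hx : |N k * (x - s)| ≤ 2
      · have hNx : N k * |x - s| ≤ 2 := by
          rwa [abs_mul, abs_of_pos (by linarith [hN k])] at hx
        have hx2 : |x - s| ≤ 2 := by nlinarith [hN k, abs_nonneg (x - s)]
        have hmem : x ∈ Set.Icc (s - 2) (s + 2) := by
          rw [abs_le] at hx2
          constructor <;> linarith [hx2.1, hx2.2]
        rw [Set.indicator_of_mem hmem]
        refine (norm_add_le _ _).trans ?_
        rw [norm_smul, norm_smul]
        have hχ1 : |χ k x| ≤ 1 := by
          rw [abs_of_nonneg b.nonneg]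
          exact b.le_one
        have a1 : ‖deriv φ x * χ k x + φ x * (deriv b (N k * (x - s)) * N k)‖ ≤ C + 2 * C * B := by
          refine (norm_add_le _ _).trans (add_le_add ?_ ?_)
          · rw [norm_mul]
            exact (mul_le_mul (hC x) hχ1 (abs_nonneg _) hC0).trans_eq (mul_one C)
          · rw [norm_mul, norm_mul, Real.norm_eq_abs, Real.norm_eq_abs (N k),
              abs_of_pos (by linarith [hN k] : 0 < N k)]
            calc |φ x| * (‖deriv b (N k * (x - s))‖ * N k)
                ≤ (C * |x - s|) * (B * N k) := by
                  have := hN k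
                  gcongr
                  · exact hφs x
                  · exact hB _
              _ = C * B * (N k * |x - s|) := by ring
              _ ≤ C * B * 2 := by gcongr
              _ = 2 * C * B := by ring
        have a2 : ‖φ x * χ k x‖ ≤ 2 * C := by
          rw [norm_mul]
          calc |φ x| * |χ k x| ≤ (C * |x - s|) * 1 := by
                gcongr
                exact hφs x
            _ ≤ C * 2 := by
                rw [mul_one]
                gcongr
            _ = 2 * C := by ring
        gcongr
      · rw [not_le] at hx
        simp only [χ, hb0 _ hx, hb0' _ hx, mul_zero, zero_mul, add_zero, zero_smul, norm_zero]
        exact Set.indicator_nonneg (fun x _ => by positivity) x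
    · filter_upwards [compl_mem_ae_iff.2 (measure_singleton s)] with x hx
      have hxs : 0 < |x - s| := abs_pos.2 (sub_ne_zero.2 hx)
      refine tendsto_const_nhds.congr' ?_
      obtain ⟨k₀, hk₀⟩ := exists_nat_gt (2 / |x - s|)
      filter_upwards [eventually_ge_atTop k₀] with k hk
      have hlt : 2 < |N k * (x - s)| := by
        rw [abs_mul, abs_of_pos (by linarith [hN k] : 0 < N k), ← div_lt_iff₀ hxs]
        have : (k₀ : ℝ) ≤ k := by exact_mod_cast hk
        simp only [N]
        linarith
      rw [hpd k x]
      simp [χ, hb0 _ hlt, hb0' _ hlt]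
  have hconst : (fun k => weakDefect f g fun x => φ x * χ k x) = fun _ : ℕ => weakDefect f g φ :=
    funext fun k => (key k).symm
  rw [hconst, integral_zero] at hlim
  exact tendsto_nhds_unique tendsto_const_nhds hlim

theorem measurable_sign : Measurable Real.sign := by
  unfold Real.sign
  exact Measurable.ite measurableSet_Iio measurable_const
    (Measurable.ite measurableSet_Ioi measurable_const measurable_const)

theorem locallyIntegrable_sign (s : ℝ) : LocallyIntegrable fun x => (Real.sign (x - s) : ℂ) := by
  have hm : Measurable fun x => (Real.sign (x - s) : ℂ) :=
    Complex.measurable_ofReal.comp (measurable_sign.comp (measurable_id.sub_const s))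
  refine (locallyIntegrable_const (1 : ℝ)).mono hm.aestronglyMeasurable (ae_of_all _ fun x => ?_)
  rcases Real.sign_apply_eq (x - s) with h | h | h <;> simp [h]

theorem integral_deriv_smul_sign {φ : ℝ → ℝ} (hφ : ContDiff ℝ ∞ φ) (hc : HasCompactSupport φ)
    (s : ℝ) : ∫ x, deriv φ x • (Real.sign (x - s) : ℂ) = -2 * φ s := by
  rw [← (IsPrimitive.of_test hφ).integral_sign_mul
    (hφ.continuous.integrable_of_hasCompactSupport hc).ofReal
    ((hφ.continuous_deriv (by simp)).integrable_of_hasCompactSupport hc.deriv).ofReal s]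
  refine integral_congr_ae (ae_of_all _ fun x => ?_)
  simp only [Complex.real_smul]
  ring

/-- A weak derivative on a punctured open set extends across the puncture once a jump is
subtracted. -/
theorem HasWeakDerivOn.exists_sub_sign {V : Set ℝ} (hV : IsOpen V) {s : ℝ} (hs : s ∈ V)
    {f g : ℝ → ℂ} (h : HasWeakDerivOn (V \ {s}) f g) (hf : LocallyIntegrable f)
    (hg : LocallyIntegrable g) :
    ∃ σ : ℂ, HasWeakDerivOn V (fun x => f x - 1 / 2 * (σ * (Real.sign (x - s) : ℂ))) g := by
  obtain ⟨χ, hχV, hχc, hχ, -, hχs⟩ :=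
    exists_contDiff_tsupport_subset (n := ⊤) (hV.mem_nhds hs)
  -- `φ - φ(s) χ` vanishes at `s`, so its defect is zero: the defect is a multiple of the delta at
  -- `s`, with coefficient its value on `χ`.
  have hlin : ∀ φ : ℝ → ℝ, ContDiff ℝ ∞ φ → HasCompactSupport φ → tsupport φ ⊆ V →
      weakDefect f g φ = φ s * weakDefect f g χ := fun φ hφ hc hU => by
    have hm : ContDiff ℝ ∞ fun x => φ s * χ x := contDiff_const.mul hχ
    have hmc : HasCompactSupport fun x => φ s * χ x := hχc.mul_left
    have e := weakDefect_sub hf hg hφ hc hm hmc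
    rw [h.weakDefect_eq_zero_of_apply_eq_zero hf hg (hφ.sub hm) (hc.sub hmc)
      ((tsupport_sub φ fun x => φ s * χ x).trans (Set.union_subset hU
        (tsupport_mul_subset_right.trans hχV))) (by simp [hχs])] at e
    rw [sub_eq_zero.1 e.symm]
    unfold weakDefect
    rw [← integral_const_mul]
    refine integral_congr_ae (ae_of_all _ fun x => ?_)
    simp only
    rw [deriv_const_mul _ (hχ.differentiable (by simp)).differentiableAt]
    simp only [Complex.real_smul]
    push_cast
    ring
  have hsg := locallyIntegrable_sign s
  have hloc : LocallyIntegrable fun x =>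
      1 / 2 * (-weakDefect f g χ * (Real.sign (x - s) : ℂ)) := by
    have := (hsg.smul (-weakDefect f g χ)).smul (1 / 2 : ℂ)
    simpa only [smul_eq_mul, Pi.smul_def] using this
  have hloc' := hf.sub hloc
  -- Since `∫ φ' sign = -2 φ(s)`, subtracting half of `σ sign` adds `σ φ(s)` to the defect; this
  -- cancels it exactly for this `σ`.
  refine ⟨-weakDefect f g χ, hloc'.locallyIntegrableOn V, hg.locallyIntegrableOn V,
    fun φ hφ hc hU => ?_⟩
  have e := hlin φ hφ hc hU
  have hd : Continuous (deriv φ) := hφ.continuous_deriv (by simp)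
  have i1 := integrable_smul_of_locallyIntegrableOn (locallyIntegrableOn_univ.2 hf) hd hc.deriv
    (Set.subset_univ _)
  have i2 := integrable_smul_of_locallyIntegrableOn (locallyIntegrableOn_univ.2 hg)
    hφ.continuous hc (Set.subset_univ _)
  have i3 := integrable_smul_of_locallyIntegrableOn (locallyIntegrableOn_univ.2 hsg) hd hc.deriv
    (Set.subset_univ _)
  rw [weakDefect, integral_add i1 i2] at e
  have e2 : ∫ x, deriv φ x • (f x - 1 / 2 * (-weakDefect f g χ * (Real.sign (x - s) : ℂ)))
      = ∫ x, (deriv φ x • f x + 1 / 2 * weakDefect f g χ * (deriv φ x • (Real.sign (x - s) : ℂ))) :=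
    integral_congr_ae (ae_of_all _ fun x => by
      simp only [Complex.real_smul]
      ring)
  rw [e2, integral_add i1 (i3.const_mul _), integral_const_mul, integral_deriv_smul_sign hφ hc]
  linear_combination e

/-- The punctures are filled one at a time. Each filling subtracts a multiple of a `sign` and leaves
`g` unchanged. -/
theorem HasWeakDerivOn.exists_sub_sum_sign (F : Finset ℝ) {f g : ℝ → ℂ}
    (h : HasWeakDerivOn (F : Set ℝ)ᶜ f g) (hf : LocallyIntegrable f) (hg : LocallyIntegrable g) :
    ∃ σ : ℝ → ℂ, HasWeakDerivOn Set.univ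
      (fun x => f x - 1 / 2 * ∑ s ∈ F, σ s * (Real.sign (x - s) : ℂ)) g := by
  classical
  induction F using Finset.induction_on generalizing f with
  | empty => exact ⟨0, by simpa using h⟩
  | insert s F hs ih =>
    have hV : IsOpen ((F : Set ℝ)ᶜ) := F.finite_toSet.isClosed.isOpen_compl
    have e : ((insert s F : Finset ℝ) : Set ℝ)ᶜ = (F : Set ℝ)ᶜ \ {s} := by
      ext x
      simp [and_comm]
    rw [e] at h
    obtain ⟨τ, hτ⟩ := h.exists_sub_sign hV (by simpa using hs) hf hg
    have hloc : LocallyIntegrable fun x => 1 / 2 * (τ * (Real.sign (x - s) : ℂ)) := by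
      have := ((locallyIntegrable_sign s).smul τ).smul (1 / 2 : ℂ)
      simpa only [smul_eq_mul, Pi.smul_def] using this
    obtain ⟨σ, hσ⟩ := ih hτ (hf.sub hloc)
    refine ⟨Function.update σ s τ, ?_⟩
    convert hσ using 2 with x
    rw [Finset.sum_insert hs, Function.update_self, Finset.sum_congr rfl fun t ht => by
      rw [Function.update_of_ne (ne_of_mem_of_not_mem ht hs)]]
    ring

variable {n : ℕ} {P : Params n}

/-- Off the walls, a weak derivative is the weak derivative of a regular part on the line. -/
theorem HasWeakDerivOn.exists_regularPart (P : Params n) {f g : ℝ → ℂ}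
    (h : HasWeakDerivOn (Set.range P.s)ᶜ f g) (hf : LocallyIntegrable f)
    (hg : LocallyIntegrable g) : ∃ σ, HasWeakDerivOn Set.univ (regularPart P f σ) g := by
  classical
  have e : ((Finset.univ.image P.s : Finset ℝ) : Set ℝ) = Set.range P.s := by simp
  rw [← e] at h
  obtain ⟨σ, hσ⟩ := h.exists_sub_sum_sign _ hf hg
  refine ⟨fun j => σ (P.s j), ?_⟩
  convert hσ using 2 with x
  rw [Finset.sum_image fun i _ j _ hij => P.s_inj hij]
  rfl

theorem HasWeakDerivOn.mono {U V : Set ℝ} {f g : ℝ → ℂ} (h : HasWeakDerivOn V f g) (hUV : U ⊆ V) :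
    HasWeakDerivOn U f g :=
  ⟨h.1.mono_set hUV, h.2.1.mono_set hUV, fun φ hφ hc hU => h.2.2 φ hφ hc (hU.trans hUV)⟩

theorem hasWeakDerivOn_sign {U : Set ℝ} {s : ℝ} (hs : s ∉ U) :
    HasWeakDerivOn U (fun x => (Real.sign (x - s) : ℂ)) 0 := by
  refine ⟨(locallyIntegrable_sign s).locallyIntegrableOn U, locallyIntegrableOn_zero,
    fun φ hφ hc hU => ?_⟩
  rw [integral_deriv_smul_sign hφ hc, image_eq_zero_of_notMem_tsupport fun h => hs (hU h)]
  simp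

/-- Off the walls each `sign` is locally constant, so restoring the jumps does not affect the weak
derivative there. -/
theorem HasWeakDerivOn.of_regularPart (P : Params n) {f g : ℝ → ℂ} {σ : Fin n → ℂ}
    (h : HasWeakDerivOn Set.univ (regularPart P f σ) g) :
    HasWeakDerivOn (Set.range P.s)ᶜ f g := by
  have hsum : ∀ F : Finset (Fin n), HasWeakDerivOn (Set.range P.s)ᶜ
      (fun x => ∑ j ∈ F, σ j * (Real.sign (x - P.s j) : ℂ)) 0 := fun F => by
    classical
    induction F using Finset.induction_on with
    | empty => exact ⟨locallyIntegrableOn_zero, locallyIntegrableOn_zero, by simp⟩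
    | insert j F hj ih =>
      have h1 := ((hasWeakDerivOn_sign (U := (Set.range P.s)ᶜ) (s := P.s j)
        (by simp)).smul (σ j)).add ih
      rw [smul_zero, zero_add] at h1
      convert h1 using 2 with x
      rw [Finset.sum_insert hj]
      rfl
  have h2 := (h.mono (Set.subset_univ (Set.range P.s)ᶜ)).add ((hsum Finset.univ).smul (1 / 2))
  rw [smul_zero, add_zero] at h2
  convert h2 using 1
  funext x
  simp [regularPart]

/-! ### Essential limits -/

theorem HasEssLimit.congr {f g : ℝ → ℂ} {l : Filter ℝ} {c : ℂ} (h : HasEssLimit f l c)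
    (hfg : f =ᵐ[volume] g) : HasEssLimit g l c :=
  Tendsto.congr' (hfg.filter_mono inf_le_right) h

theorem HasEssLimit.of_tendsto {f : ℝ → ℂ} {l : Filter ℝ} {c : ℂ} (h : Tendsto f l (𝓝 c)) :
    HasEssLimit f l c :=
  h.mono_left inf_le_left

theorem HasEssLimit.mono {f : ℝ → ℂ} {l l' : Filter ℝ} {c : ℂ} (h : HasEssLimit f l c)
    (hl : l' ≤ l) : HasEssLimit f l' c :=
  Tendsto.mono_left h (inf_le_inf_right _ hl)

/-- One-sided neighbourhoods have positive measure and so meet every conull set. This makes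
essential one-sided limits unique. -/
theorem neBot_nhdsGT_inf_ae (s : ℝ) : (𝓝[>] s ⊓ ae volume).NeBot := by
  rw [inf_neBot_iff]
  intro A hA B hB
  obtain ⟨u, hu, huA⟩ := mem_nhdsGT_iff_exists_Ioo_subset.1 hA
  have h1 : volume (Set.Ioo s u) ≠ 0 := by
    rw [Real.volume_Ioo]
    simpa using hu
  obtain ⟨x, hx, hxB⟩ : (Set.Ioo s u ∩ B).Nonempty := by
    by_contra hne
    rw [Set.not_nonempty_iff_eq_empty] at hne
    exact h1 (measure_mono_null
      (fun x hx hxB => (hne ▸ ⟨hx, hxB⟩ : x ∈ (∅ : Set ℝ))) (mem_ae_iff.1 hB))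
  exact ⟨x, huA hx, hxB⟩

theorem neBot_nhdsLT_inf_ae (s : ℝ) : (𝓝[<] s ⊓ ae volume).NeBot := by
  rw [inf_neBot_iff]
  intro A hA B hB
  obtain ⟨u, hu, huA⟩ := mem_nhdsLT_iff_exists_Ioo_subset.1 hA
  have h1 : volume (Set.Ioo u s) ≠ 0 := by
    rw [Real.volume_Ioo]
    simpa using hu
  obtain ⟨x, hx, hxB⟩ : (Set.Ioo u s ∩ B).Nonempty := by
    by_contra hne
    rw [Set.not_nonempty_iff_eq_empty] at hne
    exact h1 (measure_mono_null
      (fun x hx hxB => (hne ▸ ⟨hx, hxB⟩ : x ∈ (∅ : Set ℝ))) (mem_ae_iff.1 hB))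
  exact ⟨x, huA hx, hxB⟩

theorem HasEssLimit.unique_right {f : ℝ → ℂ} {s : ℝ} {c d : ℂ} (h : HasEssLimit f (𝓝[>] s) c)
    (h' : HasEssLimit f (𝓝[>] s) d) : c = d :=
  haveI := neBot_nhdsGT_inf_ae s
  tendsto_nhds_unique h h'

theorem HasEssLimit.unique_left {f : ℝ → ℂ} {s : ℝ} {c d : ℂ} (h : HasEssLimit f (𝓝[<] s) c)
    (h' : HasEssLimit f (𝓝[<] s) d) : c = d :=
  haveI := neBot_nhdsLT_inf_ae s
  tendsto_nhds_unique h h'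

theorem HasEssLimit.unique {f : ℝ → ℂ} {s : ℝ} {c d : ℂ} (h : HasEssLimit f (𝓝 s) c)
    (h' : HasEssLimit f (𝓝 s) d) : c = d :=
  (h.mono nhdsWithin_le_nhds).unique_right (h'.mono nhdsWithin_le_nhds)

theorem HasEssLimit.add_coe {f g : L2} {l : Filter ℝ} {c d : ℂ} (h : HasEssLimit f l c)
    (h' : HasEssLimit g l d) : HasEssLimit (f + g : L2) l (c + d) :=
  HasEssLimit.congr (Tendsto.add h h' : HasEssLimit (f + g) l (c + d)) (Lp.coeFn_add f g).symm

theorem HasEssLimit.smul_coe {f : L2} {l : Filter ℝ} {c : ℂ} (a : ℂ) (h : HasEssLimit f l c) :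
    HasEssLimit (a • f : L2) l (a * c) :=
  HasEssLimit.congr (Tendsto.const_smul h a : HasEssLimit (a • f) l (a • c))
    (Lp.coeFn_smul a f).symm

theorem HasEssLimit.star_coe {f : L2} {l : Filter ℝ} {c : ℂ} (h : HasEssLimit f l c) :
    HasEssLimit (star f : L2) l (conj c) :=
  HasEssLimit.congr (((Complex.continuous_conj.tendsto c).comp h : HasEssLimit (star f) l (conj c)))
    (Lp.coeFn_star f).symm

theorem hasEssLimit_zero_coe (l : Filter ℝ) : HasEssLimit (0 : L2) l 0 :=
  HasEssLimit.congr (f := 0) (HasEssLimit.of_tendsto tendsto_const_nhds)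
    (Lp.coeFn_zero ℂ 2 volume).symm

/-! ### One-sided limits at the walls -/

theorem eventually_sign_sub_eq {x s : ℝ} (h : x ≠ s) :
    ∀ᶠ y in 𝓝 x, Real.sign (y - s) = Real.sign (x - s) := by
  rcases lt_or_gt_of_ne h with h | h
  · filter_upwards [eventually_lt_nhds h] with y hy
    rw [Real.sign_of_neg (sub_neg.2 hy), Real.sign_of_neg (sub_neg.2 h)]
  · filter_upwards [eventually_gt_nhds h] with y hy
    rw [Real.sign_of_pos (sub_pos.2 hy), Real.sign_of_pos (sub_pos.2 h)]

/-- Only the `i`-th term is discontinuous at `s i`. Because `Real.sign 0 = 0`, the value of the sum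
at `s i` is the mean of its two one-sided limits, which differ from it by `± σ i`. -/
theorem tendsto_sum_sign_right (P : Params n) (σ : Fin n → ℂ) (i : Fin n) :
    Tendsto (fun x => ∑ j, σ j * (Real.sign (x - P.s j) : ℂ)) (𝓝[>] (P.s i))
      (𝓝 ((∑ j, σ j * (Real.sign (P.s i - P.s j) : ℂ)) + σ i)) := by
  classical
  have e : (∑ j, σ j * (Real.sign (P.s i - P.s j) : ℂ)) + σ i
      = ∑ j, (σ j * (Real.sign (P.s i - P.s j) : ℂ) + if j = i then σ j else 0) := by
    rw [Finset.sum_add_distrib, Finset.sum_ite_eq' Finset.univ i]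
    simp
  rw [e]
  refine tendsto_finsetSum _ fun j _ => tendsto_const_nhds.congr' ?_
  by_cases hj : j = i
  · subst hj
    filter_upwards [self_mem_nhdsWithin] with x hx
    rw [Real.sign_of_pos (sub_pos.2 hx)]
    simp
  · filter_upwards [nhdsWithin_le_nhds
      (eventually_sign_sub_eq fun h => hj (P.s_inj h.symm))] with x hx
    rw [hx]
    simp [hj]

theorem tendsto_sum_sign_left (P : Params n) (σ : Fin n → ℂ) (i : Fin n) :
    Tendsto (fun x => ∑ j, σ j * (Real.sign (x - P.s j) : ℂ)) (𝓝[<] (P.s i))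
      (𝓝 ((∑ j, σ j * (Real.sign (P.s i - P.s j) : ℂ)) - σ i)) := by
  classical
  have e : (∑ j, σ j * (Real.sign (P.s i - P.s j) : ℂ)) - σ i
      = ∑ j, (σ j * (Real.sign (P.s i - P.s j) : ℂ) - if j = i then σ j else 0) := by
    rw [Finset.sum_sub_distrib, Finset.sum_ite_eq' Finset.univ i]
    simp
  rw [e]
  refine tendsto_finsetSum _ fun j _ => tendsto_const_nhds.congr' ?_
  by_cases hj : j = i
  · subst hj
    filter_upwards [self_mem_nhdsWithin] with x hx
    rw [Real.sign_of_neg (sub_neg.2 hx)]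
    simp
  · filter_upwards [nhdsWithin_le_nhds
      (eventually_sign_sub_eq fun h => hj (P.s_inj h.symm))] with x hx
    rw [hx]
    simp [hj]

theorem HasWeakDerivOn.exists_hasEssLimit {f g : ℝ → ℂ} (h : HasWeakDerivOn Set.univ f g)
    (s : ℝ) : ∃ c, HasEssLimit f (𝓝 s) c := by
  obtain ⟨F, hF, hp⟩ := h.exists_isPrimitive
  exact ⟨F s, (HasEssLimit.of_tendsto (hp.continuous.tendsto s)).congr hF.symm⟩

/-- If the regular part has a weak derivative, then `σ` consists of the jumps at the walls. -/
theorem HasWeakDerivOn.exists_oneSided {f g : ℝ → ℂ} {σ : Fin n → ℂ}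
    (h : HasWeakDerivOn Set.univ (regularPart P f σ) g) :
    ∃ m : Fin n → ℂ, ∀ j, HasEssLimit f (𝓝[>] (P.s j)) (m j + σ j / 2) ∧
      HasEssLimit f (𝓝[<] (P.s j)) (m j - σ j / 2) := by
  obtain ⟨F, hF, hp⟩ := h.exists_isPrimitive
  have hf : f =ᵐ[volume] fun x => F x + 1 / 2 * ∑ j, σ j * (Real.sign (x - P.s j) : ℂ) := by
    filter_upwards [hF] with x hx
    rw [← hx, regularPart]
    ring
  -- `m j` is the mean of the two one-sided limits at the wall.
  refine ⟨fun j => F (P.s j) + 1 / 2 * ∑ i, σ i * (Real.sign (P.s j - P.s i) : ℂ), fun j => ?_⟩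
  have hc : ∀ t, Tendsto F (𝓝[t] (P.s j)) (𝓝 (F (P.s j))) := fun t =>
    (hp.continuous.tendsto _).mono_left nhdsWithin_le_nhds
  constructor
  · refine HasEssLimit.congr (HasEssLimit.of_tendsto ?_) hf.symm
    convert (hc _).add ((tendsto_sum_sign_right P σ j).const_mul (1 / 2)) using 2
    ring
  · refine HasEssLimit.congr (HasEssLimit.of_tendsto ?_) hf.symm
    convert (hc _).add ((tendsto_sum_sign_left P σ j).const_mul (1 / 2)) using 2
    ring

theorem HasJump.unique {f : ℝ → ℂ} {s : ℝ} {σ τ : ℂ} (h : HasJump f s σ) (h' : HasJump f s τ) :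
    σ = τ := by
  obtain ⟨cr, cl, hr, hl, rfl⟩ := h
  obtain ⟨cr', cl', hr', hl', rfl⟩ := h'
  rw [hr.unique_right hr', hl.unique_left hl']

theorem HasWeakDerivOn.hasJump {f g : ℝ → ℂ} {σ : Fin n → ℂ}
    (h : HasWeakDerivOn Set.univ (regularPart P f σ) g) (j : Fin n) :
    HasJump f (P.s j) (σ j) := by
  obtain ⟨m, hm⟩ := h.exists_oneSided
  exact ⟨_, _, (hm j).1, (hm j).2, by ring⟩

/-! ### The Green function -/

theorem reSign_mul_self (ζ : ℂ) : reSign ζ * reSign ζ = 1 := by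
  unfold reSign
  split_ifs <;> ring

theorem hasDerivAt_abs_sub {x s : ℝ} (h : x ≠ s) :
    HasDerivAt (fun y => |y - s|) (Real.sign (x - s)) x := by
  rcases lt_or_gt_of_ne h with h | h
  · rw [Real.sign_of_neg (sub_neg.2 h)]
    refine ((hasDerivAt_id x).sub_const s).fun_neg.congr_of_eventuallyEq ?_
    filter_upwards [eventually_lt_nhds h] with y hy
    rw [abs_of_neg (sub_neg.2 hy)]
    simp
  · rw [Real.sign_of_pos (sub_pos.2 h)]
    refine ((hasDerivAt_id x).sub_const s).congr_of_eventuallyEq ?_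
    filter_upwards [eventually_gt_nhds h] with y hy
    rw [abs_of_pos (sub_pos.2 hy)]
    simp

theorem sign_mul_sign {x s : ℝ} (h : x ≠ s) :
    (Real.sign (x - s) : ℂ) * (Real.sign (x - s) : ℂ) = 1 := by
  rcases Real.sign_apply_eq_of_ne_zero _ (sub_ne_zero.2 h) with h | h <;> simp [h]

theorem hasDerivAt_exp_green (P : Params n) (ζ : ℂ) {x s : ℝ} (h : x ≠ s) :
    HasDerivAt (fun y : ℝ => Complex.exp (-(reSign ζ * ζ * (|y - s| : ℝ) / P.a)))
      (Complex.exp (-(reSign ζ * ζ * (|x - s| : ℝ) / P.a))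
        * (-(reSign ζ * ζ * (Real.sign (x - s) : ℂ) / P.a))) x :=
  ((((hasDerivAt_abs_sub h).ofReal_comp.const_mul (reSign ζ * ζ)).div_const (P.a : ℂ)).fun_neg).cexp

theorem continuous_exp_green (P : Params n) (ζ : ℂ) (s : ℝ) :
    Continuous fun y : ℝ => Complex.exp (-(reSign ζ * ζ * (|y - s| : ℝ) / P.a)) := by
  fun_prop

theorem a_ne_zero (P : Params n) : (P.a : ℂ) ≠ 0 := by exact_mod_cast P.a_pos.ne'

theorem ne_zero_of_re_ne_zero {ζ : ℂ} (hζ : ζ.re ≠ 0) : ζ ≠ 0 := fun h => hζ (by simp [h])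

/-- The Green function is continuous with a corner at `s`, and a single exceptional point does not
disturb the fundamental theorem of calculus. -/
theorem isPrimitive_green (P : Params n) {ζ : ℂ} (hζ : ζ.re ≠ 0) (s : ℝ) :
    IsPrimitive (fun x => green P ζ (x - s)) (fun x => green' P ζ (x - s)) := by
  refine IsPrimitive.of_hasDerivAt_off_countable (Set.countable_singleton s)
    (continuous_const.mul (continuous_exp_green P ζ s)) (fun x hx => ?_)
    ((memLp_green' P hζ s).locallyIntegrable (by norm_num))
  have h := (hasDerivAt_exp_green P ζ hx).const_mul (reSign ζ * (P.a / (2 * ζ)))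
  refine h.congr_deriv ?_
  have ha := a_ne_zero P
  have h0 := ne_zero_of_re_ne_zero hζ
  rw [green']
  field_simp
  linear_combination -(Real.sign (x - s) : ℂ) * reSign_mul_self ζ

/-- `-𝒢'` jumps by one at `s`. Removing half a `sign` makes it continuous, and off `s` the equation
`𝒢'' = (ζ²/a²) 𝒢` gives the derivative. Thus `-𝒢'` is a square integrable function with a unit jump,
which `sign` itself is not. -/
theorem isPrimitive_green'_sub_sign (P : Params n) {ζ : ℂ} (hζ : ζ.re ≠ 0) (s : ℝ) :
    IsPrimitive (fun x => -green' P ζ (x - s) - 1 / 2 * (Real.sign (x - s) : ℂ))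
      (fun x => -(ζ ^ 2 / P.a ^ 2) * green P ζ (x - s)) := by
  have e : (fun x => -green' P ζ (x - s) - 1 / 2 * (Real.sign (x - s) : ℂ)) = fun x =>
      1 / 2 * (Real.sign (x - s) : ℂ)
        * (Complex.exp (-(reSign ζ * ζ * (|x - s| : ℝ) / P.a)) - 1) := by
    funext x
    rw [green']
    ring
  refine IsPrimitive.of_hasDerivAt_off_countable (Set.countable_singleton s) ?_ (fun x hx => ?_) ?_
  · have hE := (continuous_exp_green P ζ s).sub (continuous_const (y := (1 : ℂ)))
    have hc := Continuous.if_le (f' := fun x : ℝ => -(1 / 2) *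
        (Complex.exp (-(reSign ζ * ζ * (|x - s| : ℝ) / P.a)) - 1))
      (g' := fun x : ℝ => (1 / 2) * (Complex.exp (-(reSign ζ * ζ * (|x - s| : ℝ) / P.a)) - 1))
      (continuous_const.mul hE) (continuous_const.mul hE) continuous_id (continuous_const (y := s))
      (fun x hx => by simp only [id] at hx; simp [hx])
    rw [e]
    convert hc using 2 with x
    simp only [id]
    split_ifs with h
    · rcases h.lt_or_eq with h | h
      · rw [Real.sign_of_neg (sub_neg.2 h)]
        push_cast
        ring
      · simp [h]
    · rw [Real.sign_of_pos (sub_pos.2 (not_le.1 h))]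
      push_cast
      ring
  · rw [e]
    have h := ((hasDerivAt_exp_green P ζ hx).sub_const 1).const_mul
      (1 / 2 * (Real.sign (x - s) : ℂ))
    have h' := h.congr_of_eventuallyEq (f₁ := fun x => 1 / 2 * (Real.sign (x - s) : ℂ)
        * (Complex.exp (-(reSign ζ * ζ * (|x - s| : ℝ) / P.a)) - 1)) (by
      filter_upwards [eventually_sign_sub_eq hx] with y hy
      rw [hy])
    refine h'.congr_deriv ?_
    have ha := a_ne_zero P
    have h0 := ne_zero_of_re_ne_zero hζ
    rw [green]
    field_simp
    linear_combination -reSign ζ * sign_mul_sign hx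
  · exact (((memLp_green P hζ s).const_mul _).locallyIntegrable (by norm_num))

/-- Pairing a function of `H¹(ℝ)` with the jump function `-𝒢'_ζ`. -/
theorem integral_green_mul (P : Params n) {ζ : ℂ} (hζ : ζ.re ≠ 0) (s : ℝ) {u du : ℝ → ℂ} {c : ℂ}
    (h : HasWeakDerivOn Set.univ u du) (hu : MemLp u 2) (hdu : MemLp du 2)
    (hc : HasEssLimit u (𝓝 s) c) :
    ∫ x, (-(ζ ^ 2 / P.a ^ 2) * green P ζ (x - s) * u x + du x * -green' P ζ (x - s)) = -c := by
  obtain ⟨U, hU, hUp⟩ := h.exists_isPrimitive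
  have hUc : U s = c :=
    ((HasEssLimit.of_tendsto (hUp.continuous.tendsto s)).congr hU.symm).unique hc
  have ha := a_ne_zero P
  have h0 := ne_zero_of_re_ne_zero hζ
  have hU2 : MemLp U 2 := hu.ae_eq hU
  have i1 : Integrable fun x => green P ζ (x - s) * U x := (memLp_green P hζ s).integrable_mul hU2
  have i2 : Integrable fun x => green' P ζ (x - s) * U x + du x * green P ζ (x - s) :=
    ((memLp_green' P hζ s).integrable_mul hU2).add (hdu.integrable_mul (memLp_green P hζ s))
  have key := ((isPrimitive_green P hζ s).mul hUp).integral_sign_mul i1 i2 s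
  -- Each of `𝒢` and `𝒢'` is, up to a constant, `sign` times the other. The integrand is therefore a
  -- constant times `sign (x - s)` times the derivative of `𝒢 U`, and `integral_sign_mul` evaluates
  -- it as a multiple of `𝒢(0) U(s)`.
  have e : (fun x => -(ζ ^ 2 / P.a ^ 2) * green P ζ (x - s) * u x + du x * -green' P ζ (x - s))
      =ᵐ[volume] fun x => (reSign ζ * ζ / P.a) * ((Real.sign (x - s) : ℂ)
        * (green' P ζ (x - s) * U x + du x * green P ζ (x - s))) := by
    filter_upwards [hU, compl_mem_ae_iff.2 (measure_singleton s)] with x hx hxs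
    rw [hx, green, green']
    have h1 := reSign_mul_self ζ
    have h2 := sign_mul_sign (x := x) (s := s) hxs
    generalize (Real.sign (x - s) : ℂ) = S at *
    generalize reSign ζ = r at *
    generalize Complex.exp _ = E
    field_simp
    linear_combination (r * ζ * E * U x) * h2 - (E * du x * S * P.a) * h1
  rw [integral_congr_ae e, integral_const_mul, key, green, hUc]
  have h1 := reSign_mul_self ζ
  generalize reSign ζ = r at *
  simp only [sub_self, abs_zero, Complex.ofReal_zero, mul_zero, zero_div, neg_zero,
    Complex.exp_zero]
  field_simp
  linear_combination (-c) * h1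

/-! ### Pressure fields with jumps and velocity fields -/

theorem HasWeakDerivOn.zero (U : Set ℝ) : HasWeakDerivOn U 0 0 :=
  ⟨locallyIntegrableOn_zero, locallyIntegrableOn_zero, by simp⟩

theorem HasWeakDerivOn.sum {ι : Type*} {U : Set ℝ} (F : Finset ι) {f g : ι → ℝ → ℂ}
    (h : ∀ i, HasWeakDerivOn U (f i) (g i)) :
    HasWeakDerivOn U (∑ i ∈ F, f i) (∑ i ∈ F, g i) := by
  classical
  induction F using Finset.induction_on with
  | empty => exact HasWeakDerivOn.zero U
  | insert i F hi ih =>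
    rw [Finset.sum_insert hi, Finset.sum_insert hi]
    exact (h i).add ih

theorem HasWeakDerivOn.star {U : Set ℝ} {f g : ℝ → ℂ} (h : HasWeakDerivOn U f g) :
    HasWeakDerivOn U (star f) (star g) := by
  have hs : ∀ {k : ℝ → ℂ}, LocallyIntegrableOn k U → LocallyIntegrableOn (Star.star k) U :=
    fun hk x hx => by
      obtain ⟨s, hs, hi⟩ := hk x hx
      exact ⟨s, hs,
        Complex.conjLIE.toContinuousLinearEquiv.toContinuousLinearMap.integrable_comp hi⟩
  refine ⟨hs h.1, hs h.2.1, fun φ hφ hc hU => ?_⟩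
  have e : ∀ (k : ℝ → ℂ) (ψ : ℝ → ℝ), ∫ x, ψ x • (Star.star k) x = conj (∫ x, ψ x • k x) :=
    fun k ψ => by
      rw [← integral_conj]
      refine integral_congr_ae (ae_of_all _ fun x => ?_)
      simp
  rw [e, e, h.2.2 φ hφ hc hU, map_neg]

theorem HasWeakDerivOn.star_coe {U : Set ℝ} {f g : L2} (h : HasWeakDerivOn U f g) :
    HasWeakDerivOn U (Star.star f : L2) (Star.star g : L2) :=
  h.star.congr (Lp.coeFn_star f).symm (Lp.coeFn_star g).symm

theorem HasWeakDerivOn.add_coe {U : Set ℝ} {f g f' g' : L2} (h : HasWeakDerivOn U f g)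
    (h' : HasWeakDerivOn U f' g') : HasWeakDerivOn U (f + f' : L2) (g + g' : L2) :=
  (h.add h').congr (Lp.coeFn_add _ _).symm (Lp.coeFn_add _ _).symm

theorem HasWeakDerivOn.smul_coe {U : Set ℝ} {f g : L2} (c : ℂ) (h : HasWeakDerivOn U f g) :
    HasWeakDerivOn U (c • f : L2) (c • g : L2) :=
  (h.smul c).congr (Lp.coeFn_smul _ _).symm (Lp.coeFn_smul _ _).symm

theorem HasWeakDerivOn.zero_coe (U : Set ℝ) : HasWeakDerivOn U (0 : L2) (0 : L2) :=
  (HasWeakDerivOn.zero U).congr (Lp.coeFn_zero _ _ _).symm (Lp.coeFn_zero _ _ _).symm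

theorem locallyIntegrable_coe (f : L2) : LocallyIntegrable f :=
  (Lp.memLp f).locallyIntegrable (by norm_num)

@[simp] theorem regularPart_zero (f : ℝ → ℂ) : regularPart P f 0 = f := by
  funext x
  simp [regularPart]

theorem regularPart_congr {f g : ℝ → ℂ} (h : f =ᵐ[volume] g) (σ : Fin n → ℂ) :
    regularPart P f σ =ᵐ[volume] regularPart P g σ := by
  filter_upwards [h] with x hx
  rw [regularPart, hx, regularPart]

theorem HasWeakDerivOn.regularPart_add {p dp p' dp' : L2} {σ σ' : Fin n → ℂ}
    (h : HasWeakDerivOn Set.univ (regularPart P p σ) dp)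
    (h' : HasWeakDerivOn Set.univ (regularPart P p' σ') dp') :
    HasWeakDerivOn Set.univ (regularPart P (p + p' : L2) (σ + σ')) (dp + dp' : L2) := by
  refine (h.add h').congr ?_ (Lp.coeFn_add _ _).symm
  filter_upwards [Lp.coeFn_add p p'] with x hx
  simp only [regularPart, Pi.add_apply, hx, add_mul, Finset.sum_add_distrib]
  ring

theorem HasWeakDerivOn.regularPart_smul {p dp : L2} {σ : Fin n → ℂ} (c : ℂ)
    (h : HasWeakDerivOn Set.univ (regularPart P p σ) dp) :
    HasWeakDerivOn Set.univ (regularPart P (c • p : L2) (c • σ)) (c • dp : L2) := by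
  refine (h.smul c).congr ?_ (Lp.coeFn_smul _ _).symm
  filter_upwards [Lp.coeFn_smul c p] with x hx
  simp only [regularPart, Pi.smul_apply, hx, smul_eq_mul, mul_sub, Finset.mul_sum]
  congr 1
  exact Finset.sum_congr rfl fun j _ => by ring

theorem HasWeakDerivOn.regularPart_star {p dp : L2} {σ : Fin n → ℂ}
    (h : HasWeakDerivOn Set.univ (regularPart P p σ) dp) :
    HasWeakDerivOn Set.univ (regularPart P (Star.star p : L2) (Star.star σ))
      (Star.star dp : L2) := by
  refine h.star.congr ?_ (Lp.coeFn_star _).symm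
  filter_upwards [Lp.coeFn_star p] with x hx
  simp [regularPart, hx]

/-- The sum of the jump functions `-𝒢'` with weights `σ`. -/
theorem hasWeakDerivOn_sum_green (P : Params n) {ζ : ℂ} (hζ : ζ.re ≠ 0) (σ : Fin n → ℂ) :
    HasWeakDerivOn Set.univ
      (regularPart P (fun x => ∑ j, σ j * -green' P ζ (x - P.s j)) σ)
      (fun x => ∑ j, σ j * (-(ζ ^ 2 / P.a ^ 2) * green P ζ (x - P.s j))) := by
  have h := HasWeakDerivOn.sum Finset.univ fun j =>
    ((isPrimitive_green'_sub_sign P hζ (P.s j)).hasWeakDerivOn).smul (σ j)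
  convert h using 1
  · funext x
    simp only [regularPart, Finset.sum_apply, Pi.smul_apply, smul_eq_mul, mul_sub,
      Finset.sum_sub_distrib, Finset.mul_sum]
    congr 1
    exact Finset.sum_congr rfl fun j _ => by ring
  · funext x
    simp

/-- Integration by parts between a field with jumps and a field without. -/
theorem integral_mul_add_mul_eq_neg_sum {f g u du : ℝ → ℂ} {σ c : Fin n → ℂ}
    (h : HasWeakDerivOn Set.univ (regularPart P f σ) g) (h' : HasWeakDerivOn Set.univ u du)
    (hf : MemLp f 2) (hg : MemLp g 2) (hu : MemLp u 2) (hdu : MemLp du 2)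
    (hc : ∀ j, HasEssLimit u (𝓝 (P.s j)) (c j)) :
    ∫ x, (g x * u x + du x * f x) = -∑ j, σ j * c j := by
  -- Any `ζ` off the imaginary axis would do. The functions `η j` are square integrable with unit
  -- jumps, so `f - ∑ σ_j η_j` has no jumps and ordinary integration by parts applies to it; the
  -- pairings with the `η j` are explicit.
  have h1 : ((1 : ℂ)).re ≠ 0 := by simp
  let η : Fin n → ℝ → ℂ := fun j x => -green' P 1 (x - P.s j)
  let dη : Fin n → ℝ → ℂ := fun j x => -((1 : ℂ) ^ 2 / P.a ^ 2) * green P 1 (x - P.s j)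
  have hη : ∀ j, MemLp (η j) 2 := fun j => (memLp_green' P h1 (P.s j)).neg
  have hdη : ∀ j, MemLp (dη j) 2 := fun j => (memLp_green P h1 (P.s j)).const_mul _
  have hs : MemLp (fun x => ∑ j, σ j * η j x) 2 := memLp_finsetSum _ fun j _ =>
    (hη j).const_mul (σ j)
  have hds : MemLp (fun x => ∑ j, σ j * dη j x) 2 := memLp_finsetSum _ fun j _ =>
    (hdη j).const_mul (σ j)
  have hw := h.add ((hasWeakDerivOn_sum_green P h1 σ).smul (-1))
  have e1 : regularPart P f σ + (-1 : ℂ) • regularPart P (fun x => ∑ j, σ j * η j x) σ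
      = f - fun x => ∑ j, σ j * η j x := by
    funext x
    simp only [regularPart, Pi.add_apply, Pi.smul_apply, Pi.sub_apply, smul_eq_mul]
    ring
  have e2 : g + (-1 : ℂ) • (fun x => ∑ j, σ j * dη j x) = g - fun x => ∑ j, σ j * dη j x := by
    rw [neg_one_smul, sub_eq_add_neg]
  change HasWeakDerivOn Set.univ (regularPart P f σ
    + (-1 : ℂ) • regularPart P (fun x => ∑ j, σ j * η j x) σ)
    (g + (-1 : ℂ) • (fun x => ∑ j, σ j * dη j x)) at hw
  rw [e1, e2] at hw
  have key := integral_mul_add_mul_eq_zero hw h' (hf.sub hs) (hg.sub hds) hu hdu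
  have i0 : Integrable fun x => (g - fun x => ∑ j, σ j * dη j x) x * u x
      + du x * (f - fun x => ∑ j, σ j * η j x) x :=
    ((hg.sub hds).integrable_mul hu).add (hdu.integrable_mul (hf.sub hs))
  have i1 : ∀ j, Integrable fun x => σ j * (dη j x * u x + du x * η j x) := fun j =>
    (((hdη j).integrable_mul hu).add (hdu.integrable_mul (hη j))).const_mul _
  have e : (fun x => g x * u x + du x * f x) = fun x =>
      ((g - fun x => ∑ j, σ j * dη j x) x * u x + du x * (f - fun x => ∑ j, σ j * η j x) x)
        + ∑ j, σ j * (dη j x * u x + du x * η j x) := by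
    funext x
    simp only [Pi.sub_apply, mul_add, Finset.sum_add_distrib, sub_mul, mul_sub, Finset.sum_mul,
      Finset.mul_sum]
    have a1 : ∑ j, σ j * dη j x * u x = ∑ j, σ j * (dη j x * u x) :=
      Finset.sum_congr rfl fun j _ => by ring
    have a2 : ∑ j, du x * (σ j * η j x) = ∑ j, σ j * (du x * η j x) :=
      Finset.sum_congr rfl fun j _ => by ring
    rw [a1, a2]
    ring
  rw [e, integral_add i0 (integrable_finsetSum _ fun j _ => i1 j), key,
    integral_finsetSum _ fun j _ => i1 j, zero_add, ← Finset.sum_neg_distrib]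
  refine Finset.sum_congr rfl fun j _ => ?_
  rw [integral_const_mul]
  have := integral_green_mul P h1 (P.s j) h' hu hdu (hc j)
  simp only [η, dη]
  rw [this]
  ring

/-- Sesquilinear form of the integration by parts: conjugating the pressure, and with it its jumps,
turns the inner products into plain integrals. -/
theorem inner_add_inner_eq_neg_sum {p dp u du : L2} {σ c : Fin n → ℂ}
    (h : HasWeakDerivOn Set.univ (regularPart P p σ) dp) (h' : HasWeakDerivOn Set.univ u du)
    (hc : ∀ j, HasEssLimit u (𝓝 (P.s j)) (c j)) :
    inner ℂ dp u + inner ℂ p du = -∑ j, conj (σ j) * c j := by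
  have key := integral_mul_add_mul_eq_neg_sum h.regularPart_star h' (Lp.memLp _) (Lp.memLp _)
    (Lp.memLp u) (Lp.memLp du) hc
  rw [L2.inner_def, L2.inner_def, ← integral_add (L2.integrable_inner dp u)
    (L2.integrable_inner p du)]
  refine Eq.trans (integral_congr_ae ?_) key
  filter_upwards [Lp.coeFn_star p, Lp.coeFn_star dp] with x h1 h2
  rw [h1, h2]
  simp only [RCLike.inner_apply, Pi.star_apply, RCLike.star_def]
  ring

theorem memLp_test {φ : ℝ → ℝ} (hφ : Continuous φ) (hc : HasCompactSupport φ) :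
    MemLp (fun x => (φ x : ℂ)) 2 volume :=
  (Complex.continuous_ofReal.comp hφ).memLp_of_hasCompactSupport
    (hc.comp_left Complex.ofReal_zero)

/-- Velocity fields take arbitrary values at the walls. -/
theorem exists_velocity (P : Params n) (w : Fin n → ℂ) :
    ∃ v dv : L2, HasWeakDerivOn Set.univ v dv ∧ ∀ j, HasEssLimit v (𝓝 (P.s j)) (w j) := by
  classical
  -- Test functions which form a dual basis to evaluation at the walls.
  have hθ : ∀ j, ∃ θ : ℝ → ℝ, ContDiff ℝ ∞ θ ∧ HasCompactSupport θ ∧ θ (P.s j) = 1 ∧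
      ∀ i, i ≠ j → θ (P.s i) = 0 := fun j => by
    have hfin : (P.s '' {i | i ≠ j}).Finite := Set.toFinite _
    have hmem : (P.s '' {i | i ≠ j})ᶜ ∈ 𝓝 (P.s j) := hfin.isClosed.isOpen_compl.mem_nhds (by
      rintro ⟨i, hi, hij⟩
      exact hi (P.s_inj hij))
    obtain ⟨θ, hθV, hθc, hθ, -, hθs⟩ := exists_contDiff_tsupport_subset (n := ⊤) hmem
    exact ⟨θ, hθ, hθc, hθs, fun i hi => image_eq_zero_of_notMem_tsupport fun h =>
      hθV h ⟨i, hi, rfl⟩⟩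
  choose θ hd hc h1 h0 using hθ
  let f : ℝ → ℂ := fun x => ∑ j, w j * (θ j x : ℂ)
  let g : ℝ → ℂ := fun x => ∑ j, w j * ((deriv (θ j) x : ℝ) : ℂ)
  have hf : MemLp f 2 := memLp_finsetSum _ fun j _ =>
    (memLp_test (hd j).continuous (hc j)).const_mul (w j)
  have hg : MemLp g 2 := memLp_finsetSum _ fun j _ =>
    (memLp_test ((hd j).continuous_deriv (by simp)) (hc j).deriv).const_mul (w j)
  have hw : HasWeakDerivOn Set.univ f g := by
    have := HasWeakDerivOn.sum Finset.univ fun j =>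
      ((IsPrimitive.of_test (hd j)).hasWeakDerivOn).smul (w j)
    convert this using 1
    · funext x
      simp [f]
    · funext x
      simp [g]
  refine ⟨hf.toLp f, hg.toLp g, hw.congr hf.coeFn_toLp.symm hg.coeFn_toLp.symm, fun j => ?_⟩
  have hfc : Continuous f := by
    have := fun j => (hd j).continuous
    fun_prop
  have hfj : f (P.s j) = w j := by
    simp only [f]
    rw [Finset.sum_eq_single j (fun i _ hi => by rw [h0 i j hi.symm]; simp) (by simp), h1]
    simp
  rw [← hfj]
  exact (HasEssLimit.of_tendsto (hfc.tendsto _)).congr hf.coeFn_toLp.symm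

/-- Pressure fields have arbitrary one-sided limits at the walls. -/
theorem exists_pressure (P : Params n) (σ m : Fin n → ℂ) :
    ∃ p dp : L2, HasWeakDerivOn Set.univ (regularPart P p σ) dp ∧
      ∀ j, HasEssLimit p (𝓝[>] (P.s j)) (m j + σ j / 2) ∧
        HasEssLimit p (𝓝[<] (P.s j)) (m j - σ j / 2) := by
  have h1 : ((1 : ℂ)).re ≠ 0 := by simp
  have hf : MemLp (fun x => ∑ j, σ j * -green' P 1 (x - P.s j)) 2 volume :=
    memLp_finsetSum _ fun j _ => (memLp_green' P h1 (P.s j)).neg.const_mul (σ j)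
  have hg : MemLp (fun x => ∑ j, σ j * (-((1 : ℂ) ^ 2 / P.a ^ 2) * green P 1 (x - P.s j))) 2
      volume :=
    memLp_finsetSum _ fun j _ => ((memLp_green P h1 (P.s j)).const_mul _).const_mul (σ j)
  have hw : HasWeakDerivOn Set.univ (regularPart P (hf.toLp _ : L2) σ) (hg.toLp _ : L2) :=
    (hasWeakDerivOn_sum_green P h1 σ).congr (regularPart_congr hf.coeFn_toLp.symm σ)
      hg.coeFn_toLp.symm
  obtain ⟨m₀, hm₀⟩ := hw.exists_oneSided
  -- The Green functions produce the jumps, but with means `m₀` of their own. A field without jumps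
  -- corrects the means.
  obtain ⟨v, dv, hv, hvl⟩ := exists_velocity P (m - m₀)
  have hv' : HasWeakDerivOn Set.univ (regularPart P v 0) dv := by rwa [regularPart_zero]
  refine ⟨_, _, by simpa only [add_zero] using hw.regularPart_add hv', fun j => ?_⟩
  have e1 : m j + σ j / 2 = (m₀ j + σ j / 2) + (m - m₀) j := by
    rw [Pi.sub_apply]
    ring
  have e2 : m j - σ j / 2 = (m₀ j - σ j / 2) + (m - m₀) j := by
    rw [Pi.sub_apply]
    ring
  rw [e1, e2]
  exact ⟨(hm₀ j).1.add_coe ((hvl j).mono nhdsWithin_le_nhds),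
    (hm₀ j).2.add_coe ((hvl j).mono nhdsWithin_le_nhds)⟩

/-! ### The maximal operator and its boundary data -/

/-- The graph of the maximal operator `B = -A₀*`, together with the boundary data of its elements:
`(Ψ, B Ψ, σ, δ)` with the jumps `σ j` of the pressure and the slips `δ j = v(s_j) - z_j`. -/
def maximalRel (P : Params n) :
    Submodule ℂ (State P × State P × (Fin n → ℂ) × (Fin n → ℂ)) where
  carrier := {x | ∃ dp dv : L2, HasWeakDerivOn Set.univ (regularPart P x.1.p x.2.2.1) dp ∧
    HasWeakDerivOn Set.univ x.1.v dv ∧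
    (∀ j, HasEssLimit x.1.v (𝓝 (P.s j)) (x.1.z j + x.2.2.2 j)) ∧
    x.2.1 = State.mk (-(P.a ^ 2 * P.ρ₀ : ℂ) • dv) (-(1 / P.ρ₀ : ℂ) • dp) x.1.z
      (fun j => -((P.K j / P.M j : ℂ) * x.1.y j + (P.S / P.M j : ℂ) * x.2.2.1 j))}
  zero_mem' := by
    refine ⟨0, 0, ?_, HasWeakDerivOn.zero_coe _, fun j => ?_, ?_⟩
    · simpa using HasWeakDerivOn.zero_coe _
    · simpa using hasEssLimit_zero_coe _
    · refine State.ext' ?_ ?_ ?_ ?_ <;> simp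
      rfl
  add_mem' := by
    rintro ⟨Ψ, Ξ, σ, δ⟩ ⟨Φ, Θ, τ, ε⟩ ⟨dp, dv, h1, h2, h3, h4⟩ ⟨dq, du, k1, k2, k3, k4⟩
    refine ⟨dp + dq, dv + du, h1.regularPart_add k1, h2.add_coe k2, fun j => ?_, ?_⟩
    · have := (h3 j).add_coe (k3 j)
      rw [add_add_add_comm] at this
      exact this
    · simp only at h4 k4
      simp only [Prod.mk_add_mk, h4, k4]
      refine State.ext' ?_ ?_ rfl ?_
      · simp
      · simp
      · funext j
        simp
        ring
  smul_mem' := by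
    rintro c ⟨Ψ, Ξ, σ, δ⟩ ⟨dp, dv, h1, h2, h3, h4⟩
    refine ⟨c • dp, c • dv, h1.regularPart_smul c, h2.smul_coe c, fun j => ?_, ?_⟩
    · have := (h3 j).smul_coe c
      rw [mul_add] at this
      exact this
    · simp only at h4
      simp only [Prod.smul_mk, h4]
      refine State.ext' ?_ ?_ rfl ?_
      · simp [smul_comm c]
      · simp [smul_comm c]
      · funext j
        simp
        ring

theorem mem_maximalRel {Ψ : State P} {dp dv : L2} {σ δ : Fin n → ℂ}
    (hp : HasWeakDerivOn Set.univ (regularPart P Ψ.p σ) dp) (hv : HasWeakDerivOn Set.univ Ψ.v dv)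
    (hδ : ∀ j, HasEssLimit Ψ.v (𝓝 (P.s j)) (Ψ.z j + δ j)) :
    (Ψ, (State.mk (-(P.a ^ 2 * P.ρ₀ : ℂ) • dv) (-(1 / P.ρ₀ : ℂ) • dp) Ψ.z
      (fun j => -((P.K j / P.M j : ℂ) * Ψ.y j + (P.S / P.M j : ℂ) * σ j)) : State P), σ, δ)
      ∈ maximalRel P :=
  ⟨dp, dv, hp, hv, hδ, rfl⟩

theorem M_ne_zero (P : Params n) (j : Fin n) : (P.M j : ℂ) ≠ 0 := by
  exact_mod_cast (P.M_pos j).ne'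

theorem S_ne_zero (P : Params n) : (P.S : ℂ) ≠ 0 := by exact_mod_cast P.S_pos.ne'

theorem ρ₀_ne_zero (P : Params n) : (P.ρ₀ : ℂ) ≠ 0 := by exact_mod_cast P.ρ₀_pos.ne'

/-- Green's identity for the maximal operator. -/
theorem green_identity {Ψ Ξ Φ Θ : State P} {σ δ τ ε : Fin n → ℂ}
    (h : (Ψ, Ξ, σ, δ) ∈ maximalRel P) (h' : (Φ, Θ, τ, ε) ∈ maximalRel P) :
    inner ℂ Ξ Φ + inner ℂ Ψ Θ = ∑ j, (conj (δ j) * τ j + conj (σ j) * ε j) := by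
  obtain ⟨dp, dv, h1, h2, h3, h4⟩ := h
  obtain ⟨dq, du, k1, k2, k3, k4⟩ := h'
  simp only at h1 h2 h3 h4 k1 k2 k3 k4
  have ha := a_ne_zero P
  have hr := ρ₀_ne_zero P
  have hS := S_ne_zero P
  -- The form couples pressure with velocity crosswise: the pressure of `Ψ` with the velocity of
  -- `Φ`, and, after conjugation, the pressure of `Φ` with the velocity of `Ψ`.
  have e1 := inner_add_inner_eq_neg_sum h1 k2 k3
  have e2 := congrArg conj (inner_add_inner_eq_neg_sum k1 h2 h3)
  simp only [map_add, map_neg, map_sum, map_mul, Complex.conj_conj, inner_conj_symm] at e2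
  rw [h4, k4, inner_eq, inner_eq]
  simp only [energyForm, State.p_mk, State.v_mk, State.y_mk, State.z_mk, inner_smul_left,
    inner_smul_right]
  -- In the oscillator part the elastic terms cancel. What remains comes from the force `S σ_j` on
  -- the wall, and it cancels the `z` part of `v(s_j) = z_j + δ_j` in the field terms, so that only
  -- slips survive.
  have e3 : ((1 / P.S : ℝ) : ℂ) * ∑ j, ((P.K j : ℂ) * (conj (Ψ.z j) * Φ.y j) + (P.M j : ℂ) *
        (conj (-((P.K j / P.M j : ℂ) * Ψ.y j + (P.S / P.M j : ℂ) * σ j)) * Φ.z j))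
      + ((1 / P.S : ℝ) : ℂ) * ∑ j, ((P.K j : ℂ) * (conj (Ψ.y j) * Φ.z j) + (P.M j : ℂ) *
        (conj (Ψ.z j) * (-((P.K j / P.M j : ℂ) * Φ.y j + (P.S / P.M j : ℂ) * τ j))))
      = -∑ j, (conj (σ j) * Φ.z j + conj (Ψ.z j) * τ j) := by
    rw [← mul_add, ← Finset.sum_add_distrib, Finset.mul_sum, ← Finset.sum_neg_distrib]
    refine Finset.sum_congr rfl fun j _ => ?_
    have hM := M_ne_zero P j
    simp only [map_neg, map_add, map_mul, map_div₀, Complex.conj_ofReal]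
    push_cast
    field_simp
    ring
  have e4 : ∑ j, (conj (δ j) * τ j + conj (σ j) * ε j)
      = ∑ j, τ j * (conj (Ψ.z j) + conj (δ j)) + ∑ j, conj (σ j) * (Φ.z j + ε j)
        - ∑ j, (conj (σ j) * Φ.z j + conj (Ψ.z j) * τ j) := by
    rw [← Finset.sum_add_distrib, ← Finset.sum_sub_distrib]
    exact Finset.sum_congr rfl fun j _ => by ring
  rw [e4]
  have c1 : ((1 / (P.a ^ 2 * P.ρ₀) : ℝ) : ℂ) * (P.a ^ 2 * P.ρ₀ : ℂ) = 1 := by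
    push_cast
    field_simp
  have c2 : (P.ρ₀ : ℂ) * (1 / P.ρ₀ : ℂ) = 1 := by field_simp
  have c3 : conj (-(P.a ^ 2 * P.ρ₀ : ℂ)) = -(P.a ^ 2 * P.ρ₀ : ℂ) := by simp
  have c4 : conj (-(1 / P.ρ₀ : ℂ)) = -(1 / P.ρ₀ : ℂ) := by simp
  rw [c3, c4]
  linear_combination e3 - e1 - e2 - (inner ℂ dv Φ.p + inner ℂ Ψ.p du) * c1
    - (inner ℂ dp Φ.v + inner ℂ Ψ.v dq) * c2

/-- Jumps and slips are read off from essential limits, and weak derivatives on the line are unique.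
Hence `Ψ` determines both its image and its boundary data. -/
theorem maximalRel_unique {Ψ Ξ Ξ' : State P} {σ δ σ' δ' : Fin n → ℂ}
    (h : (Ψ, Ξ, σ, δ) ∈ maximalRel P) (h' : (Ψ, Ξ', σ', δ') ∈ maximalRel P) :
    Ξ = Ξ' ∧ σ = σ' ∧ δ = δ' := by
  obtain ⟨dp, dv, h1, h2, h3, h4⟩ := h
  obtain ⟨dq, du, k1, k2, k3, k4⟩ := h'
  simp only at h1 h2 h3 h4 k1 k2 k3 k4
  have hσ : σ = σ' := funext fun j => (h1.hasJump j).unique (k1.hasJump j)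
  subst hσ
  refine ⟨?_, rfl, funext fun j => add_left_cancel ((h3 j).unique (k3 j))⟩
  rw [h4, k4, h1.unique k1, h2.unique k2]

theorem star_smul_coe (c : ℂ) (f : L2) : star (c • f) = conj c • star f := by
  refine Lp.ext ?_
  filter_upwards [Lp.coeFn_star (c • f), Lp.coeFn_smul c f, Lp.coeFn_smul (conj c) (star f),
    Lp.coeFn_star f] with x h1 h2 h3 h4
  rw [h1, h3, Pi.star_apply, h2, Pi.smul_apply, Pi.smul_apply, h4, Pi.star_apply]
  simp

/-- All coefficients of `B` are real, so conjugation acts on boundary data by conjugation. -/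
theorem maximalRel_conjugate {Ψ Ξ : State P} {σ δ : Fin n → ℂ}
    (h : (Ψ, Ξ, σ, δ) ∈ maximalRel P) :
    (Ψ.conjugate, Ξ.conjugate, star σ, star δ) ∈ maximalRel P := by
  obtain ⟨dp, dv, h1, h2, h3, h4⟩ := h
  simp only at h1 h2 h3 h4
  refine ⟨star dp, star dv, h1.regularPart_star, h2.star_coe, fun j => ?_, ?_⟩
  · have := (h3 j).star_coe
    rw [map_add] at this
    exact this
  · rw [h4]
    refine State.ext' ?_ ?_ rfl ?_
    · exact (star_smul_coe _ _).trans (by simp)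
    · exact (star_smul_coe _ _).trans (by simp)
    · funext j
      simp [State.conjugate]

theorem exists_maximalRel {Ψ : State P} (hp : Ψ.p ∈ H1 (Set.range P.s)ᶜ)
    (hv : Ψ.v ∈ H1 Set.univ) : ∃ Ξ σ δ, (Ψ, Ξ, σ, δ) ∈ maximalRel P := by
  obtain ⟨dp, hdp⟩ := hp
  obtain ⟨dv, hdv⟩ := hv
  obtain ⟨σ, hσ⟩ := hdp.exists_regularPart P (locallyIntegrable_coe _) (locallyIntegrable_coe _)
  choose c hc using fun j => hdv.exists_hasEssLimit (P.s j)
  exact ⟨_, σ, fun j => c j - Ψ.z j, mem_maximalRel hσ hdv fun j => by simpa using hc j⟩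

theorem mem_H1_of_maximalRel {Ψ Ξ : State P} {σ δ : Fin n → ℂ}
    (h : (Ψ, Ξ, σ, δ) ∈ maximalRel P) : Ψ.p ∈ H1 (Set.range P.s)ᶜ ∧ Ψ.v ∈ H1 Set.univ := by
  obtain ⟨dp, dv, h1, h2, h3, h4⟩ := h
  exact ⟨⟨dp, h1.of_regularPart⟩, ⟨dv, h2⟩⟩

theorem kinematic_iff_of_maximalRel {Ψ Ξ : State P} {σ δ : Fin n → ℂ}
    (h : (Ψ, Ξ, σ, δ) ∈ maximalRel P) (j : Fin n) :
    HasEssLimit Ψ.v (𝓝 (P.s j)) (Ψ.z j) ↔ δ j = 0 := by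
  obtain ⟨dp, dv, h1, h2, h3, h4⟩ := h
  constructor
  · intro hk
    simpa using (h3 j).unique hk
  · intro hδ
    simpa [hδ] using h3 j

/-- The boundary data of the maximal operator are arbitrary. -/
theorem exists_maximalRel_of_traces (P : Params n) (σ m w y z : Fin n → ℂ) :
    ∃ p v : L2, (∃ Ξ, (State.mk p v y z, Ξ, σ, w - z) ∈ maximalRel P) ∧
      (∀ j, HasEssLimit p (𝓝[>] (P.s j)) (m j + σ j / 2) ∧
        HasEssLimit p (𝓝[<] (P.s j)) (m j - σ j / 2)) ∧
      ∀ j, HasEssLimit v (𝓝 (P.s j)) (w j) := by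
  obtain ⟨p, dp, hp, hpl⟩ := exists_pressure P σ m
  obtain ⟨v, dv, hv, hvl⟩ := exists_velocity P w
  exact ⟨p, v, ⟨_, mem_maximalRel hp hv fun j => by simpa using hvl j⟩, hpl, hvl⟩

theorem freeGen_maximalRel (Ψ : (freeGen P).domain) :
    ∃ δ, ((Ψ : State P), freeGen P Ψ, (0 : Fin n → ℂ), δ) ∈ maximalRel P := by
  have hv := weakDeriv_spec ⟨Ψ.1.v, Ψ.2.2⟩
  choose c hc using fun j => hv.exists_hasEssLimit (P.s j)
  refine ⟨fun j => c j - Ψ.1.z j, weakDeriv ⟨Ψ.1.p, Ψ.2.1⟩, weakDeriv ⟨Ψ.1.v, Ψ.2.2⟩, ?_, hv,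
    fun j => by simpa using hc j, ?_⟩
  · simpa using weakDeriv_spec ⟨Ψ.1.p, Ψ.2.1⟩
  · refine State.ext' rfl rfl rfl (funext fun j => ?_)
    change -((P.K j / P.M j : ℂ) * Ψ.1.y j) = -((P.K j / P.M j : ℂ) * Ψ.1.y j
      + (P.S / P.M j : ℂ) * 0)
    rw [mul_zero, add_zero]

/-- Together with `freeGen_maximalRel` this identifies `A` with the part of `B` without jumps, so
that later arguments only handle boundary data. -/
theorem freeGen_apply_of_maximalRel {Ψ Ξ : State P} {δ : Fin n → ℂ}
    (h : (Ψ, Ξ, (0 : Fin n → ℂ), δ) ∈ maximalRel P) :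
    ∃ hΨ : Ψ ∈ (freeGen P).domain, freeGen P ⟨Ψ, hΨ⟩ = Ξ := by
  obtain ⟨dp, dv, h1, h2, h3, h4⟩ := id h
  simp only [regularPart_zero] at h1 h2
  have hΨ : Ψ ∈ (freeGen P).domain := ⟨⟨dp, h1⟩, ⟨dv, h2⟩⟩
  obtain ⟨δ', h'⟩ := freeGen_maximalRel ⟨Ψ, hΨ⟩
  exact ⟨hΨ, (maximalRel_unique h' h).1⟩

theorem restrictedGen_maximalRel (Ψ : (restrictedGen P).domain) :
    ((Ψ : State P), restrictedGen P Ψ, (0 : Fin n → ℂ), (0 : Fin n → ℂ)) ∈ maximalRel P := by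
  obtain ⟨δ, h⟩ := freeGen_maximalRel ⟨Ψ.1, Ψ.2.2⟩
  have hδ : δ = 0 := funext fun j => (kinematic_iff_of_maximalRel h j).1 (Ψ.2.1 j)
  rw [hδ] at h
  exact h

theorem restrictedGen_apply_of_maximalRel {Ψ Ξ : State P}
    (h : (Ψ, Ξ, (0 : Fin n → ℂ), (0 : Fin n → ℂ)) ∈ maximalRel P) :
    ∃ hΨ : Ψ ∈ (restrictedGen P).domain, restrictedGen P ⟨Ψ, hΨ⟩ = Ξ := by
  obtain ⟨h1, h2⟩ := freeGen_apply_of_maximalRel h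
  exact ⟨⟨fun j => (kinematic_iff_of_maximalRel h j).2 rfl, h1⟩, h2⟩

/-! ### The adjoint of the restricted generator -/

/-- A test function as an element of `L²(ℝ)`. -/
noncomputable def testL2 {φ : ℝ → ℝ} (hφ : Continuous φ) (hc : HasCompactSupport φ) : L2 :=
  (memLp_test hφ hc).toLp

theorem inner_testL2 {φ : ℝ → ℝ} (hφ : Continuous φ) (hc : HasCompactSupport φ) (f : L2) :
    inner ℂ (testL2 hφ hc) f = ∫ x, φ x • f x := by
  rw [L2.inner_def]
  refine integral_congr_ae ?_
  filter_upwards [(memLp_test hφ hc).coeFn_toLp] with x hx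
  rw [testL2, hx]
  simp [RCLike.inner_apply, mul_comm]

theorem hasWeakDerivOn_testL2 {φ : ℝ → ℝ} (hφ : ContDiff ℝ ∞ φ) (hc : HasCompactSupport φ) :
    HasWeakDerivOn Set.univ (testL2 hφ.continuous hc)
      (testL2 (hφ.continuous_deriv (by simp)) hc.deriv) :=
  (IsPrimitive.of_test hφ).hasWeakDerivOn.congr
    (memLp_test hφ.continuous hc).coeFn_toLp.symm
    (memLp_test (hφ.continuous_deriv (by simp)) hc.deriv).coeFn_toLp.symm

theorem hasEssLimit_testL2 {φ : ℝ → ℝ} (hφ : Continuous φ) (hc : HasCompactSupport φ) (s : ℝ) :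
    HasEssLimit (testL2 hφ hc) (𝓝 s) (φ s) :=
  (HasEssLimit.of_tendsto ((Complex.continuous_ofReal.comp hφ).tendsto s)).congr
    (memLp_test hφ hc).coeFn_toLp.symm

/-- The constraint of `A₀` concerns velocities only, so test pressures need not vanish at the walls.
-/
theorem maximalRel_testL2_left {φ : ℝ → ℝ} (hφ : ContDiff ℝ ∞ φ) (hc : HasCompactSupport φ) :
    ((State.mk (testL2 hφ.continuous hc) 0 0 0 : State P),
      (State.mk 0 (-(1 / P.ρ₀ : ℂ) • testL2 (hφ.continuous_deriv (by simp)) hc.deriv) 0 0 : State P),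
      (0 : Fin n → ℂ), (0 : Fin n → ℂ)) ∈ maximalRel P := by
  refine ⟨_, _, by simpa using hasWeakDerivOn_testL2 hφ hc, HasWeakDerivOn.zero_coe _,
    fun j => by simpa using hasEssLimit_zero_coe _, ?_⟩
  refine State.ext' ?_ ?_ ?_ ?_ <;> simp
  rfl

theorem maximalRel_testL2_right {φ : ℝ → ℝ} (hφ : ContDiff ℝ ∞ φ) (hc : HasCompactSupport φ)
    (h0 : ∀ j, φ (P.s j) = 0) :
    ((State.mk 0 (testL2 hφ.continuous hc) 0 0 : State P),
      (State.mk (-(P.a ^ 2 * P.ρ₀ : ℂ) • testL2 (hφ.continuous_deriv (by simp)) hc.deriv) 0 0 0 :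
        State P),
      (0 : Fin n → ℂ), (0 : Fin n → ℂ)) ∈ maximalRel P := by
  refine ⟨0, _, by simpa using HasWeakDerivOn.zero_coe _, hasWeakDerivOn_testL2 hφ hc,
    fun j => ?_, ?_⟩
  · simpa [h0] using hasEssLimit_testL2 hφ.continuous hc (P.s j)
  · refine State.ext' ?_ ?_ ?_ ?_ <;> simp
    rfl

/-- A vector orthogonal to the domain is tested componentwise. Test velocities with `z = 0` must
vanish at the walls, a null set. A state with `z = e_j` needs a velocity field with `v(s_j) = 1`,
but that field no longer contributes once `Ψ.v = 0` is known; hence the order of the four steps. -/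
theorem dense_restrictedGen (P : Params n) : Dense ((restrictedGen P).domain : Set (State P)) := by
  rw [Submodule.dense_iff_topologicalClosure_eq_top, Submodule.topologicalClosure_eq_top_iff,
    Submodule.eq_bot_iff]
  intro Ψ hΨ
  have hΨ' : ∀ Φ Θ : State P, (Φ, Θ, (0 : Fin n → ℂ), (0 : Fin n → ℂ)) ∈ maximalRel P →
      energyForm Φ Ψ = 0 := fun Φ Θ h =>
    (Submodule.mem_orthogonal _ _).1 hΨ Φ (restrictedGen_apply_of_maximalRel h).1
  have ha := a_ne_zero P
  have hr := ρ₀_ne_zero P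
  have hS := S_ne_zero P
  have hp : Ψ.p = 0 := by
    refine Lp.ext (EventuallyEq.trans (ae_eq_zero_of_integral_contDiff_smul_eq_zero
      (locallyIntegrable_coe _) fun φ hφ hc => ?_) (Lp.coeFn_zero _ _ _).symm)
    have h := hΨ' _ _ (maximalRel_testL2_left hφ hc)
    simp only [energyForm, State.p_mk, State.v_mk, State.y_mk, State.z_mk, inner_zero_left,
      Pi.zero_apply, map_zero, zero_mul, mul_zero, add_zero, Finset.sum_const_zero,
      inner_testL2] at h
    refine (mul_eq_zero.1 h).resolve_left ?_
    push_cast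
    simp [ha, hr]
  have hv : Ψ.v = 0 := by
    have hfin : (Set.range P.s).Finite := Set.finite_range _
    have h1 := hfin.isClosed.isOpen_compl.ae_eq_zero_of_integral_contDiff_smul_eq_zero
      ((locallyIntegrable_coe Ψ.v).locallyIntegrableOn _) fun φ hφ hc hU => by
        have h := hΨ' _ _ (maximalRel_testL2_right hφ hc fun j =>
          image_eq_zero_of_notMem_tsupport fun hm => hU hm ⟨j, rfl⟩)
        simp only [energyForm, State.p_mk, State.v_mk, State.y_mk, State.z_mk, inner_zero_left,
          Pi.zero_apply, map_zero, zero_mul, mul_zero, add_zero, zero_add, Finset.sum_const_zero,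
          inner_testL2] at h
        exact (mul_eq_zero.1 h).resolve_left hr
    refine Lp.ext (EventuallyEq.trans ?_ (Lp.coeFn_zero _ _ _).symm)
    filter_upwards [h1, compl_mem_ae_iff.2 (hfin.measure_zero volume)] with x hx hxs
    exact hx hxs
  have hy : Ψ.y = 0 := by
    funext j
    have h := hΨ' (State.mk 0 0 (Pi.single j 1) 0) _
      (mem_maximalRel (dp := 0) (dv := 0) (by simpa using HasWeakDerivOn.zero_coe _)
        (HasWeakDerivOn.zero_coe _) fun j => by simpa using hasEssLimit_zero_coe _)
    simp only [energyForm, State.p_mk, State.v_mk, State.y_mk, State.z_mk, inner_zero_left,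
      Pi.zero_apply, map_zero, zero_mul, mul_zero, add_zero, zero_add] at h
    rw [Finset.sum_eq_single j (fun i _ hi => by simp [hi]) (by simp)] at h
    have hK : (P.K j : ℂ) ≠ 0 := by exact_mod_cast (P.K_pos j).ne'
    simpa [hS, hK] using h
  have hz : Ψ.z = 0 := by
    classical
    funext j
    obtain ⟨v, dv, hvd, hvl⟩ := exists_velocity P (Pi.single j 1)
    have h := hΨ' (State.mk 0 v 0 (Pi.single j 1)) _
      (mem_maximalRel (dp := 0) (by simpa using HasWeakDerivOn.zero_coe _) hvd
        fun j => by simpa using hvl j)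
    simp only [energyForm, State.p_mk, State.v_mk, State.y_mk, State.z_mk, inner_zero_left, hv,
      inner_zero_right, Pi.zero_apply, map_zero, zero_mul, mul_zero, add_zero, zero_add] at h
    rw [Finset.sum_eq_single j (fun i _ hi => by simp [hi]) (by simp)] at h
    have hM := M_ne_zero P j
    simpa [hS, hM] using h
  exact State.ext' hp hv hy hz

/-- The maximal operator is `-A₀*`. -/
theorem adjoint_restrictedGen_of_maximalRel {Ψ Ξ : State P} {σ δ : Fin n → ℂ}
    (h : (Ψ, Ξ, σ, δ) ∈ maximalRel P) :
    ∃ hΨ : Ψ ∈ (restrictedGen P).adjoint.domain, (restrictedGen P).adjoint ⟨Ψ, hΨ⟩ = -Ξ := by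
  have key : ∀ Φ : (restrictedGen P).domain,
      inner ℂ (-Ξ) (Φ : State P) = inner ℂ Ψ (restrictedGen P Φ) := fun Φ => by
    have := green_identity h (restrictedGen_maximalRel Φ)
    simp only [Pi.zero_apply, mul_zero, add_zero, Finset.sum_const_zero] at this
    rw [inner_neg_left]
    linear_combination -this
  exact ⟨LinearPMap.mem_adjoint_domain_of_exists _ ⟨-Ξ, key⟩,
    LinearPMap.adjoint_apply_eq (dense_restrictedGen P) _ key⟩

/-- Test pressures are unrestricted and give a weak derivative of `v` on the whole line; test
velocities must avoid the walls and give one of `p` only off them. This regularity is all that has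
to be extracted from the adjoint. -/
theorem exists_maximalRel_of_mem_adjoint {Ψ : State P}
    (hΨ : Ψ ∈ (restrictedGen P).adjoint.domain) :
    ∃ σ δ, (Ψ, -(restrictedGen P).adjoint ⟨Ψ, hΨ⟩, σ, δ) ∈ maximalRel P := by
  have hadj := LinearPMap.adjoint_isFormalAdjoint (dense_restrictedGen P) ⟨Ψ, hΨ⟩
  set W := (restrictedGen P).adjoint ⟨Ψ, hΨ⟩ with hW
  have hadj' : ∀ Φ Θ : State P, (Φ, Θ, (0 : Fin n → ℂ), (0 : Fin n → ℂ)) ∈ maximalRel P →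
      energyForm Φ W = energyForm Θ Ψ := fun Φ Θ h => by
    obtain ⟨hΦ, hΘ⟩ := restrictedGen_apply_of_maximalRel h
    have := congrArg conj (hadj ⟨Φ, hΦ⟩)
    rw [inner_conj_symm, inner_conj_symm, hΘ] at this
    exact this
  have ha := a_ne_zero P
  have hr := ρ₀_ne_zero P
  have hv : Ψ.v ∈ H1 Set.univ := by
    refine ⟨(1 / (P.a ^ 2 * P.ρ₀) : ℂ) • W.p, HasWeakDerivOn.congr (f := Ψ.v)
      (g := (1 / (P.a ^ 2 * P.ρ₀) : ℂ) • ⇑W.p) ⟨?_, ?_, fun φ hφ hc _ => ?_⟩ EventuallyEq.rfl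
      (Lp.coeFn_smul _ _).symm⟩
    · exact (locallyIntegrable_coe _).locallyIntegrableOn _
    · exact ((locallyIntegrable_coe _).smul _).locallyIntegrableOn _
    · have h := hadj' _ _ (maximalRel_testL2_left hφ hc)
      simp only [energyForm, State.p_mk, State.v_mk, State.y_mk, State.z_mk, inner_zero_left,
        Pi.zero_apply, map_zero, zero_mul, mul_zero, add_zero, zero_add, Finset.sum_const_zero,
        inner_smul_left, inner_testL2] at h
      simp only [Pi.smul_apply, smul_comm _ (1 / (P.a ^ 2 * P.ρ₀) : ℂ)]
      rw [integral_smul, smul_eq_mul]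
      simp only [map_neg, map_div₀, map_one, Complex.conj_ofReal] at h
      push_cast at h
      rw [h]
      field_simp
  have hp : Ψ.p ∈ H1 (Set.range P.s)ᶜ := by
    refine ⟨(P.ρ₀ : ℂ) • W.v, HasWeakDerivOn.congr (f := Ψ.p)
      (g := (P.ρ₀ : ℂ) • ⇑W.v) ⟨?_, ?_, fun φ hφ hc hU => ?_⟩ EventuallyEq.rfl
      (Lp.coeFn_smul _ _).symm⟩
    · exact (locallyIntegrable_coe _).locallyIntegrableOn _
    · exact ((locallyIntegrable_coe _).smul _).locallyIntegrableOn _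
    · have h := hadj' _ _ (maximalRel_testL2_right hφ hc fun j =>
        image_eq_zero_of_notMem_tsupport fun hm => hU hm ⟨j, rfl⟩)
      simp only [energyForm, State.p_mk, State.v_mk, State.y_mk, State.z_mk, inner_zero_left,
        Pi.zero_apply, map_zero, zero_mul, mul_zero, add_zero, zero_add, Finset.sum_const_zero,
        inner_smul_left, inner_testL2] at h
      simp only [Pi.smul_apply, smul_comm _ (P.ρ₀ : ℂ)]
      rw [integral_smul, smul_eq_mul, h]
      simp only [map_neg, map_mul, map_pow, Complex.conj_ofReal]
      push_cast
      field_simp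
  -- The reverse inclusion now evaluates the adjoint at `Ψ`, so its oscillator components need no
  -- separate test.
  obtain ⟨Ξ, σ, δ, h⟩ := exists_maximalRel hp hv
  obtain ⟨hΨ', e⟩ := adjoint_restrictedGen_of_maximalRel h
  refine ⟨σ, δ, ?_⟩
  rw [hW, e, neg_neg]
  exact h

/-! ### Skew-adjoint operators -/

theorem le_of_forall_apply_eq {T T' : State P →ₗ.[ℂ] State P}
    (h : ∀ Ψ : T.domain, ∃ hΨ : (Ψ : State P) ∈ T'.domain, T' ⟨Ψ, hΨ⟩ = T Ψ) : T ≤ T' :=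
  ⟨fun Ψ hΨ => (h ⟨Ψ, hΨ⟩).1, fun Ψ Φ e => by
    obtain ⟨hΨ, h'⟩ := h Ψ
    rw [← h']
    exact congrArg T' (Subtype.ext e)⟩

theorem exists_apply_eq_of_le {T T' : State P →ₗ.[ℂ] State P} (h : T ≤ T') (Ψ : T.domain) :
    ∃ hΨ : (Ψ : State P) ∈ T'.domain, T' ⟨Ψ, hΨ⟩ = T Ψ :=
  ⟨h.1 Ψ.2, (h.2 rfl).symm⟩

theorem IsSkewAdjoint.inner_add_inner {T : State P →ₗ.[ℂ] State P} (hT : IsSkewAdjoint T)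
    (Ψ Φ : T.domain) : inner ℂ (T Ψ) (Φ : State P) + inner ℂ (Ψ : State P) (T Φ) = 0 := by
  have h := LinearPMap.adjoint_isFormalAdjoint hT.1
  rw [hT.2] at h
  have h' := h Ψ Φ
  rw [LinearPMap.neg_apply, inner_neg_left] at h'
  rw [← h']
  ring

/-- This is the inclusion `T* ≤ -T`: a pair which is skew to the whole graph lies in the graph. -/
theorem IsSkewAdjoint.apply_eq_of_inner {T : State P →ₗ.[ℂ] State P} (hT : IsSkewAdjoint T)
    {Ψ Ξ : State P} (h : ∀ Φ : T.domain, inner ℂ Ξ (Φ : State P) + inner ℂ Ψ (T Φ) = 0) :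
    ∃ hΨ : Ψ ∈ T.domain, T ⟨Ψ, hΨ⟩ = Ξ := by
  have key : ∀ Φ : T.domain, inner ℂ (-Ξ) (Φ : State P) = inner ℂ Ψ (T Φ) := fun Φ => by
    rw [inner_neg_left]
    linear_combination -h Φ
  have hmem := LinearPMap.mem_adjoint_domain_of_exists Ψ ⟨-Ξ, key⟩
  have hval := LinearPMap.adjoint_apply_eq hT.1 ⟨Ψ, hmem⟩ key
  obtain ⟨hΨ, e⟩ := exists_apply_eq_of_le hT.2.le ⟨Ψ, hmem⟩
  refine ⟨hΨ, ?_⟩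
  rw [hval] at e
  exact neg_injective e

theorem isSkewAdjoint_of_inner {T : State P →ₗ.[ℂ] State P}
    (hd : Dense (T.domain : Set (State P)))
    (hs : ∀ Ψ Φ : T.domain, inner ℂ (T Ψ) (Φ : State P) + inner ℂ (Ψ : State P) (T Φ) = 0)
    (hm : ∀ Ψ Ξ : State P, (∀ Φ : T.domain, inner ℂ Ξ (Φ : State P) + inner ℂ Ψ (T Φ) = 0) →
      Ψ ∈ T.domain) : IsSkewAdjoint T := by
  have hle : -T ≤ T.adjoint := LinearPMap.IsFormalAdjoint.le_adjoint hd fun Ψ Φ => by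
    rw [LinearPMap.neg_apply, inner_neg_right]
    linear_combination hs Ψ Φ
  refine ⟨hd, (LinearPMap.eq_of_le_of_domain_eq hle (le_antisymm hle.1 fun Ψ hΨ => ?_)).symm⟩
  refine hm Ψ (-T.adjoint ⟨Ψ, hΨ⟩) fun Φ => ?_
  rw [inner_neg_left, LinearPMap.adjoint_isFormalAdjoint hd ⟨Ψ, hΨ⟩ Φ]
  ring

/-- The graph of `T'` is skew to that of `T`, hence contained in it by maximality. -/
theorem IsSkewAdjoint.eq_of_le {T T' : State P →ₗ.[ℂ] State P} (hT : IsSkewAdjoint T)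
    (hT' : IsSkewAdjoint T') (h : T ≤ T') : T = T' := by
  refine LinearPMap.eq_of_le_of_domain_eq h (le_antisymm h.1 fun Ψ hΨ => ?_)
  refine (hT.apply_eq_of_inner (Ξ := T' ⟨Ψ, hΨ⟩) fun Φ => ?_).1
  obtain ⟨hΦ, e⟩ := exists_apply_eq_of_le h Φ
  rw [← e]
  exact hT'.inner_add_inner ⟨Ψ, hΨ⟩ ⟨Φ, hΦ⟩

/-! ### Skew-adjoint extensions -/

theorem maximalRel_of_inner {Ψ Ξ : State P}
    (h : ∀ Φ : (restrictedGen P).domain,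
      inner ℂ Ξ (Φ : State P) + inner ℂ Ψ (restrictedGen P Φ) = 0) :
    ∃ σ δ, (Ψ, Ξ, σ, δ) ∈ maximalRel P := by
  have key : ∀ Φ : (restrictedGen P).domain,
      inner ℂ (-Ξ) (Φ : State P) = inner ℂ Ψ (restrictedGen P Φ) := fun Φ => by
    rw [inner_neg_left]
    linear_combination -h Φ
  have hmem := LinearPMap.mem_adjoint_domain_of_exists Ψ ⟨-Ξ, key⟩
  have hval := LinearPMap.adjoint_apply_eq (dense_restrictedGen P) ⟨Ψ, hmem⟩ key
  obtain ⟨σ, δ, hr⟩ := exists_maximalRel_of_mem_adjoint hmem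
  rw [hval, neg_neg] at hr
  exact ⟨σ, δ, hr⟩

theorem maximalRel_of_inner_of_le {T : State P →ₗ.[ℂ] State P} (hT : restrictedGen P ≤ T)
    {Ψ Ξ : State P} (h : ∀ Φ : T.domain, inner ℂ Ξ (Φ : State P) + inner ℂ Ψ (T Φ) = 0) :
    ∃ σ δ, (Ψ, Ξ, σ, δ) ∈ maximalRel P :=
  maximalRel_of_inner fun Φ => by
    obtain ⟨hΦ, e⟩ := exists_apply_eq_of_le hT Φ
    rw [← e]
    exact h ⟨Φ, hΦ⟩

/-- Every skew-adjoint extension of `A₀` is a restriction of the maximal operator. -/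
theorem IsSkewAdjoint.maximalRel {T : State P →ₗ.[ℂ] State P} (hs : IsSkewAdjoint T)
    (hT : restrictedGen P ≤ T) (Ψ : T.domain) :
    ∃ σ δ, ((Ψ : State P), T Ψ, σ, δ) ∈ maximalRel P :=
  maximalRel_of_inner_of_le hT fun Φ => hs.inner_add_inner Ψ Φ

theorem mem_adjoint_of_maximalRel {Ψ Ξ : State P} {σ δ : Fin n → ℂ}
    (h : (Ψ, Ξ, σ, δ) ∈ maximalRel P) : Ψ ∈ (restrictedGen P).adjoint.domain :=
  (adjoint_restrictedGen_of_maximalRel h).1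

/-! ### The free generator -/

theorem restrictedGen_le_freeGen (P : Params n) : restrictedGen P ≤ freeGen P :=
  le_of_forall_apply_eq fun Ψ => ⟨Ψ.2.2, rfl⟩

/-- Every term of Green's identity contains a jump, so it vanishes on jump-free states. Conversely,
a jump-free state whose only slip is at `s_j` detects `σ_j`, so the domain is maximal. -/
theorem isSkewAdjoint_freeGen (P : Params n) : IsSkewAdjoint (freeGen P) := by
  classical
  refine isSkewAdjoint_of_inner
    ((dense_restrictedGen P).mono (restrictedGen_le_freeGen P).1) (fun Ψ Φ => ?_)
    fun Ψ Ξ h => ?_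
  · obtain ⟨δ, hΨ⟩ := freeGen_maximalRel Ψ
    obtain ⟨ε, hΦ⟩ := freeGen_maximalRel Φ
    rw [green_identity hΨ hΦ]
    simp
  · obtain ⟨σ, δ, hΨ⟩ := maximalRel_of_inner_of_le (restrictedGen_le_freeGen P) h
    have hσ : σ = 0 := funext fun j => by
      obtain ⟨p, v, ⟨Θ, hΦ⟩, -, -⟩ := exists_maximalRel_of_traces P 0 0 (Pi.single j 1) 0 0
      obtain ⟨hm, e⟩ := freeGen_apply_of_maximalRel hΦ
      have key := h ⟨_, hm⟩
      rw [e, green_identity hΨ hΦ,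
        Finset.sum_eq_single j (fun i _ hi => by simp [hi]) (by simp)] at key
      simpa using key
    rw [hσ] at hΨ
    exact (freeGen_apply_of_maximalRel hΨ).1

theorem isReal_freeGen (P : Params n) : IsReal (freeGen P) := fun Ψ => by
  obtain ⟨δ, hΨ⟩ := freeGen_maximalRel Ψ
  have h := maximalRel_conjugate hΨ
  rw [star_zero] at h
  exact freeGen_apply_of_maximalRel h

theorem hasLocalConditions_freeGen (P : Params n) : HasLocalConditions (freeGen P) := by
  -- The local condition is `p(s_j⁻) = p(s_j⁺)`.
  refine ⟨fun _ => LinearMap.eqLocus (LinearMap.fst ℂ ℂ (ℂ × ℂ × ℂ × ℂ))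
    (LinearMap.fst ℂ ℂ (ℂ × ℂ × ℂ) ∘ₗ LinearMap.snd ℂ ℂ (ℂ × ℂ × ℂ × ℂ)), fun Ψ hΨ => ?_⟩
  obtain ⟨σ, δ, h⟩ := exists_maximalRel_of_mem_adjoint hΨ
  obtain ⟨dp, dv, h1, h2, h3, h4⟩ := id h
  obtain ⟨m, hm⟩ := h1.exists_oneSided
  constructor
  · intro hΨ' j
    obtain ⟨δ', h'⟩ := freeGen_maximalRel ⟨Ψ, hΨ'⟩
    have hσ : σ j = 0 := congrFun (maximalRel_unique h h').2.1 j
    exact ⟨_, _, _, (hm j).2, (hm j).1, h3 j, by simp [hσ]⟩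
  · intro hL
    have hσ : σ = 0 := funext fun j => by
      obtain ⟨pl, pr, vj, hl, hr, -, he⟩ := hL j
      have he' : pl = pr := he
      exact (h1.hasJump j).unique ⟨pr, pl, hr, hl, by simp [he']⟩
    rw [hσ] at h
    exact (freeGen_apply_of_maximalRel h).1

/-- With the fields at rest, `v(s_j) = 0` and the slip at the `j`-th wall is `-z`; all other data
vanish. -/
theorem oscillatorState_maximalRel (P : Params n) (j : Fin n) (y z : ℂ) :
    (oscillatorState P j y z, oscillatorState P j z (-((P.K j / P.M j : ℂ) * y)),
      (0 : Fin n → ℂ), (Pi.single j (-z) : Fin n → ℂ)) ∈ maximalRel P := by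
  refine ⟨0, 0, by simpa [oscillatorState] using HasWeakDerivOn.zero_coe _,
    HasWeakDerivOn.zero_coe _, fun i => ?_, ?_⟩
  · have e : (Pi.single j z : Fin n → ℂ) i + (Pi.single j (-z) : Fin n → ℂ) i = 0 := by
      rw [Pi.single_neg, Pi.neg_apply, add_neg_cancel]
    simp only [oscillatorState, State.z_mk, State.v_mk, e]
    exact hasEssLimit_zero_coe _
  · refine State.ext' ?_ ?_ rfl (funext fun i => ?_)
    · simp [oscillatorState]
    · simp [oscillatorState]
    · by_cases hi : i = j
      · subst hi
        simp [oscillatorState]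
      · simp [oscillatorState, hi]

theorem isDecoupled_freeGen (P : Params n) (j : Fin n) : IsDecoupled (freeGen P) j := fun y z =>
  freeGen_apply_of_maximalRel (oscillatorState_maximalRel P j y z)

theorem eq_freeGen_of_isDecoupled {T : State P →ₗ.[ℂ] State P} (hT : restrictedGen P ≤ T)
    (hs : IsSkewAdjoint T) (hd : ∀ j, IsDecoupled T j) : T = freeGen P := by
  refine hs.eq_of_le (isSkewAdjoint_freeGen P) (le_of_forall_apply_eq fun Ψ => ?_)
  obtain ⟨σ, δ, hΨ⟩ := hs.maximalRel hT Ψ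
  have hσ : σ = 0 := funext fun j => by
    -- The free state with `z = 1` has slip `-1` at `s_j` as its only datum, so pairing with it
    -- isolates `σ_j`.
    obtain ⟨hm, e⟩ := hd j 0 1
    have key := hs.inner_add_inner Ψ ⟨_, hm⟩
    rw [e, green_identity hΨ (oscillatorState_maximalRel P j 0 1),
      Finset.sum_eq_single j (fun i _ hi => by simp [hi]) (by simp)] at key
    simpa using key
  rw [hσ] at hΨ
  exact freeGen_apply_of_maximalRel hΨ

/-! ### The operator with point interactions -/

/-- The operator `Â`: the maximal operator on the states with `v(s_j) = z_j` for all `j`. -/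
noncomputable def pointGen (P : Params n) : State P →ₗ.[ℂ] State P :=
  (-(restrictedGen P).adjoint).domRestrict (kinematic P)

theorem pointGen_maximalRel (Ψ : (pointGen P).domain) :
    ∃ σ, ((Ψ : State P), pointGen P Ψ, σ, (0 : Fin n → ℂ)) ∈ maximalRel P := by
  obtain ⟨σ, δ, h⟩ := exists_maximalRel_of_mem_adjoint Ψ.2.2
  have hδ : δ = 0 := funext fun j => (kinematic_iff_of_maximalRel h j).1 (Ψ.2.1 j)
  rw [hδ] at h
  exact ⟨σ, h⟩

theorem pointGen_apply_of_maximalRel {Ψ Ξ : State P} {σ : Fin n → ℂ}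
    (h : (Ψ, Ξ, σ, (0 : Fin n → ℂ)) ∈ maximalRel P) :
    ∃ hΨ : Ψ ∈ (pointGen P).domain, pointGen P ⟨Ψ, hΨ⟩ = Ξ := by
  have hΨ : Ψ ∈ (pointGen P).domain :=
    ⟨fun j => (kinematic_iff_of_maximalRel h j).2 rfl, mem_adjoint_of_maximalRel h⟩
  obtain ⟨σ', h'⟩ := pointGen_maximalRel ⟨Ψ, hΨ⟩
  exact ⟨hΨ, (maximalRel_unique h' h).1⟩

theorem isPointInteractionGen_pointGen (P : Params n) : IsPointInteractionGen P (pointGen P) where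
  mem_domain_iff Ψ := by
    constructor
    · intro hΨ
      obtain ⟨σ, h⟩ := pointGen_maximalRel ⟨Ψ, hΨ⟩
      obtain ⟨dp, dv, h1, h2, h3, h4⟩ := id h
      exact ⟨(mem_H1_of_maximalRel h).1, (mem_H1_of_maximalRel h).2, ⟨σ, h1.hasJump⟩, hΨ.1⟩
    · rintro ⟨hp, hv, -, hk⟩
      obtain ⟨Ξ, σ, δ, h⟩ := exists_maximalRel hp hv
      exact ⟨hk, mem_adjoint_of_maximalRel h⟩
  apply_eq Ψ σ hσ := by
    obtain ⟨σ', h⟩ := pointGen_maximalRel Ψ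
    obtain ⟨dp, dv, h1, h2, h3, h4⟩ := h
    have e : σ' = σ := funext fun j => (h1.hasJump j).unique (hσ j)
    subst e
    exact ⟨dv, dp, h2, h1, h4⟩

theorem restrictedGen_le_pointGen (P : Params n) : restrictedGen P ≤ pointGen P :=
  le_of_forall_apply_eq fun Ψ => pointGen_apply_of_maximalRel (restrictedGen_maximalRel Ψ)

/-- Mirror image of the argument for `A`: jumps and slips exchange their roles. -/
theorem isSkewAdjoint_pointGen (P : Params n) : IsSkewAdjoint (pointGen P) := by
  classical
  refine isSkewAdjoint_of_inner
    ((dense_restrictedGen P).mono (restrictedGen_le_pointGen P).1) (fun Ψ Φ => ?_)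
    fun Ψ Ξ h => ?_
  · obtain ⟨σ, hΨ⟩ := pointGen_maximalRel Ψ
    obtain ⟨τ, hΦ⟩ := pointGen_maximalRel Φ
    rw [green_identity hΨ hΦ]
    simp
  · obtain ⟨σ, δ, hΨ⟩ := maximalRel_of_inner_of_le (restrictedGen_le_pointGen P) h
    have hδ : δ = 0 := funext fun j => by
      obtain ⟨p, v, ⟨Θ, hΦ⟩, -, -⟩ := exists_maximalRel_of_traces P (Pi.single j 1) 0 0 0 0
      rw [sub_zero] at hΦ
      obtain ⟨hm, e⟩ := pointGen_apply_of_maximalRel hΦ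
      have key := h ⟨_, hm⟩
      rw [e, green_identity hΨ hΦ,
        Finset.sum_eq_single j (fun i _ hi => by simp [hi]) (by simp)] at key
      simpa using key
    rw [hδ] at hΨ
    exact (pointGen_apply_of_maximalRel hΨ).1

theorem isReal_pointGen (P : Params n) : IsReal (pointGen P) := fun Ψ => by
  obtain ⟨σ, hΨ⟩ := pointGen_maximalRel Ψ
  have h := maximalRel_conjugate hΨ
  rw [star_zero] at h
  exact pointGen_apply_of_maximalRel h

/-- The condition at each wall is `v(s_j) = z_j`, and a free oscillator state with `z = 1` violates
it. -/
theorem isLocal_pointGen (P : Params n) : IsLocal (pointGen P) := by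
  refine ⟨⟨fun _ => LinearMap.eqLocus
    (LinearMap.fst ℂ ℂ (ℂ × ℂ) ∘ₗ LinearMap.snd ℂ ℂ (ℂ × ℂ × ℂ) ∘ₗ
      LinearMap.snd ℂ ℂ (ℂ × ℂ × ℂ × ℂ))
    (LinearMap.snd ℂ ℂ ℂ ∘ₗ LinearMap.snd ℂ ℂ (ℂ × ℂ) ∘ₗ LinearMap.snd ℂ ℂ (ℂ × ℂ × ℂ) ∘ₗ
      LinearMap.snd ℂ ℂ (ℂ × ℂ × ℂ × ℂ)), fun Ψ hΨ => ?_⟩, fun j hj => ?_⟩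
  · obtain ⟨σ, δ, h⟩ := exists_maximalRel_of_mem_adjoint hΨ
    obtain ⟨dp, dv, h1, h2, h3, h4⟩ := id h
    obtain ⟨m, hm⟩ := h1.exists_oneSided
    constructor
    · intro hΨ' j
      exact ⟨_, _, _, (hm j).2, (hm j).1, hΨ'.1 j, rfl⟩
    · intro hL
      refine ⟨fun j => ?_, hΨ⟩
      obtain ⟨pl, pr, vj, -, -, hv, he⟩ := hL j
      have he' : vj = Ψ.z j := he
      rwa [← he']
  · obtain ⟨hm, -⟩ := hj 0 1
    have h := (kinematic_iff_of_maximalRel (oscillatorState_maximalRel P j 0 1) j).1 (hm.1 j)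
    simp at h

/-! ### Local conditions -/

/-- Local conditions allow to cut out the boundary data at a single wall. -/
theorem HasLocalConditions.exists_single {T : State P →ₗ.[ℂ] State P} (hT : HasLocalConditions T)
    {Ψ Ξ : State P} {σ δ : Fin n → ℂ} (h : (Ψ, Ξ, σ, δ) ∈ maximalRel P) (hΨ : Ψ ∈ T.domain)
    (j : Fin n) : ∃ Φ ∈ T.domain, ∃ Θ, (Φ, Θ, (Pi.single j (σ j) : Fin n → ℂ),
      (Pi.single j (δ j) : Fin n → ℂ)) ∈ maximalRel P := by
  obtain ⟨L, hL⟩ := hT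
  obtain ⟨pl, pr, vj, hl, hr, hv, hmem⟩ := (hL Ψ (mem_adjoint_of_maximalRel h)).1 hΨ j
  obtain ⟨dp, dv, h1, h2, h3, h4⟩ := id h
  have hσ : σ j = pr - pl := (h1.hasJump j).unique ⟨pr, pl, hr, hl, rfl⟩
  have hδ : δ j = vj - Ψ.z j := by
    rw [hv.unique (h3 j)]
    simp
  -- Jump `pr - pl` and mean `(pr + pl) / 2` reproduce the limits of `Ψ` at wall `j`. All traces and
  -- oscillator components at the other walls are zero, and zero lies in every `L i`.
  obtain ⟨p, v, ⟨Θ, hΦ⟩, hpl, hvl⟩ := exists_maximalRel_of_traces P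
    (Pi.single j (pr - pl)) (Pi.single j ((pr + pl) / 2)) (Pi.single j vj)
    (Pi.single j (Ψ.y j)) (Pi.single j (Ψ.z j))
  refine ⟨State.mk p v (Pi.single j (Ψ.y j)) (Pi.single j (Ψ.z j)), ?_, Θ, ?_⟩
  · refine (hL _ (mem_adjoint_of_maximalRel hΦ)).2 fun i =>
      ⟨_, _, _, (hpl i).2, (hpl i).1, hvl i, ?_⟩
    by_cases hi : i = j
    · subst hi
      simp only [State.y_mk, State.z_mk, Pi.single_eq_same]
      convert hmem using 2
      · ring
      · congr 1
        ring
    · simp only [State.y_mk, State.z_mk, Pi.single_eq_of_ne hi]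
      convert (L i).zero_mem using 1
      simp
  · rw [← Pi.single_sub] at hΦ
    rw [hσ, hδ]
    exact hΦ

theorem isDecoupled_or_kinematic {T : State P →ₗ.[ℂ] State P} (hT : restrictedGen P ≤ T)
    (hs : IsSkewAdjoint T) (hr : IsReal T) (hl : HasLocalConditions T) (j : Fin n) :
    IsDecoupled T j ∨ ∀ Ψ ∈ T.domain, HasEssLimit Ψ.v (nhds (P.s j)) (Ψ.z j) := by
  classical
  refine or_iff_not_imp_right.2 fun hk => ?_
  push Not at hk
  obtain ⟨Ψ, hΨ, hne⟩ := hk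
  obtain ⟨σ, δ, hrel⟩ := hs.maximalRel hT ⟨Ψ, hΨ⟩
  have hδ : δ j ≠ 0 := fun h0 => hne ((kinematic_iff_of_maximalRel hrel j).2 h0)
  obtain ⟨Φ, hΦ, Θ, hΦrel⟩ := hl.exists_single hrel hΨ j
  have hΘ : T ⟨Φ, hΦ⟩ = Θ := by
    obtain ⟨_, _, h⟩ := hs.maximalRel hT ⟨Φ, hΦ⟩
    exact (maximalRel_unique h hΦrel).1
  -- `Φ` has data only at wall `j`, so Green's sum against any state of the domain collapses to one
  -- term, which skew-adjointness makes zero.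
  have key : ∀ (X Y : State P) (τ ε : Fin n → ℂ), X ∈ T.domain → (X, Y, τ, ε) ∈ maximalRel P →
      conj (δ j) * τ j + conj (σ j) * ε j = 0 := fun X Y τ ε hX hXrel => by
    obtain ⟨_, _, h⟩ := hs.maximalRel hT ⟨X, hX⟩
    have hY : T ⟨X, hX⟩ = Y := (maximalRel_unique h hXrel).1
    have := hs.inner_add_inner ⟨Φ, hΦ⟩ ⟨X, hX⟩
    rw [hΘ, hY, green_identity hΦrel hXrel,
      Finset.sum_eq_single j (fun i _ hi => by simp [hi]) (by simp)] at this
    simpa using this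
  have hδ' : conj (δ j) ≠ 0 := by simpa using hδ
  -- For the conjugate of `Ψ` the two products in `key` coincide, so they do not cancel. Without
  -- reality, `δ_j` and `σ_j` could both be nonzero.
  have hσ : σ j = 0 := by
    have h := key _ _ _ _ (hr ⟨Ψ, hΨ⟩).1 (maximalRel_conjugate hrel)
    have h' : 2 * (conj (δ j) * conj (σ j)) = 0 := by
      simp only [Pi.star_apply, RCLike.star_def] at h
      linear_combination h
    simpa [hδ] using h'
  -- Now `key` says that no state of the domain jumps at `s_j`, while an oscillator state has a slip
  -- there as its only datum. Green's form vanishes between them, and maximality applies.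
  intro y z
  refine hs.apply_eq_of_inner fun X => ?_
  obtain ⟨τ, ε, hX⟩ := hs.maximalRel hT X
  have hτ := key _ _ _ _ X.2 hX
  rw [hσ, map_zero, zero_mul, add_zero] at hτ
  have hτ' : τ j = 0 := (mul_eq_zero.1 hτ).resolve_left hδ'
  rw [green_identity (oscillatorState_maximalRel P j y z) hX,
    Finset.sum_eq_single j (fun i _ hi => by simp [hi]) (by simp)]
  simp [hτ']

theorem eq_pointGen_of_isLocal {T : State P →ₗ.[ℂ] State P} (hT : restrictedGen P ≤ T)
    (hs : IsSkewAdjoint T) (hr : IsReal T) (hl : IsLocal T) : T = pointGen P := by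
  refine hs.eq_of_le (isSkewAdjoint_pointGen P) (le_of_forall_apply_eq fun Ψ => ?_)
  obtain ⟨σ, δ, hΨ⟩ := hs.maximalRel hT Ψ
  have hδ : δ = 0 := funext fun j => (kinematic_iff_of_maximalRel hΨ j).1
    ((isDecoupled_or_kinematic hT hs hr hl.1 j).resolve_left (hl.2 j) Ψ Ψ.2)
  rw [hδ] at hΨ
  exact pointGen_apply_of_maximalRel hΨ

/-! ### Resolvents of skew-adjoint operators -/

/-- `⟨⟨Ψ, TΨ⟩⟩` is purely imaginary, so the real part of `⟨⟨Ψ, (-T+ζ)Ψ⟩⟩` is `Re ζ ‖Ψ‖²`;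
Cauchy–Schwarz does the rest. -/
theorem IsSkewAdjoint.norm_le {T : State P →ₗ.[ℂ] State P} (hT : IsSkewAdjoint T) (ζ : ℂ)
    (Ψ : T.domain) : |ζ.re| * ‖(Ψ : State P)‖ ≤ ‖-T Ψ + ζ • (Ψ : State P)‖ := by
  have h0 := hT.inner_add_inner Ψ Ψ
  rw [← inner_conj_symm] at h0
  have h1 : (inner ℂ (Ψ : State P) (T Ψ)).re = 0 := by
    have := congrArg Complex.re h0
    simp only [Complex.add_re, Complex.conj_re, Complex.zero_re] at this
    linarith
  have h2 : (inner ℂ (Ψ : State P) (-T Ψ + ζ • (Ψ : State P))).re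
      = ζ.re * ‖(Ψ : State P)‖ ^ 2 := by
    rw [inner_add_right, inner_neg_right, inner_smul_right, inner_self_eq_norm_sq_to_K,
      Complex.add_re, Complex.neg_re, h1, neg_zero, zero_add]
    change (ζ * ((‖(Ψ : State P)‖ : ℝ) : ℂ) ^ 2).re = _
    rw [← Complex.ofReal_pow, Complex.re_mul_ofReal]
  have h3 : |ζ.re| * ‖(Ψ : State P)‖ ^ 2
      ≤ ‖(Ψ : State P)‖ * ‖-T Ψ + ζ • (Ψ : State P)‖ := by
    calc |ζ.re| * ‖(Ψ : State P)‖ ^ 2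
        = |(inner ℂ (Ψ : State P) (-T Ψ + ζ • (Ψ : State P))).re| := by
          rw [h2, abs_mul, abs_of_nonneg (sq_nonneg ‖(Ψ : State P)‖)]
      _ ≤ ‖inner ℂ (Ψ : State P) (-T Ψ + ζ • (Ψ : State P))‖ := Complex.abs_re_le_norm _
      _ ≤ _ := norm_inner_le_norm _ _
  rcases (norm_nonneg (Ψ : State P)).eq_or_lt with h | h
  · rw [← h, mul_zero]
    exact norm_nonneg _
  · refine le_of_mul_le_mul_left ?_ h
    linarith

theorem IsSkewAdjoint.eq_zero_of_apply {T : State P →ₗ.[ℂ] State P} (hT : IsSkewAdjoint T)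
    {ζ : ℂ} (hζ : ζ.re ≠ 0) (Ψ : T.domain) (h : -T Ψ + ζ • (Ψ : State P) = 0) :
    (Ψ : State P) = 0 := by
  have := hT.norm_le ζ Ψ
  rw [h, norm_zero] at this
  have h' := abs_pos.2 hζ
  exact norm_le_zero_iff.1 (by nlinarith [norm_nonneg (Ψ : State P)])

/-- A right inverse is enough because `-T + ζ` is injective off the imaginary axis. -/
theorem IsSkewAdjoint.isResolvent_of_right {T : State P →ₗ.[ℂ] State P} (hT : IsSkewAdjoint T)
    {ζ : ℂ} (hζ : ζ.re ≠ 0) {R : State P →L[ℂ] State P}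
    (h : ∀ Ψ, ∃ h : R Ψ ∈ T.domain, -T ⟨R Ψ, h⟩ + ζ • R Ψ = Ψ) : IsResolvent T ζ R := by
  refine ⟨h, fun Ψ => ?_⟩
  obtain ⟨hm, e⟩ := h (-T Ψ + ζ • (Ψ : State P))
  have := hT.eq_zero_of_apply hζ (⟨_, hm⟩ - Ψ) (by
    rw [LinearPMap.map_sub, Submodule.coe_sub, smul_sub]
    refine Eq.trans ?_ (sub_eq_zero.2 e)
    abel)
  rw [Submodule.coe_sub, sub_eq_zero] at this
  exact this

/-- Off the imaginary axis, a skew-adjoint operator has a bounded resolvent. -/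
theorem IsSkewAdjoint.exists_isResolvent {T : State P →ₗ.[ℂ] State P} (hT : IsSkewAdjoint T)
    {ζ : ℂ} (hζ : ζ.re ≠ 0) : ∃ R, IsResolvent T ζ R := by
  have hcl : IsClosed (T.graph : Set (State P × State P)) := by
    have h := LinearPMap.adjoint_isClosed (T := T) hT.1
    rw [hT.2] at h
    have h' : (T.graph : Set (State P × State P))
        = (fun x : State P × State P => (x.1, -x.2)) ⁻¹' ((-T).graph : Set _) := by
      ext ⟨x, y⟩
      simp only [SetLike.mem_coe, Set.mem_preimage, LinearPMap.mem_graph_iff,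
        LinearPMap.neg_apply, neg_inj]
      rfl
    rw [h']
    exact h.preimage (by fun_prop)
  have : CompleteSpace T.graph := hcl.completeSpace_coe
  -- On the graph, a complete space since `T` is closed, `-T + ζ` becomes a bounded operator. It is
  -- bounded below, so its range is closed.
  let f : T.graph →L[ℂ] State P :=
    (-ContinuousLinearMap.snd ℂ (State P) (State P)
      + ζ • ContinuousLinearMap.fst ℂ (State P) (State P)).comp T.graph.subtypeL
  have hf : ∀ x : T.graph, f x = -x.1.2 + ζ • x.1.1 := fun x => rfl
  have hre := abs_pos.2 hζ
  have hfst : ∀ x : T.graph, ‖x.1.1‖ ≤ |ζ.re|⁻¹ * ‖f x‖ := fun x => by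
    obtain ⟨Ψ, h1, h2⟩ := (LinearPMap.mem_graph_iff T).1 x.2
    have := hT.norm_le ζ Ψ
    rw [h1, h2, ← hf] at this
    rw [inv_mul_eq_div, le_div_iff₀ hre]
    linarith
  have hbound : ∀ x : T.graph, ‖x‖ ≤ ((‖ζ‖ + 1) * |ζ.re|⁻¹ + 1) * ‖f x‖ := fun x => by
    have h1 := hfst x
    have h0 : 0 ≤ |ζ.re|⁻¹ * ‖f x‖ := by positivity
    have e : x.1.2 = ζ • x.1.1 - f x := by
      rw [hf]
      abel
    have h2 : ‖x.1.2‖ ≤ ‖ζ‖ * (|ζ.re|⁻¹ * ‖f x‖) + ‖f x‖ := by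
      rw [e]
      refine (norm_sub_le _ _).trans ?_
      rw [norm_smul]
      gcongr
    have h3 : 0 ≤ ‖ζ‖ * (|ζ.re|⁻¹ * ‖f x‖) := by positivity
    have hn := norm_nonneg (f x)
    refine max_le ?_ ?_
    · calc ‖x.1.1‖ ≤ |ζ.re|⁻¹ * ‖f x‖ := h1
        _ ≤ ‖ζ‖ * (|ζ.re|⁻¹ * ‖f x‖) + |ζ.re|⁻¹ * ‖f x‖ + ‖f x‖ := by linarith
        _ = _ := by ring
    · calc ‖x.1.2‖ ≤ ‖ζ‖ * (|ζ.re|⁻¹ * ‖f x‖) + ‖f x‖ := h2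
        _ ≤ ‖ζ‖ * (|ζ.re|⁻¹ * ‖f x‖) + |ζ.re|⁻¹ * ‖f x‖ + ‖f x‖ := by linarith
        _ = _ := by ring
  have hanti : AntilipschitzWith (Real.toNNReal ((‖ζ‖ + 1) * |ζ.re|⁻¹ + 1)) f :=
    AddMonoidHomClass.antilipschitz_of_bound f fun x => by
      rw [Real.coe_toNNReal _ (by positivity)]
      exact hbound x
  have hrcl : IsClosed (Set.range f) := hanti.isClosed_range f.uniformContinuous
  have hker : f.ker = ⊥ := LinearMap.ker_eq_bot.2 hanti.injective
  have hrange : f.range = ⊤ := by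
    have hrcl' : IsClosed (f.range : Set (State P)) := by
      rw [LinearMap.coe_range]
      exact hrcl
    rw [← hrcl'.submodule_topologicalClosure_eq, Submodule.topologicalClosure_eq_top_iff,
      Submodule.eq_bot_iff]
    intro Φ hΦ
    -- A vector orthogonal to the range satisfies `TΦ = -ζ̄ Φ`, and `-ζ̄` is again off the imaginary
    -- axis.
    obtain ⟨hm, e⟩ := hT.apply_eq_of_inner (Ψ := Φ) (Ξ := -(conj ζ • Φ)) fun Ψ => by
      have h := (Submodule.mem_orthogonal' _ _).1 hΦ (-T Ψ + ζ • (Ψ : State P))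
        ⟨⟨(Ψ, T Ψ), T.mem_graph Ψ⟩, rfl⟩
      rw [inner_add_right, inner_neg_right, inner_smul_right] at h
      rw [inner_neg_left, inner_smul_left, Complex.conj_conj]
      linear_combination -h
    exact hT.eq_zero_of_apply (ζ := -conj ζ) (by simpa using hζ) ⟨Φ, hm⟩ (by
      rw [e, neg_neg, neg_smul, add_neg_cancel])
  let e := ContinuousLinearEquiv.ofBijective f hker hrange
  refine ⟨((ContinuousLinearMap.fst ℂ (State P) (State P)).comp T.graph.subtypeL).comp
    (e.symm : State P →L[ℂ] T.graph), hT.isResolvent_of_right hζ fun Ψ => ?_⟩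
  obtain ⟨Φ, h1, h2⟩ := (LinearPMap.mem_graph_iff T).1 (e.symm Ψ).2
  have h3 : f (e.symm Ψ) = Ψ := e.apply_symm_apply Ψ
  rw [hf, ← h1, ← h2] at h3
  have h4 : (e.symm Ψ).1.1 ∈ T.domain := by
    rw [← h1]
    exact Φ.2
  have h5 : Φ = ⟨(e.symm Ψ).1.1, h4⟩ := Subtype.ext h1
  rw [h5] at h3
  exact ⟨h4, h3⟩

/-! ### The deficiency vectors -/

theorem reSign_neg {ζ : ℂ} (hζ : ζ.re ≠ 0) : reSign (-ζ) = -reSign ζ := by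
  unfold reSign
  rcases lt_or_gt_of_ne hζ with h | h
  · simp [h, h.not_gt]
  · simp [h, h.not_gt]

/-- Both signs in the definition flip with `ζ`. This symmetry yields `Ğ_ζ = -G_{-ζ}`, so one
eigenvector computation serves both families. -/
theorem green_neg (P : Params n) {ζ : ℂ} (hζ : ζ.re ≠ 0) (x : ℝ) :
    green P (-ζ) x = green P ζ x := by
  have h0 := ne_zero_of_re_ne_zero hζ
  rw [green, green, reSign_neg hζ, neg_mul_neg]
  congr 1
  field_simp

theorem green'_neg (P : Params n) {ζ : ℂ} (hζ : ζ.re ≠ 0) (x : ℝ) :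
    green' P (-ζ) x = green' P ζ x := by
  rw [green', green', reSign_neg hζ, neg_mul_neg]

/-- The oscillator frequencies are real: `ζ² = -K/M` forces `ζ` to be imaginary. -/
theorem oscillator_ne_zero (P : Params n) {ζ : ℂ} (hζ : ζ.re ≠ 0) (j : Fin n) :
    (P.K j : ℂ) + ζ ^ 2 * P.M j ≠ 0 := by
  intro h
  have hK := P.K_pos j
  have hM := P.M_pos j
  have h1 := congrArg Complex.re h
  have h2 := congrArg Complex.im h
  simp only [pow_two, Complex.add_re, Complex.add_im, Complex.mul_re, Complex.mul_im,
    Complex.ofReal_re, Complex.ofReal_im, Complex.zero_re, Complex.zero_im, mul_zero, sub_zero,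
    zero_add] at h1 h2
  have h3 : ζ.im = 0 := by
    have : 2 * P.M j * ζ.re * ζ.im = 0 := by linarith
    rcases mul_eq_zero.1 this with h | h
    · exact absurd h (by positivity)
    · exact h
  rw [h3] at h1
  have : 0 < ζ.re * ζ.re := mul_self_pos.2 hζ
  nlinarith [mul_pos this hM]

/-- This is where `Γ` comes from: its `i`-th row consists of `z_j - v(s_j)` for the eigenvector
`G^i` of `B` with unit jump at `s_i`. The exponential is the field at `s_j`, the diagonal term the
velocity of the `i`-th oscillator. -/
theorem vecG_maximalRel (P : Params n) {ζ : ℂ} (hζ : ζ.re ≠ 0) (i : Fin n) :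
    (vecG P hζ i, ζ • vecG P hζ i, (Pi.single i 1 : Fin n → ℂ), fun j => -gammaMatrix P ζ i j)
      ∈ maximalRel P := by
  classical
  have ha := a_ne_zero P
  have hr := ρ₀_ne_zero P
  have h0 := ne_zero_of_re_ne_zero hζ
  have c1 := (memLp_green P hζ (P.s i)).coeFn_toLp
  have c2 := (memLp_green' P hζ (P.s i)).coeFn_toLp
  refine ⟨(-(ζ ^ 2 / P.a ^ 2) : ℂ) • (memLp_green P hζ (P.s i)).toLp,
    (ζ / (P.a ^ 2 * P.ρ₀) : ℂ) • (memLp_green' P hζ (P.s i)).toLp, ?_, ?_, fun j => ?_, ?_⟩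
  · refine (isPrimitive_green'_sub_sign P hζ (P.s i)).hasWeakDerivOn.congr ?_ ?_
    · filter_upwards [c2, Lp.coeFn_neg (memLp_green' P hζ (P.s i)).toLp] with x h2 h3
      rw [regularPart, Finset.sum_eq_single i (fun j _ hj => by simp [hj]) (by simp)]
      simp only [vecG, State.p_mk, h3, Pi.neg_apply, h2, Pi.single_eq_same]
      ring
    · filter_upwards [c1, Lp.coeFn_smul (-(ζ ^ 2 / P.a ^ 2) : ℂ)
        (memLp_green P hζ (P.s i)).toLp] with x h2 h3
      rw [h3, Pi.smul_apply, h2, smul_eq_mul]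
  · refine HasWeakDerivOn.smul_coe _ ?_
    exact (isPrimitive_green P hζ (P.s i)).hasWeakDerivOn.congr c1.symm c2.symm
  · have hl : HasEssLimit (memLp_green P hζ (P.s i)).toLp (𝓝 (P.s j)) (green P ζ (P.s j - P.s i)) :=
      (HasEssLimit.of_tendsto ((isPrimitive_green P hζ (P.s i)).continuous.tendsto (P.s j))).congr
        c1.symm
    have hl' := hl.smul_coe (ζ / (P.a ^ 2 * P.ρ₀) : ℂ)
    have e : (vecG P hζ i).z j + -gammaMatrix P ζ i j
        = (ζ / (P.a ^ 2 * P.ρ₀) : ℂ) * green P ζ (P.s j - P.s i) := by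
      have hd := oscillator_ne_zero P hζ j
      simp only [vecG, State.z_mk, gammaMatrix, Matrix.of_apply, green, abs_sub_comm (P.s j)]
      by_cases hij : i = j
      · subst hij
        simp only [Pi.single_eq_same, if_true]
        field_simp
        ring
      · rw [Pi.single_eq_of_ne (Ne.symm hij), if_neg hij]
        field_simp
        ring
    rw [← e] at hl'
    exact hl'
  · refine State.ext' ?_ ?_ ?_ ?_
    · simp only [vecG, State.p_smul, State.p_mk, smul_smul, smul_neg, ← neg_smul]
      congr 1
      field_simp
    · simp only [vecG, State.v_smul, State.v_mk, smul_smul]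
      congr 1
      field_simp
    · simp only [vecG, State.y_smul, State.y_mk, State.z_mk, ← Pi.single_smul]
      congr 1
      simp only [smul_eq_mul]
      ring
    · funext j
      have hd := oscillator_ne_zero P hζ j
      have hM := M_ne_zero P j
      by_cases hij : j = i
      · subst hij
        simp only [vecG, State.z_smul, State.z_mk, State.y_mk, Pi.smul_apply, Pi.single_eq_same,
          smul_eq_mul]
        field_simp
        ring
      · simp [vecG, hij]

theorem vecGbreve_eq_neg_vecG (P : Params n) {ζ : ℂ} (hζ : ζ.re ≠ 0) (hζ' : (-ζ).re ≠ 0)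
    (j : Fin n) : vecGbreve P hζ j = (-1 : ℂ) • vecG P hζ' j := by
  have e1 : (memLp_green P hζ' (P.s j)).toLp = (memLp_green P hζ (P.s j)).toLp :=
    MemLp.toLp_congr _ _ (ae_of_all _ fun x => green_neg P hζ _)
  have e2 : (memLp_green' P hζ' (P.s j)).toLp = (memLp_green' P hζ (P.s j)).toLp :=
    MemLp.toLp_congr _ _ (ae_of_all _ fun x => green'_neg P hζ _)
  refine State.ext' ?_ ?_ ?_ ?_
  · simp only [vecG, vecGbreve, State.p_smul, State.p_mk, e2]
    rw [neg_one_smul, neg_neg]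
  · simp only [vecG, vecGbreve, State.v_smul, State.v_mk, e1, smul_smul]
    congr 1
    ring
  · simp only [vecG, vecGbreve, State.y_smul, State.y_mk, ← Pi.single_smul]
    congr 1
    rw [neg_sq, smul_eq_mul]
    ring
  · simp only [vecG, vecGbreve, State.z_smul, State.z_mk, ← Pi.single_smul]
    congr 1
    rw [neg_sq, smul_eq_mul]
    ring

/-- `Ğ_ζ` is an eigenvector of `B` for `-ζ`. Its slips stay unspecified because it is only paired
with jump-free states. -/
theorem vecGbreve_maximalRel (P : Params n) {ζ : ℂ} (hζ : ζ.re ≠ 0) (j : Fin n) :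
    ∃ δ, (vecGbreve P hζ j, -(ζ • vecGbreve P hζ j), (Pi.single j (-1) : Fin n → ℂ), δ)
      ∈ maximalRel P := by
  have hζ' : (-ζ).re ≠ 0 := by simpa using hζ
  have h := (maximalRel P).smul_mem (-1) (vecG_maximalRel P hζ' j)
  refine ⟨(-1 : ℂ) • fun k => -gammaMatrix P (-ζ) j k, ?_⟩
  rw [vecGbreve_eq_neg_vecG P hζ hζ']
  convert h using 1
  simp only [Prod.smul_mk, ← Pi.single_smul, smul_eq_mul, mul_one]
  congr 2
  rw [smul_smul, smul_smul, ← neg_smul]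
  congr 1
  ring

theorem sum_vecG_maximalRel (P : Params n) {ζ : ℂ} (hζ : ζ.re ≠ 0) (c : Fin n → ℂ) :
    (∑ i, c i • vecG P hζ i, ζ • ∑ i, c i • vecG P hζ i, c, -Matrix.vecMul c (gammaMatrix P ζ))
      ∈ maximalRel P := by
  classical
  have h := Submodule.sum_mem (maximalRel P) (t := Finset.univ) fun i _ =>
    (maximalRel P).smul_mem (c i) (vecG_maximalRel P hζ i)
  convert h using 1
  refine Prod.ext ?_ (Prod.ext ?_ (Prod.ext ?_ ?_))
  · simp [Prod.fst_sum]
  · simp only [Prod.fst_sum, Prod.snd_sum, Prod.smul_snd, Prod.smul_fst, Finset.smul_sum]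
    exact Finset.sum_congr rfl fun i _ => smul_comm _ _ _
  · funext j
    simp [Prod.fst_sum, Prod.snd_sum, Finset.sum_apply, Pi.single_apply]
  · funext j
    simp [Prod.snd_sum, Finset.sum_apply, Matrix.vecMul, dotProduct]

/-- If `c Γ = 0`, then `∑ c_i G^i` has no slips and is an eigenvector of `Â` for `ζ`. It vanishes by
skew-adjointness, and so do its jumps `c`. -/
theorem isUnit_det_gammaMatrix (P : Params n) {ζ : ℂ} (hζ : ζ.re ≠ 0) :
    IsUnit (gammaMatrix P ζ).det := by
  rw [isUnit_iff_ne_zero]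
  intro hdet
  obtain ⟨c, hc, h0⟩ := Matrix.exists_vecMul_eq_zero_iff.2 hdet
  have h := sum_vecG_maximalRel P hζ c
  rw [h0, neg_zero] at h
  obtain ⟨hm, e⟩ := pointGen_apply_of_maximalRel h
  have hz := (isSkewAdjoint_pointGen P).eq_zero_of_apply hζ ⟨_, hm⟩ (by rw [e, neg_add_cancel])
  simp only at hz
  rw [hz] at h
  exact hc (maximalRel_unique h (maximalRel P).zero_mem).2.1

/-- Slips arise from `Γ` acting on row vectors, whereas the resolvent formula applies `Γ⁻¹` to
column vectors; symmetry reconciles the two. -/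
theorem gammaMatrix_transpose (P : Params n) (ζ : ℂ) :
    (gammaMatrix P ζ).transpose = gammaMatrix P ζ := by
  ext i j
  simp only [Matrix.transpose_apply, gammaMatrix, Matrix.of_apply, abs_sub_comm (P.s i)]
  by_cases hij : i = j
  · rw [hij]
  · rw [if_neg hij, if_neg (Ne.symm hij)]
    simp

/-- Krein's formula for the resolvent of `Â`. -/
theorem isResolvent_pointGen (P : Params n) {ζ : ℂ} (hζ : ζ.re ≠ 0) {R : State P →L[ℂ] State P}
    (hR : IsResolvent (freeGen P) ζ R) : IsResolvent (pointGen P) ζ (R + kreinTerm P hζ) := by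
  refine (isSkewAdjoint_pointGen P).isResolvent_of_right hζ fun Ψ => ?_
  obtain ⟨hm, e⟩ := hR.1 Ψ
  obtain ⟨ε, hΦ⟩ := freeGen_maximalRel ⟨R Ψ, hm⟩
  have eA : freeGen P ⟨R Ψ, hm⟩ = ζ • R Ψ - Ψ := by
    refine Eq.trans ?_ (congrArg (ζ • R Ψ - ·) e)
    abel
  rw [eA] at hΦ
  -- In Green's identity between `Ğ^k_{ζ̄}` and `R Ψ` the terms with `ζ` cancel, which leaves
  -- `-⟨⟨Ğ^k, Ψ⟩⟩ = -ε_k`.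
  have hε : ∀ k, inner ℂ (vecGbreve P (conj_re_ne_zero hζ) k) Ψ = ε k := fun k => by
    obtain ⟨δ, hk⟩ := vecGbreve_maximalRel P (conj_re_ne_zero hζ) k
    have key := green_identity hk hΦ
    rw [Finset.sum_eq_single k (fun i _ hi => by simp [hi]) (by simp), inner_neg_left,
      inner_smul_left, inner_sub_right, inner_smul_right, Complex.conj_conj] at key
    simp only [Pi.single_eq_same, map_neg, map_one, Pi.zero_apply, mul_zero, zero_add] at key
    linear_combination -key
  have hK : kreinTerm P hζ Ψ
      = ∑ i, Matrix.mulVec (gammaMatrix P ζ)⁻¹ ε i • vecG P hζ i := by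
    simp only [kreinTerm, sum_apply, smul_apply,
      InnerProductSpace.rankOne_apply, hε, smul_smul, ← Finset.sum_smul, Matrix.mulVec, dotProduct]
  have hsum := (maximalRel P).add_mem hΦ
    (sum_vecG_maximalRel P hζ (Matrix.mulVec (gammaMatrix P ζ)⁻¹ ε))
  -- With the coefficients `Γ⁻¹ ε` the slips of the correction are `-ε`, so the sum has no slips and
  -- lies in the domain of `Â`.
  have hv : Matrix.vecMul (Matrix.mulVec (gammaMatrix P ζ)⁻¹ ε) (gammaMatrix P ζ) = ε := by
    rw [← Matrix.mulVec_transpose, gammaMatrix_transpose, Matrix.mulVec_mulVec,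
      Matrix.mul_nonsing_inv _ (isUnit_det_gammaMatrix P hζ), Matrix.one_mulVec]
  rw [← hK, hv] at hsum
  simp only [Prod.mk_add_mk, add_neg_cancel] at hsum
  obtain ⟨hm', e'⟩ := pointGen_apply_of_maximalRel hsum
  refine ⟨hm', ?_⟩
  change -pointGen P ⟨R Ψ + kreinTerm P hζ Ψ, hm'⟩ + ζ • (R Ψ + kreinTerm P hζ Ψ) = Ψ
  rw [e', smul_add]
  abel

end Acoustic

/-! ### Assembly of the theorem, with `pointGen` as `Â`. -/

theorem theorem1 {n : ℕ} (P : Params n) :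
    ∃ Ahat : State P →ₗ.[ℂ] State P,
      -- domain and action of `Â`
      IsPointInteractionGen P Ahat ∧
      -- `Â` is a local, real and skew-adjoint extension of `A₀`, and the only one
      (∀ T : State P →ₗ.[ℂ] State P,
        (restrictedGen P ≤ T ∧ IsSkewAdjoint T ∧ IsReal T ∧ IsLocal T) ↔ T = Ahat) ∧
      -- the extensions with local conditions that may leave some oscillators free: at each wall,
      -- either the oscillator is free or the kinematic condition of `Â` holds
      (∀ T : State P →ₗ.[ℂ] State P,
        restrictedGen P ≤ T → IsSkewAdjoint T → IsReal T → HasLocalConditions T →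
          ∀ j, IsDecoupled T j ∨ ∀ Ψ ∈ T.domain, HasEssLimit Ψ.v (nhds (P.s j)) (Ψ.z j)) ∧
      -- `A` is the only skew-adjoint extension of `A₀` that decouples all oscillators; it is real
      -- and has (trivially) local conditions
      (∀ T : State P →ₗ.[ℂ] State P,
        (restrictedGen P ≤ T ∧ IsSkewAdjoint T ∧ ∀ j, IsDecoupled T j) ↔ T = freeGen P) ∧
      IsReal (freeGen P) ∧ HasLocalConditions (freeGen P) ∧
      -- the resolvent of `Â`
      ∀ (ζ : ℂ) (hζ : ζ.re ≠ 0), IsUnit (gammaMatrix P ζ).det ∧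
        ∃ R : State P →L[ℂ] State P, IsResolvent (freeGen P) ζ R ∧
          IsResolvent Ahat ζ (R + kreinTerm P hζ) := by
  refine ⟨pointGen P, isPointInteractionGen_pointGen P, fun T => ⟨?_, ?_⟩,
    fun T hT hs hr hl j => isDecoupled_or_kinematic hT hs hr hl j, fun T => ⟨?_, ?_⟩,
    isReal_freeGen P, hasLocalConditions_freeGen P,
    fun ζ hζ => ⟨isUnit_det_gammaMatrix P hζ, ?_⟩⟩
  · rintro ⟨hT, hs, hr, hl⟩
    exact eq_pointGen_of_isLocal hT hs hr hl
  · rintro rfl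
    exact ⟨restrictedGen_le_pointGen P, isSkewAdjoint_pointGen P, isReal_pointGen P,
      isLocal_pointGen P⟩
  · rintro ⟨hT, hs, hd⟩
    exact eq_freeGen_of_isDecoupled hT hs hd
  · rintro rfl
    exact ⟨restrictedGen_le_freeGen P, isSkewAdjoint_freeGen P, isDecoupled_freeGen P⟩
  · obtain ⟨R, hR⟩ := (isSkewAdjoint_freeGen P).exists_isResolvent hζ
    exact ⟨R, hR, isResolvent_pointGen P hζ hR⟩
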